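/- Let $n\ge 2$ and $0<\alpha<1$, and put $2^*_\alpha=\frac{2n}{n-2\alpha}$, $q=\frac{n+2\alpha}{n-2\alpha}$. Let $V:\mathbb R^n\to\mathbb R$ be continuous with $V\ge V_0$ for a constant $V_0>0$ and $V(x)\to\infty$ as $|x|\to\infty$. Let $H^\alpha_V$ be the space of real $u\in L^2(\mathbb R^n)$ with $\iint\frac{|u(x)-u(z)|^2}{|x-z|^{n+2\alpha}}\,dx\,dz<\infty$ and $\int Vu^2\,dx<\infty$, with inner product $$\langle u,w\rangle_V=\iint\frac{(u(x)-u(z))(w(x)-w(z))}{|x-z|^{n+2\alpha}}\,dx\,dz+\int Vuw\,dx$$ and norm $\|u\|_V=\langle u,u\rangle_V^{1/2}$. Let $C_e$ be the Sobolev constant, i.e. the least constant with $\|u\|_{L^2}\le C_e\|u\|_V$ and $\|u\|_{L^{2^*_\alpha}}\le C_e\|u\|_V$ for all $u\in H^\alpha_V$. Let $f:\mathbb R\to\mathbb R$ be continuous with $f(0)=0$, $f(t)=o(|t|)$ as $t\to0$, $f(t)=o(|t|^{q})$ as $|t|\to\infty$, and suppose that for some $\mu>2$, with $F(t)=\int_0^tf(s)\,ds$,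 one has $0<\mu F(t)\le tf(t)$ for all $t\ne0$. Let $0<\varepsilon<\frac1{2C_e^2}$, let $0<\delta\le\rho$ be such that $|f(t)|\le\varepsilon|t|$ for $|t|\le\delta$ and $|f(t)|\le\varepsilon|t|^{q}$ for $|t|\ge\rho$, put $K_\varepsilon=\delta^{-q}\max_{\delta\le|t|\le\rho}|f(t)|$, and let $\varrho>0$. Let $h\in L^2(\mathbb R^n)$, $h\not\equiv0$, with $$\|h\|_{L^2}<\frac{\varrho}{C_e}\Bigl(\tfrac12-\varepsilon C_e^2-(\varepsilon+K_\varepsilon)C_e^{2^*_\alpha}\varrho^{2^*_\alpha-2}\Bigr).$$ Then the equation $(-\Delta)^\alpha u+Vu=f(u)+h$ on $\mathbb R^n$ has at least two distinct weak solutions $u_1,u_2\in H^\alpha_V$, where $u\in H^\alpha_V$ is a weak solution if $\langle u,w\rangle_V=\int(f(u)+h)w\,dx$ for all $w\in H^\alpha_V$. Moreover, $u_1$ and $u_2$ can be chosen to be critical points of $I(u)=\frac12\|u\|_V^2-\int F(u)\,dx-\int hu\,dx$ on $H^\alpha_V$ such that $$I(u_1)=\inf_{\gamma\in\Gamma}\max_{t\in[0,1]}I(\gamma(t))>0,$$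 with $\Gamma=\{\gamma\in C([0,1],H^\alpha_V):\gamma(0)=0,\ \|\gamma(1)\|_V>\varrho,\ I(\gamma(1))\le0\}$ (which is non-empty), and $\|u_2\|_V<\varrho$, $I(u_2)=\min_{\|w\|_V\le\varrho}I(w)\le0$. -/

import Mathlib

open MeasureTheory Filter Topology Asymptotics

namespace FracSchrodinger

/-- Euclidean space `ℝⁿ`. -/
abbrev E (n : ℕ) : Type := EuclideanSpace ℝ (Fin n)

/-- The critical exponent `2*_α = 2n / (n - 2α)`. -/
noncomputable def critExp (n : ℕ) (α : ℝ) : ℝ := 2 * n / (n - 2 * α)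

/-- The growth exponent `(n + 2α) / (n - 2α) = 2*_α - 1`. -/
noncomputable def growthExp (n : ℕ) (α : ℝ) : ℝ := (n + 2 * α) / (n - 2 * α)

/-- `u ∈ H^α(ℝⁿ)`: `u ∈ L²` and the Gagliardo double integral is finite. -/
def MemH {n : ℕ} (α : ℝ) (u : E n → ℝ) : Prop :=
  MemLp u 2 volume ∧
    Integrable (fun p : E n × E n => (u p.1 - u p.2) ^ 2 / ‖p.1 - p.2‖ ^ ((n : ℝ) + 2 * α))
      (volume.prod volume)

/-- `u ∈ H^α_V(ℝⁿ)`: `u ∈ H^α(ℝⁿ)` and `∫ V u² < ∞`. Functions are not identified when they agree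
almost everywhere; the results below speak of a.e. equality explicitly. -/
def MemHV {n : ℕ} (α : ℝ) (V : E n → ℝ) (u : E n → ℝ) : Prop :=
  MemH α u ∧ Integrable (fun x => V x * u x ^ 2) volume

/-- The inner product `⟨u, w⟩_V` of `H^α_V(ℝⁿ)`. -/
noncomputable def innerV {n : ℕ} (α : ℝ) (V : E n → ℝ) (u w : E n → ℝ) : ℝ :=
  (∫ p : E n × E n, (u p.1 - u p.2) * (w p.1 - w p.2) / ‖p.1 - p.2‖ ^ ((n : ℝ) + 2 * α)
    ∂(volume.prod volume)) + ∫ x, V x * u x * w x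

/-- The norm `‖u‖_V` of `H^α_V(ℝⁿ)`. -/
noncomputable def normV {n : ℕ} (α : ℝ) (V : E n → ℝ) (u : E n → ℝ) : ℝ :=
  Real.sqrt (innerV α V u u)

/-- The Sobolev constant `C_e`: the least `C ≥ 0` such that `‖u‖_{L²} ≤ C ‖u‖_V` and
`‖u‖_{L^{2*_α}} ≤ C ‖u‖_V` for all `u ∈ H^α_V(ℝⁿ)`. -/
noncomputable def sobolevConst {n : ℕ} (α : ℝ) (V : E n → ℝ) : ℝ :=
  sInf {C : ℝ | 0 ≤ C ∧ ∀ u : E n → ℝ, MemHV α V u →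
    eLpNorm u 2 volume ≤ ENNReal.ofReal (C * normV α V u) ∧
    eLpNorm u (ENNReal.ofReal (critExp n α)) volume ≤ ENNReal.ofReal (C * normV α V u)}

/-- The primitive `F(t) = ∫₀ᵗ f(s) ds`. -/
noncomputable def primitive (f : ℝ → ℝ) (t : ℝ) : ℝ := ∫ s in (0 : ℝ)..t, f s

/-- `K_ε = δ^{-q} max_{δ ≤ |t| ≤ ρ} |f(t)|`; used with `q = (n + 2α) / (n - 2α)` and `0 < δ ≤ ρ`. -/
noncomputable def growthConst (f : ℝ → ℝ) (q δ ρ : ℝ) : ℝ :=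
  δ ^ (-q) * sSup ((fun t => |f t|) '' {t : ℝ | δ ≤ |t| ∧ |t| ≤ ρ})

/-- The energy functional `I(u) = ½‖u‖_V² - ∫ F(u) - ∫ h u`. -/
noncomputable def energy {n : ℕ} (α : ℝ) (V : E n → ℝ) (f : ℝ → ℝ) (h : E n → ℝ)
    (u : E n → ℝ) : ℝ :=
  normV α V u ^ 2 / 2 - (∫ x, primitive f (u x)) - ∫ x, h x * u x

/-- Weak solutions in `H^α_V(ℝⁿ)` of `(-Δ)^α u + V u = f(u) + h`. -/
def IsWeakSolution {n : ℕ} (α : ℝ) (V : E n → ℝ) (f : ℝ → ℝ) (h : E n → ℝ)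
    (u : E n → ℝ) : Prop :=
  MemHV α V u ∧ ∀ w : E n → ℝ, MemHV α V w →
    Integrable (fun x => (f (u x) + h x) * w x) volume ∧
    innerV α V u w = ∫ x, (f (u x) + h x) * w x

/-- `u` is a critical point of the energy on `H^α_V(ℝⁿ)`: the Fréchet derivative at `u` exists
and vanishes, i.e. `I(u + w) - I(u) = o(‖w‖_V)`. -/
def IsCriticalPt {n : ℕ} (α : ℝ) (V : E n → ℝ) (f : ℝ → ℝ) (h : E n → ℝ)
    (u : E n → ℝ) : Prop :=
  MemHV α V u ∧ ∀ c > 0, ∃ r > 0, ∀ w : E n → ℝ, MemHV α V w → normV α V w < r →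
    |energy α V f h (u + w) - energy α V f h u| ≤ c * normV α V w

/-- The admissible paths of the mountain pass: continuous `γ : [0,1] → H^α_V(ℝⁿ)` with
`γ(0) = 0`, `‖γ(1)‖_V > r` and `I(γ(1)) ≤ 0`. -/
def IsMountainPath {n : ℕ} (α : ℝ) (V : E n → ℝ) (f : ℝ → ℝ) (h : E n → ℝ) (r : ℝ)
    (γ : ℝ → E n → ℝ) : Prop :=
  (∀ t ∈ Set.Icc (0 : ℝ) 1, MemHV α V (γ t)) ∧
  (∀ t ∈ Set.Icc (0 : ℝ) 1,
    Tendsto (fun s => normV α V (γ s - γ t)) (𝓝[Set.Icc (0 : ℝ) 1] t) (𝓝 0)) ∧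
  γ 0 =ᵐ[volume] 0 ∧ r < normV α V (γ 1) ∧ energy α V f h (γ 1) ≤ 0

/-- `c = inf_γ max_{t ∈ [0,1]} I(γ(t))` over the admissible paths. Being a greatest lower bound in
`ℝ`, this includes that admissible paths exist. -/
def IsMountainPassLevel {n : ℕ} (α : ℝ) (V : E n → ℝ) (f : ℝ → ℝ) (h : E n → ℝ) (r c : ℝ) :
    Prop :=
  IsGLB {m : ℝ | ∃ γ : ℝ → E n → ℝ, IsMountainPath α V f h r γ ∧
    IsGreatest ((fun t => energy α V f h (γ t)) '' Set.Icc (0 : ℝ) 1) m} c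

end FracSchrodinger

/-! The energy is `½‖u‖²` minus a potential that is compact with respect to the `L²` norm, and the
two solutions come from its two natural critical points. The threshold on `h` says exactly that `I ≥
β > 0` on the sphere `‖u‖_V = ϱ`. Since `I(0) = 0`, and since the Ambrosetti–Rabinowitz condition
gives `F(st) ≥ s^μ F(t)` for `s ≥ 1`, so that `I ≤ 0` far out on some ray, there is a mountain pass
around the origin. Its level is positive, whereas the minimum of `I` on the ball is at most `0`.
That minimum is not on the sphere, so it is a critical point, and the signs of the energies separate
the two solutions.

Three ingredients carry the analysis.

Compactness: `V → ∞` controls the `L²` mass far away, and the Gagliardo seminorm controls the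
deviation from averages over small balls. The embedding into `L²` is thus a norm limit of finite
rank operators (`isCompactOperator_toL2`). The same estimate on a ball centred at the point, with
its radius optimised, proves the fractional Sobolev inequality (`exists_sobolev`).

The critical exponent: `L^{2*}` compactness is never needed. As `f` is negligible against `|t|` at
`0` and against `|t|^q` at infinity, one has `|f(s) - f(t)| ≤ η(|s| + |t| + |s|^q + |t|^q) + C|s -
t|` for every `η > 0` (`exists_abs_sub_le`). On bounded sets the first part integrates to something
small and the second is an `L²` distance. Differentiability, Palais–Smale and the existence of a
minimiser all rest on this splitting.

Critical point theory: Ekeland's principle on the space of paths yields almost critical points near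
the minimax level (`exists_almost_critical`), and Palais–Smale turns them into a critical point
(`mountain_pass`). The minimiser comes from the parallelogram law and compactness, without weak
limits (`exists_min_closedBall`).

All of this takes place in an abstract Hilbert space with an embedding into `L² ∩ L^{q+1}`
(`LebesgueEmbedding`). The concrete space is realised as a closed subspace of `L² × L²`
(`energySpace`). -/

namespace FracSchrodinger

/-! ### Ekeland's principle in complete metric spaces -/

/-- Ekeland's variational principle. -/
theorem ekeland {X : Type*} [MetricSpace X] [CompleteSpace X] {Φ : X → ℝ} (hc : Continuous Φ)
    (hb : BddBelow (Set.range Φ)) (x₀ : X) {η : ℝ} (hη : 0 < η) :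
    ∃ x, Φ x ≤ Φ x₀ ∧ ∀ y, Φ x ≤ Φ y + η * dist x y := by
  set S : X → Set X := fun x => {y | Φ y + η * dist x y ≤ Φ x} with hS
  have hself : ∀ x, x ∈ S x := fun x => by simp [hS]
  have htrans : ∀ {x y z}, y ∈ S x → z ∈ S y → z ∈ S x := by
    intro x y z hy hz
    simp only [hS, Set.mem_ofPred_eq] at *
    nlinarith [dist_triangle x y z]
  have hclosed : ∀ x, IsClosed (S x) := fun x =>
    isClosed_le (by fun_prop) continuous_const
  have hbS : ∀ x, BddBelow (Φ '' S x) := fun x => hb.mono (Set.image_subset_range _ _)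
  have hstep : ∀ (k : ℕ) (x : X), ∃ y ∈ S x, ∀ z ∈ S x, Φ y ≤ Φ z + (1 / 2 : ℝ) ^ k := by
    intro k x
    obtain ⟨_, ⟨y, hy, rfl⟩, hlt⟩ := exists_lt_of_csInf_lt (s := Φ '' S x) ⟨_, x, hself x, rfl⟩
      (lt_add_of_pos_right (sInf (Φ '' S x)) (by positivity : (0 : ℝ) < (1 / 2) ^ k))
    refine ⟨y, hy, fun z hz => hlt.le.trans ?_⟩
    gcongr
    exact csInf_le (hbS x) ⟨z, hz, rfl⟩
  choose nxt hnxt hinf using hstep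
  let x : ℕ → X := fun k => Nat.rec x₀ (fun k y => nxt k y) k
  have hx : ∀ k, x (k + 1) = nxt k (x k) := fun k => rfl
  have hmem : ∀ k j, x (k + j) ∈ S (x k) := by
    intro k j
    induction j with
    | zero => exact hself _
    | succ j ih => exact htrans ih (by rw [← add_assoc, hx]; exact hnxt _ _)
  -- `S (x (k + 1))` lies in `S (x k)`, where `x (k + 1)` minimises `Φ` up to `2^{-k}`. The drop of
  -- `Φ` that membership demands therefore bounds the distance, and the nested sets shrink to one
  -- point.
  have hsmall : ∀ k, ∀ y ∈ S (x (k + 1)), dist (x (k + 1)) y ≤ (1 / 2 : ℝ) ^ k / η := by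
    intro k y hy
    have h1 := hinf k (x k) y (htrans (by simpa using hmem k 1) hy)
    rw [le_div_iff₀ hη]
    have h2 : Φ y + η * dist (x (k + 1)) y ≤ Φ (x (k + 1)) := hy
    rw [← hx] at h1
    linarith
  have hzero : Tendsto (fun k : ℕ => (1 / 2 : ℝ) ^ k / η) atTop (𝓝 0) := by
    simpa using (tendsto_pow_atTop_nhds_zero_of_lt_one (by norm_num : (0 : ℝ) ≤ 1 / 2)
      (by norm_num)).div_const η
  have hcau : CauchySeq fun k => x (k + 1) := by
    refine cauchySeq_of_le_tendsto_0' _ (fun k m hkm => hsmall k _ ?_) hzero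
    obtain ⟨j, rfl⟩ := Nat.exists_eq_add_of_le hkm
    have := hmem (k + 1) j
    rwa [show k + 1 + j = k + j + 1 by ring] at this
  obtain ⟨a, ha⟩ := cauchySeq_tendsto_of_complete hcau
  have haS : ∀ k, a ∈ S (x k) := fun k => by
    refine (hclosed (x k)).mem_of_tendsto ha ?_
    filter_upwards [eventually_ge_atTop k] with m hm
    obtain ⟨j, hj⟩ := Nat.exists_eq_add_of_le (hm.trans (Nat.le_succ m))
    rw [Nat.succ_eq_add_one] at hj
    rw [hj]
    exact hmem k j
  refine ⟨a, ?_, fun y => ?_⟩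
  · have : Φ a + η * dist x₀ a ≤ Φ x₀ := haS 0
    nlinarith [dist_nonneg (x := x₀) (y := a)]
  -- A violating `y` belongs to `S a`, hence to every `S (x k)`. These sets shrink to a single
  -- point, which forces `y = a`.
  · by_contra! hlt
    have hyS : y ∈ S a := hlt.le
    have hy : Tendsto (fun k => x (k + 1)) atTop (𝓝 y) := by
      rw [tendsto_iff_dist_tendsto_zero]
      exact squeeze_zero (fun _ => dist_nonneg) (fun k => hsmall k y (htrans (haS (k + 1)) hyS)) hzero
    have := tendsto_nhds_unique ha hy
    subst this
    simp at hlt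

/-! ### Minimax and minimisation in Hilbert space -/

section MountainPass

variable {H : Type*} [NormedAddCommGroup H] [InnerProductSpace ℝ H] [CompleteSpace H]

/-- A function on a segment: mean value theorem in terms of gradients. -/
theorem exists_inner_gradient_eq {I : H → ℝ} {g : H → H} (hI : ∀ u, HasGradientAt I (g u) u)
    (u v : H) {s : ℝ} (hs : 0 < s) :
    ∃ θ ∈ Set.Ioo 0 s, I (u + s • v) - I u = s * inner ℝ (g (u + θ • v)) v := by
  have hd : ∀ t : ℝ, HasDerivAt (fun t : ℝ => I (u + t • v)) (inner ℝ (g (u + t • v)) v) t := by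
    intro t
    have h1 : HasDerivAt (fun t : ℝ => u + t • v) v t := by
      simpa using ((hasDerivAt_id t).smul_const v).const_add u
    have h2 := (hI (u + t • v)).hasFDerivAt.comp_hasDerivAt t h1
    rw [InnerProductSpace.toDual_apply_apply] at h2
    exact h2
  obtain ⟨θ, hθ, h⟩ := exists_hasDerivAt_eq_slope (fun t : ℝ => I (u + t • v)) _ hs
    (fun t _ => (hd t).continuousAt.continuousWithinAt) (fun t _ => hd t)
  refine ⟨θ, hθ, ?_⟩
  rw [h, sub_zero, zero_smul, add_zero, mul_div_cancel₀ _ hs.ne']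

/-- If every path from `a` to `b` has to climb to the level `c > max (I a) (I b)`, then below the
maximum of any such path there is an almost critical point at height at least `c`. -/
theorem exists_almost_critical {I : H → ℝ} {g : H → H} (hI : ∀ u, HasGradientAt I (g u) u)
    (hg : Continuous g) {a b : H} {c m : ℝ} (ha : I a < c) (hb : I b < c)
    (hc : ∀ γ : C(unitInterval, H), γ 0 = a → γ 1 = b → ∃ t, c ≤ I (γ t))
    (γ₀ : C(unitInterval, H)) (h0 : γ₀ 0 = a) (h1 : γ₀ 1 = b) (hm : ∀ t, I (γ₀ t) ≤ m)
    {η : ℝ} (hη : 0 < η) : ∃ u, c ≤ I u ∧ I u ≤ m ∧ ‖g u‖ ≤ η := by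
  have hIc : Continuous I := continuous_iff_continuousAt.2 fun u => (hI u).continuousAt
  -- Fixing both endpoints cuts out a closed set of paths, which is complete in the uniform
  -- distance. Ekeland's principle is applied there to the maximum of `I` along the path.
  let X := {γ : C(unitInterval, H) // γ 0 = a ∧ γ 1 = b}
  have hXc : IsClosed {γ : C(unitInterval, H) | γ 0 = a ∧ γ 1 = b} :=
    (isClosed_eq (by fun_prop) continuous_const).inter (isClosed_eq (by fun_prop) continuous_const)
  have : CompleteSpace X := hXc.completeSpace_coe
  let Φ : X → ℝ := fun γ => sSup ((fun t => I (γ.1 t)) '' Set.univ)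
  have hΦc : Continuous Φ := by
    refine isCompact_univ.continuous_sSup (f := fun (γ : X) t => I (γ.1 t)) ?_
    have : Continuous fun p : X × unitInterval => p.1.1 p.2 := by
      have h1 : Continuous fun p : C(unitInterval, H) × unitInterval => p.1 p.2 := by fun_prop
      exact h1.comp ((continuous_subtype_val.comp continuous_fst).prodMk continuous_snd)
    exact hIc.comp this
  have hbdd : ∀ γ : X, BddAbove ((fun t => I (γ.1 t)) '' Set.univ) := fun γ =>
    (isCompact_univ.image (hIc.comp γ.1.continuous)).bddAbove
  have hle : ∀ (γ : X) t, I (γ.1 t) ≤ Φ γ := fun γ t => le_csSup (hbdd γ) ⟨t, trivial, rfl⟩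
  have hmax : ∀ γ : X, ∃ t, I (γ.1 t) = Φ γ := fun γ => by
    obtain ⟨t, -, ht⟩ := (isCompact_univ.image (hIc.comp γ.1.continuous)).sSup_mem
      (Set.univ_nonempty.image _)
    exact ⟨t, ht⟩
  have hcΦ : ∀ γ : X, c ≤ Φ γ := fun γ => by
    obtain ⟨t, ht⟩ := hc γ.1 γ.2.1 γ.2.2
    exact ht.trans (hle γ t)
  obtain ⟨γ, hγ₀, hγ⟩ := ekeland hΦc ⟨c, by rintro _ ⟨γ, rfl⟩; exact hcΦ γ⟩
    (⟨γ₀, h0, h1⟩ : X) hη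
  have hγm : Φ γ ≤ m := hγ₀.trans (csSup_le (Set.univ_nonempty.image _)
    (by rintro _ ⟨t, -, rfl⟩; exact hm t))
  set m' := max (I a) (I b) with hm'
  have hm'c : 0 < c - m' := sub_pos.2 (max_lt ha hb)
  -- The cutoff is `1` at heights at least `c` and `0` up to the height of the higher endpoint, so
  -- the deformation below keeps the endpoints fixed.
  let χ : unitInterval → ℝ := fun t => max 0 (min 1 ((I (γ.1 t) - m') / (c - m')))
  have hIγ : Continuous fun t => I (γ.1 t) := hIc.comp γ.1.continuous
  have hχc : Continuous χ :=
    continuous_const.max (continuous_const.min ((hIγ.sub continuous_const).div_const _))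
  have hχ0 : ∀ t, 0 ≤ χ t := fun t => le_max_left _ _
  have hχ1 : ∀ t, χ t ≤ 1 := fun t => max_le zero_le_one (min_le_left _ _)
  have hχz : ∀ t, I (γ.1 t) ≤ m' → χ t = 0 := fun t ht =>
    max_eq_left ((min_le_right _ _).trans (div_nonpos_of_nonpos_of_nonneg (by linarith) hm'c.le))
  have hχo : ∀ t, c ≤ I (γ.1 t) → χ t = 1 := fun t ht => by
    have : min 1 ((I (γ.1 t) - m') / (c - m')) = 1 :=
      min_eq_left ((one_le_div hm'c).2 (by linarith))
    simp [χ, this]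
  have hpos : ∀ t, 0 < max ‖g (γ.1 t)‖ η := fun t => lt_max_of_lt_right hη
  have hgγ : Continuous fun t => g (γ.1 t) := hg.comp γ.1.continuous
  -- Dividing by `max ‖g‖ η` instead of `‖g‖` keeps the field continuous at zeros of the gradient
  -- and of norm at most `1`. Where `‖g‖ > η` and `χ = 1` it is the unit descent direction.
  let v : C(unitInterval, H) :=
    ⟨fun t => (-(χ t / max ‖g (γ.1 t)‖ η)) • g (γ.1 t),
      ((hχc.div (hgγ.norm.max continuous_const) fun t => (hpos t).ne').neg).smul hgγ⟩
  have hv : ∀ t, ‖v t‖ ≤ 1 := fun t => by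
    change ‖(-(χ t / max ‖g (γ.1 t)‖ η)) • g (γ.1 t)‖ ≤ 1
    rw [norm_smul, norm_neg, Real.norm_of_nonneg (div_nonneg (hχ0 t) (hpos t).le), div_mul_eq_mul_div,
      div_le_one (hpos t)]
    calc χ t * ‖g (γ.1 t)‖ ≤ 1 * ‖g (γ.1 t)‖ := by gcongr; exact hχ1 t
      _ ≤ _ := by rw [one_mul]; exact le_max_left _ _
  have hv0 : v 0 = 0 := by
    change (-(χ 0 / max ‖g (γ.1 0)‖ η)) • g (γ.1 0) = 0
    rw [hχz 0 (by rw [γ.2.1]; exact le_max_left _ _)]; simp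
  have hv1 : v 1 = 0 := by
    change (-(χ 1 / max ‖g (γ.1 1)‖ η)) • g (γ.1 1) = 0
    rw [hχz 1 (by rw [γ.2.2]; exact le_max_right _ _)]; simp
  let pert : ℝ → X := fun s => ⟨γ.1 + s • v, by simp [hv0, γ.2.1], by simp [hv1, γ.2.2]⟩
  have hdist : ∀ s, 0 < s → dist γ (pert s) ≤ s := fun s hs => by
    change dist γ.1 (γ.1 + s • v) ≤ s
    rw [dist_eq_norm, sub_add_cancel_left, norm_neg, norm_smul, Real.norm_of_nonneg hs.le]
    calc s * ‖v‖ ≤ s * 1 := by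
          gcongr; exact (ContinuousMap.norm_le _ zero_le_one).2 hv
      _ = s := mul_one s
  -- By Ekeland's principle, moving the path by `s • v` lowers its maximum by at most `η s`. At a
  -- maximum point `t` of the moved path, `I (γ t) ≤ Φ γ`, so the mean value theorem bounds the
  -- slope there below by `-η`.
  have hkey : ∀ k : ℕ, ∃ (t : unitInterval) (θ : ℝ), 0 < θ ∧ θ < 1 / ((k : ℝ) + 1) ∧
      -η ≤ inner ℝ (g (γ.1 t + θ • v t)) (v t) ∧
      Φ γ - η * (1 / ((k : ℝ) + 1)) ≤ I (γ.1 t + (1 / ((k : ℝ) + 1)) • v t) := by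
    intro k
    have hs : (0 : ℝ) < 1 / ((k : ℝ) + 1) := by positivity
    set s : ℝ := 1 / ((k : ℝ) + 1)
    obtain ⟨t, ht⟩ := hmax (pert s)
    have e1 : I ((pert s).1 t) = I (γ.1 t + s • v t) := rfl
    obtain ⟨θ, hθ, hmv⟩ := exists_inner_gradient_eq hI (γ.1 t) (v t) hs
    have e2 := hγ (pert s)
    have e3 : η * dist γ (pert s) ≤ η * s := by gcongr; exact hdist s hs
    refine ⟨t, θ, hθ.1, hθ.2, ?_, by linarith⟩
    have e4 := hle γ t
    by_contra! hcon
    nlinarith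
  choose t θ hθ0 hθ1 hin hval using hkey
  obtain ⟨τ, φ, hφ, hτ⟩ := CompactSpace.tendsto_subseq t
  have hone : Tendsto (fun k => 1 / ((φ k : ℝ) + 1)) atTop (𝓝 0) :=
    tendsto_one_div_add_atTop_nhds_zero_nat.comp hφ.tendsto_atTop
  have hθt : Tendsto (fun k => θ (φ k)) atTop (𝓝 0) :=
    squeeze_zero (fun k => (hθ0 _).le) (fun k => (hθ1 _).le) hone
  have hγτ : Tendsto (fun k => γ.1 (t (φ k))) atTop (𝓝 (γ.1 τ)) :=
    (γ.1.continuous.tendsto τ).comp hτ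
  have hvτ : Tendsto (fun k => v (t (φ k))) atTop (𝓝 (v τ)) := (v.continuous.tendsto τ).comp hτ
  have hlim1 : -η ≤ inner ℝ (g (γ.1 τ)) (v τ) := by
    have h2 : Tendsto (fun k => γ.1 (t (φ k)) + θ (φ k) • v (t (φ k))) atTop (𝓝 (γ.1 τ)) := by
      simpa using hγτ.add (hθt.smul hvτ)
    exact ge_of_tendsto' (((hg.tendsto _).comp h2).inner hvτ) fun k => hin _
  have hlim2 : Φ γ ≤ I (γ.1 τ) := by
    have h2 : Tendsto (fun k => γ.1 (t (φ k)) + (1 / ((φ k : ℝ) + 1)) • v (t (φ k))) atTop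
        (𝓝 (γ.1 τ)) := by
      simpa using hγτ.add (hone.smul hvτ)
    have h3 : Tendsto (fun k => Φ γ - η * (1 / ((φ k : ℝ) + 1))) atTop (𝓝 (Φ γ)) := by
      simpa using (hone.const_mul η).const_sub (Φ γ)
    exact le_of_tendsto_of_tendsto' h3 ((hIc.tendsto _).comp h2) fun k => hval _
  refine ⟨γ.1 τ, (hcΦ γ).trans hlim2, (hle γ τ).trans hγm, ?_⟩
  by_contra! hcon
  have hvv : v τ = (-(χ τ / max ‖g (γ.1 τ)‖ η)) • g (γ.1 τ) := rfl
  rw [hvv, hχo τ ((hcΦ γ).trans hlim2), max_eq_left hcon.le, inner_smul_right,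
    real_inner_self_eq_norm_sq] at hlim1
  have hne : ‖g (γ.1 τ)‖ ≠ 0 := (hη.trans hcon).ne'
  have : -(1 / ‖g (γ.1 τ)‖) * ‖g (γ.1 τ)‖ ^ 2 = -‖g (γ.1 τ)‖ := by field_simp
  linarith

/-- The mountain pass theorem of Ambrosetti and Rabinowitz. -/
theorem mountain_pass {I : H → ℝ} {g : H → H} (hI : ∀ u, HasGradientAt I (g u) u)
    (hg : Continuous g) (hzero : I 0 ≤ 0) {r β : ℝ} (hr : 0 < r) (hβ : 0 < β)
    (hsphere : ∀ u, ‖u‖ = r → β ≤ I u) {e : H} (he : r < ‖e‖) (hIe : I e ≤ 0)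
    (hPS : ∀ (u : ℕ → H) (B : ℝ), (∀ k, I (u k) ≤ B) → Tendsto (fun k => g (u k)) atTop (𝓝 0) →
      ∃ (a : H) (φ : ℕ → ℕ), StrictMono φ ∧ Tendsto (u ∘ φ) atTop (𝓝 a)) :
    ∃ u, g u = 0 ∧ β ≤ I u ∧ IsGLB {m : ℝ | ∃ γ : C(unitInterval, H), γ 0 = 0 ∧ r < ‖γ 1‖ ∧
      I (γ 1) ≤ 0 ∧ IsGreatest (Set.range fun t => I (γ t)) m} (I u) := by
  have hIc : Continuous I := continuous_iff_continuousAt.2 fun u => (hI u).continuousAt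
  set S := {m : ℝ | ∃ γ : C(unitInterval, H), γ 0 = 0 ∧ r < ‖γ 1‖ ∧
      I (γ 1) ≤ 0 ∧ IsGreatest (Set.range fun t => I (γ t)) m}
  have hgreat : ∀ γ : C(unitInterval, H), ∃ m, IsGreatest (Set.range fun t => I (γ t)) m :=
    fun γ => (isCompact_range (hIc.comp γ.continuous)).exists_isGreatest (Set.range_nonempty _)
  have hcross : ∀ γ : C(unitInterval, H), γ 0 = 0 → r < ‖γ 1‖ → ∃ t, β ≤ I (γ t) := by
    intro γ h0 h1
    obtain ⟨t, ht⟩ := intermediate_value_univ (0 : unitInterval) 1 (γ.continuous.norm)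
      (show r ∈ Set.Icc ‖γ 0‖ ‖γ 1‖ from ⟨by rw [h0, norm_zero]; exact hr.le, h1.le⟩)
    exact ⟨t, hsphere _ ht⟩
  have hlow : ∀ m ∈ S, β ≤ m := by
    rintro m ⟨γ, h0, h1, -, hm⟩
    obtain ⟨t, ht⟩ := hcross γ h0 h1
    exact ht.trans (hm.2 ⟨t, rfl⟩)
  have hSne : S.Nonempty := by
    let γ : C(unitInterval, H) := ⟨fun t => (t : ℝ) • e, by fun_prop⟩
    obtain ⟨m, hm⟩ := hgreat γ
    exact ⟨m, γ, by simp [γ], by simpa [γ] using he, by simpa [γ] using hIe, hm⟩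
  have hglb := isGLB_csInf hSne ⟨β, hlow⟩
  set c := sInf S
  have hcβ : β ≤ c := le_csInf hSne hlow
  have hseq : ∀ k : ℕ, ∃ u, c ≤ I u ∧ I u ≤ c + 1 / ((k : ℝ) + 1) ∧ ‖g u‖ ≤ 1 / ((k : ℝ) + 1) := by
    intro k
    have hk : (0 : ℝ) < 1 / ((k : ℝ) + 1) := by positivity
    obtain ⟨m, ⟨γ, h0, h1, hI1, hm⟩, hmc⟩ := exists_lt_of_csInf_lt hSne (lt_add_of_pos_right c hk)
    -- The admissible class lets the endpoint vary. Freezing that of a nearly optimal path is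
    -- harmless: every competitor with the same endpoint is admissible, so it reaches level `c`.
    obtain ⟨u, hu1, hu2, hu3⟩ := exists_almost_critical hI hg (a := 0) (b := γ 1) (c := c) (m := m)
      (by linarith) (by linarith) (fun γ' h0' h1' => by
        obtain ⟨m', hm'⟩ := hgreat γ'
        obtain ⟨t, ht⟩ := hm'.1
        refine ⟨t, ?_⟩
        change I (γ' t) = m' at ht
        rw [ht]
        exact hglb.1 ⟨γ', h0', by rw [h1']; exact h1, by rw [h1']; exact hI1, hm'⟩)
      γ h0 rfl (fun t => hm.2 ⟨t, rfl⟩) hk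
    exact ⟨u, hu1, hu2.trans hmc.le, hu3⟩
  choose u hu1 hu2 hu3 using hseq
  have hlim := tendsto_one_div_add_atTop_nhds_zero_nat (𝕜 := ℝ)
  obtain ⟨a, φ, hφ, ha⟩ := hPS u (c + 1) (fun k => (hu2 k).trans (by
      gcongr
      rw [div_le_one (by positivity)]
      linarith [Nat.cast_nonneg (α := ℝ) k])) (squeeze_zero_norm hu3 hlim)
  have hIa : I a = c := by
    have h2 : Tendsto (fun k => I (u (φ k))) atTop (𝓝 c) := by
      refine tendsto_of_tendsto_of_tendsto_of_le_of_le tendsto_const_nhds ?_ (fun k => hu1 (φ k))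
        fun k => hu2 (φ k)
      simpa using (hlim.comp hφ.tendsto_atTop).const_add c
    exact tendsto_nhds_unique ((hIc.tendsto a).comp ha) h2
  refine ⟨a, ?_, hIa ▸ hcβ, hIa ▸ hglb⟩
  exact tendsto_nhds_unique ((hg.tendsto a).comp ha)
    ((squeeze_zero_norm hu3 hlim).comp hφ.tendsto_atTop)

/-- A bounded sequence has a subsequence whose image under a compact operator is Cauchy. -/
theorem exists_subseq_cauchySeq {H F : Type*} [NormedAddCommGroup H] [NormedSpace ℝ H]
    [NormedAddCommGroup F] [NormedSpace ℝ F]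
    {J : H →L[ℝ] F} (hJ : IsCompactOperator J) {R : ℝ} {u : ℕ → H} (hu : ∀ k, ‖u k‖ ≤ R) :
    ∃ φ : ℕ → ℕ, StrictMono φ ∧ CauchySeq fun k => J (u (φ k)) := by
  obtain ⟨K, hK, hsub⟩ :=
    IsCompactOperator.image_closedBall_subset_compact (f := J.toLinearMap) hJ R
  obtain ⟨a, -, φ, hφ, h⟩ := hK.tendsto_subseq (x := fun k => J (u k))
    (fun k => hsub ⟨u k, by simpa using hu k, rfl⟩)
  exact ⟨φ, hφ, h.cauchySeq⟩

/-- `½‖u‖² - G u` attains its minimum on closed balls if `G` is uniformly continuous on them with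
respect to a compact operator. -/
theorem exists_min_closedBall {F : Type*} [NormedAddCommGroup F] [NormedSpace ℝ F]
    {J : H →L[ℝ] F} (hJ : IsCompactOperator J) {G : H → ℝ} (hGc : Continuous G) {r : ℝ}
    (hr : 0 < r) {B : ℝ} (hB : ∀ u, ‖u‖ ≤ r → G u ≤ B)
    (hG : ∀ η > 0, ∃ τ > 0, ∀ u w, ‖u‖ ≤ r → ‖w‖ ≤ r → ‖J u - J w‖ < τ → |G u - G w| ≤ η) :
    ∃ u, ‖u‖ ≤ r ∧ ∀ w, ‖w‖ ≤ r → ‖u‖ ^ 2 / 2 - G u ≤ ‖w‖ ^ 2 / 2 - G w := by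
  set I : H → ℝ := fun u => ‖u‖ ^ 2 / 2 - G u with hIdef
  have hIc : Continuous I := by fun_prop
  set A := I '' Metric.closedBall 0 r with hA
  have hAne : A.Nonempty := ⟨_, 0, by simpa using hr.le, rfl⟩
  have hAb : BddBelow A := ⟨-B, by
    rintro _ ⟨u, hu, rfl⟩
    have := hB u (by simpa using hu)
    simp only [hIdef]
    nlinarith [sq_nonneg ‖u‖]⟩
  set m := sInf A
  have hm : ∀ w, ‖w‖ ≤ r → m ≤ I w := fun w hw => csInf_le hAb ⟨w, by simpa using hw, rfl⟩
  have hseq : ∀ k : ℕ, ∃ u, ‖u‖ ≤ r ∧ I u ≤ m + 1 / ((k : ℝ) + 1) := by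
    intro k
    obtain ⟨_, ⟨u, hu, rfl⟩, h⟩ := exists_lt_of_csInf_lt hAne
      (lt_add_of_pos_right m (by positivity : (0 : ℝ) < 1 / ((k : ℝ) + 1)))
    exact ⟨u, by simpa using hu, h.le⟩
  choose u hu hIu using hseq
  obtain ⟨φ, hφ, hcau⟩ := exists_subseq_cauchySeq hJ hu
  have hlim := (tendsto_one_div_add_atTop_nhds_zero_nat (𝕜 := ℝ)).comp hφ.tendsto_atTop
  have hucau : CauchySeq fun k => u (φ k) := by
    rw [Metric.cauchySeq_iff]
    intro κ hκ
    -- By the parallelogram law `‖a - b‖² / 8 = (I a + I b) / 2 - I c + (G a + G b) / 2 - G c` for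
    -- the midpoint `c`. With errors `κ² / 64` this is at most `κ² / 32`, hence `‖a - b‖ ≤ κ / 2`.
    obtain ⟨τ, hτ, hGτ⟩ := hG (κ ^ 2 / 64) (by positivity)
    obtain ⟨N₁, hN₁⟩ := Metric.cauchySeq_iff.1 hcau τ hτ
    obtain ⟨N₂, hN₂⟩ := eventually_atTop.1 (hlim.eventually_lt_const
      (show (0 : ℝ) < κ ^ 2 / 64 by positivity))
    refine ⟨max N₁ N₂, fun i hi j hj => ?_⟩
    set a := u (φ i)
    set b := u (φ j)
    have hab : ‖J a - J b‖ < τ := by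
      rw [← dist_eq_norm]
      exact hN₁ i (le_of_max_le_left hi) j (le_of_max_le_left hj)
    have hIa : I a ≤ m + κ ^ 2 / 64 := (hIu _).trans (by
      exact add_le_add_right (hN₂ i (le_of_max_le_right hi)).le m)
    have hIb : I b ≤ m + κ ^ 2 / 64 := (hIu _).trans (by
      exact add_le_add_right (hN₂ j (le_of_max_le_right hj)).le m)
    set c := (1 / 2 : ℝ) • (a + b) with hcdef
    have hcr : ‖c‖ ≤ r := by
      rw [hcdef, norm_smul, Real.norm_of_nonneg (by norm_num)]
      linarith [norm_add_le a b, hu (φ i), hu (φ j)]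
    have hJca : ‖J c - J a‖ < τ := by
      have : J c - J a = (-(1 / 2) : ℝ) • (J a - J b) := by
        rw [hcdef, map_smul, map_add]; module
      rw [this, norm_smul, norm_neg, Real.norm_of_nonneg (by norm_num)]
      linarith [norm_nonneg (J a - J b)]
    have hJcb : ‖J c - J b‖ < τ := by
      have : J c - J b = (1 / 2 : ℝ) • (J a - J b) := by
        rw [hcdef, map_smul, map_add]; module
      rw [this, norm_smul, Real.norm_of_nonneg (by norm_num)]
      linarith [norm_nonneg (J a - J b)]
    have h1 := abs_le.1 (hGτ c a hcr (hu _) hJca)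
    have h2 := abs_le.1 (hGτ c b hcr (hu _) hJcb)
    have h3 := hm c hcr
    have h4 : ‖c‖ ^ 2 = (‖a + b‖ ^ 2) / 4 := by
      rw [hcdef, norm_smul, Real.norm_of_nonneg (by norm_num)]; ring
    have h5 := parallelogram_law_with_norm ℝ a b
    simp only [hIdef] at hIa hIb h3
    rw [dist_eq_norm]
    refine lt_of_pow_lt_pow_left₀ 2 hκ.le ?_
    nlinarith
  obtain ⟨a, ha⟩ := cauchySeq_tendsto_of_complete hucau
  have har : ‖a‖ ≤ r := le_of_tendsto' ha.norm fun k => hu _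
  refine ⟨a, har, fun w hw => ?_⟩
  have h1 : I a ≤ m := by
    refine le_of_tendsto_of_tendsto' ((hIc.tendsto a).comp ha) (b := atTop)
      (g := fun k => m + 1 / ((φ k : ℝ) + 1)) ?_ fun k => hIu _
    simpa using hlim.const_add m
  exact h1.trans (hm w hw)

end MountainPass

end FracSchrodinger

/-! ### The energy space as a Hilbert space -/

namespace FracSchrodinger

section EnergySpace

variable {n : ℕ} {α : ℝ} {V : E n → ℝ}

/-- The square root of the Gagliardo kernel denominator. -/
noncomputable def halfKernel {n : ℕ} (α : ℝ) (z : E n × E n) : ℝ :=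
  ‖z.1 - z.2‖ ^ (((n : ℝ) + 2 * α) / 2)

theorem halfKernel_sq (z : E n × E n) :
    halfKernel α z ^ 2 = ‖z.1 - z.2‖ ^ ((n : ℝ) + 2 * α) := by
  rw [halfKernel, ← Real.rpow_natCast, ← Real.rpow_mul (norm_nonneg _)]
  congr 1
  push_cast
  ring

theorem measurable_halfKernel : Measurable (halfKernel α : E n × E n → ℝ) := by
  unfold halfKernel
  fun_prop

/-- The difference quotient whose square is the Gagliardo integrand. -/
noncomputable def quotient {n : ℕ} (α : ℝ) (u : E n → ℝ) (z : E n × E n) : ℝ :=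
  (u z.1 - u z.2) / halfKernel α z

theorem quotient_mul (u w : E n → ℝ) (z : E n × E n) : quotient α u z * quotient α w z =
    (u z.1 - u z.2) * (w z.1 - w z.2) / ‖z.1 - z.2‖ ^ ((n : ℝ) + 2 * α) := by
  rw [quotient, quotient, div_mul_div_comm, ← halfKernel_sq, sq]

theorem quotient_sq (u : E n → ℝ) (z : E n × E n) :
    quotient α u z ^ 2 = (u z.1 - u z.2) ^ 2 / ‖z.1 - z.2‖ ^ ((n : ℝ) + 2 * α) := by
  rw [sq, quotient_mul, sq]

theorem quotient_congr {u w : E n → ℝ} (h : u =ᵐ[volume] w) :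
    quotient α u =ᵐ[volume.prod volume] quotient α w := by
  filter_upwards [Measure.quasiMeasurePreserving_fst.ae_eq_comp h,
    Measure.quasiMeasurePreserving_snd.ae_eq_comp h] with z h1 h2
  simp only [Function.comp_apply] at h1 h2
  simp only [quotient, h1, h2]

theorem quotient_add (u w : E n → ℝ) : quotient α (u + w) = quotient α u + quotient α w := by
  ext z
  simp only [quotient, Pi.add_apply]
  ring

theorem quotient_smul (c : ℝ) (u : E n → ℝ) : quotient α (c • u) = c • quotient α u := by
  ext z
  simp only [quotient, Pi.smul_apply, smul_eq_mul]
  ring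

theorem aestronglyMeasurable_quotient {u : E n → ℝ} (hu : AEStronglyMeasurable u volume) :
    AEStronglyMeasurable (quotient α u) (volume.prod volume) :=
  ((hu.comp_fst.sub hu.comp_snd).aemeasurable.div
    measurable_halfKernel.aemeasurable).aestronglyMeasurable

/-- `H^α_V` as a subspace of `L²(ℝⁿ × ℝⁿ) × L²(ℝⁿ)`, through `u ↦ (quotient u, √V u)`. -/
noncomputable def energySpace (n : ℕ) (α : ℝ) (V : E n → ℝ) :
    Submodule ℝ (WithLp 2 (Lp ℝ 2 ((volume : Measure (E n)).prod (volume : Measure (E n))) ×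
      Lp ℝ 2 (volume : Measure (E n)))) where
  carrier := {p | (p.fst : E n × E n → ℝ) =ᵐ[(volume : Measure (E n)).prod (volume : Measure (E n))]
    quotient α fun x => (p.snd : E n → ℝ) x / √(V x)}
  add_mem' := by
    intro p p' hp hp'
    have h1 : (p + p').fst = p.fst + p'.fst := rfl
    have h2 : (fun x => (p + p').snd x / √(V x)) =ᵐ[volume]
        (fun x => p.snd x / √(V x)) + fun x => p'.snd x / √(V x) := by
      filter_upwards [Lp.coeFn_add p.snd p'.snd] with x hx
      change (p.snd + p'.snd : Lp ℝ 2 volume) x / √(V x) = _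
      rw [hx]
      simp [add_div]
    change ((p + p').fst : E n × E n → ℝ) =ᵐ[_] _
    rw [h1]
    refine (Lp.coeFn_add _ _).trans (EventuallyEq.trans ?_ (quotient_congr h2).symm)
    rw [quotient_add]
    exact EventuallyEq.add (show _ =ᵐ[_] _ from hp) (show _ =ᵐ[_] _ from hp')
  zero_mem' := by
    have h2 : (fun x => (0 : Lp ℝ 2 (volume : Measure (E n))) x / √(V x)) =ᵐ[volume] 0 := by
      filter_upwards [Lp.coeFn_zero ℝ 2 (volume : Measure (E n))] with x hx
      rw [hx]
      simp
    refine (Lp.coeFn_zero _ _ _).trans (EventuallyEq.trans ?_ (quotient_congr h2).symm)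
    filter_upwards with z
    simp [quotient]
  smul_mem' := by
    intro c p hp
    have h2 : (fun x => (c • p).snd x / √(V x)) =ᵐ[volume] c • fun x => p.snd x / √(V x) := by
      filter_upwards [Lp.coeFn_smul c p.snd] with x hx
      change (c • p.snd : Lp ℝ 2 volume) x / √(V x) = _
      rw [hx]
      simp [mul_div_assoc]
    change ((c • p.fst : Lp ℝ 2 _) : E n × E n → ℝ) =ᵐ[_] _
    refine (Lp.coeFn_smul _ _).trans (EventuallyEq.trans ?_ (quotient_congr h2).symm)
    rw [quotient_smul]
    exact EventuallyEq.const_smul (show _ =ᵐ[_] _ from hp) c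

/-- The function represented by an element of `energySpace`. -/
noncomputable def fn (p : energySpace n α V) (x : E n) : ℝ := p.1.snd x / √(V x)

theorem fst_eq_quotient (p : energySpace n α V) :
    p.1.fst =ᵐ[volume.prod volume] quotient α (fn p) := p.2

theorem fn_add (p q : energySpace n α V) : fn (p + q) =ᵐ[volume] fn p + fn q := by
  filter_upwards [Lp.coeFn_add p.1.snd q.1.snd] with x hx
  change (p.1.snd + q.1.snd : Lp ℝ 2 volume) x / √(V x) = _
  rw [hx]
  simp [add_div, fn]

theorem fn_smul (c : ℝ) (p : energySpace n α V) : fn (c • p) =ᵐ[volume] c • fn p := by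
  filter_upwards [Lp.coeFn_smul c p.1.snd] with x hx
  change (c • p.1.snd : Lp ℝ 2 volume) x / √(V x) = _
  rw [hx]
  simp [mul_div_assoc, fn]

theorem fn_sub (p q : energySpace n α V) : fn (p - q) =ᵐ[volume] fn p - fn q := by
  filter_upwards [Lp.coeFn_sub p.1.snd q.1.snd] with x hx
  change (p.1.snd - q.1.snd : Lp ℝ 2 volume) x / √(V x) = _
  rw [hx]
  simp [sub_div, fn]

theorem fn_zero : fn (0 : energySpace n α V) =ᵐ[volume] 0 := by
  filter_upwards [Lp.coeFn_zero ℝ 2 (volume : Measure (E n))] with x hx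
  change (0 : Lp ℝ 2 volume) x / √(V x) = _
  rw [hx]
  simp

/-- The constraint is pointwise: the first component at `(x, y)` is a fixed expression in the values
of the second at `x` and `y`. It survives almost everywhere limits, which are available along a
subsequence. -/
theorem isClosed_energySpace :
    IsClosed (energySpace n α V : Set (WithLp 2 (Lp ℝ 2 ((volume : Measure (E n)).prod (volume : Measure (E n))) ×
      Lp ℝ 2 (volume : Measure (E n))))) := by
  refine isClosed_of_closure_subset fun p hp => ?_
  obtain ⟨s, hs, hlim⟩ := mem_closure_iff_seq_limit.1 hp
  have h1 : Tendsto (fun k => (s k).fst) atTop (𝓝 p.fst) :=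
    ((WithLp.continuous_fst _ _ _).tendsto p).comp hlim
  have h2 : Tendsto (fun k => (s k).snd) atTop (𝓝 p.snd) :=
    ((WithLp.continuous_snd _ _ _).tendsto p).comp hlim
  obtain ⟨φ, hφ, hae1⟩ := (tendstoInMeasure_of_tendsto_Lp h1).exists_seq_tendsto_ae
  obtain ⟨ψ, hψ, hae2⟩ :=
    (tendstoInMeasure_of_tendsto_Lp (h2.comp hφ.tendsto_atTop)).exists_seq_tendsto_ae
  have hmem : ∀ᵐ z ∂((volume : Measure (E n)).prod (volume : Measure (E n))), ∀ k,
      (s k).fst z = quotient α (fun x => (s k).snd x / √(V x)) z := ae_all_iff.2 fun k => hs k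
  change (p.fst : E n × E n → ℝ) =ᵐ[_] _
  filter_upwards [hae1, hmem, Measure.quasiMeasurePreserving_fst.ae hae2,
    Measure.quasiMeasurePreserving_snd.ae hae2] with z hz1 hz2 hz3 hz4
  refine tendsto_nhds_unique (hz1.comp hψ.tendsto_atTop) ?_
  simp only [Function.comp_def, hz2] at hz3 hz4 ⊢
  exact ((hz3.div_const _).sub (hz4.div_const _)).div_const _

instance : CompleteSpace (energySpace n α V) :=
  isClosed_energySpace.completeSpace_coe

theorem innerV_congr {u u' w w' : E n → ℝ} (hu : u =ᵐ[volume] u') (hw : w =ᵐ[volume] w') :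
    innerV α V u w = innerV α V u' w' := by
  unfold innerV
  simp_rw [← quotient_mul]
  congr 1
  · refine integral_congr_ae ?_
    filter_upwards [quotient_congr (α := α) hu, quotient_congr (α := α) hw] with z h1 h2
    rw [h1, h2]
  · refine integral_congr_ae ?_
    filter_upwards [hu, hw] with x h1 h2
    rw [h1, h2]

theorem normV_congr {u u' : E n → ℝ} (hu : u =ᵐ[volume] u') : normV α V u = normV α V u' := by
  rw [normV, normV, innerV_congr hu hu]

theorem inner_eq_innerV (hV : ∀ x, 0 < V x) (p q : energySpace n α V) :
    inner ℝ p q = innerV α V (fn p) (fn q) := by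
  rw [Submodule.coe_inner, WithLp.prod_inner_apply]
  change inner ℝ p.1.fst q.1.fst + inner ℝ p.1.snd q.1.snd = _
  rw [L2.inner_def, L2.inner_def, innerV]
  simp_rw [← quotient_mul]
  congr 1
  · refine integral_congr_ae ?_
    filter_upwards [fst_eq_quotient p, fst_eq_quotient q] with z h1 h2
    rw [h1, h2]
    simp [mul_comm]
  · refine integral_congr_ae ?_
    filter_upwards with x
    have := Real.mul_self_sqrt (hV x).le
    have h0 := (Real.sqrt_pos.2 (hV x)).ne'
    simp only [fn, RCLike.inner_apply, conj_trivial]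
    field_simp
    rw [Real.sq_sqrt (hV x).le]

theorem normV_fn (hV : ∀ x, 0 < V x) (p : energySpace n α V) : normV α V (fn p) = ‖p‖ := by
  rw [normV, ← inner_eq_innerV hV, real_inner_self_eq_norm_sq, Real.sqrt_sq (norm_nonneg _)]

theorem aestronglyMeasurable_fn (hVc : Continuous V) (p : energySpace n α V) :
    AEStronglyMeasurable (fn p) volume :=
  ((Lp.aestronglyMeasurable p.1.snd).aemeasurable.div
    (hVc.measurable.sqrt).aemeasurable).aestronglyMeasurable

theorem memHV_fn {V₀ : ℝ} (hVc : Continuous V) (hV₀ : 0 < V₀) (hV : ∀ x, V₀ ≤ V x)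
    (p : energySpace n α V) : MemHV α V (fn p) := by
  have hpos : ∀ x, 0 < V x := fun x => hV₀.trans_le (hV x)
  refine ⟨⟨?_, ?_⟩, ?_⟩
  · refine MemLp.of_le_mul (Lp.memLp p.1.snd) (aestronglyMeasurable_fn hVc p) (c := (√V₀)⁻¹)
      (Eventually.of_forall fun x => ?_)
    have h0 := Real.sqrt_pos.2 hV₀
    rw [fn, norm_div, Real.norm_of_nonneg (Real.sqrt_nonneg _), div_eq_inv_mul]
    gcongr
    exact hV x
  · simp_rw [← quotient_sq]
    refine ((Lp.memLp p.1.fst).integrable_sq).congr ?_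
    filter_upwards [fst_eq_quotient p] with z hz
    rw [hz]
  · refine ((Lp.memLp p.1.snd).integrable_sq).congr (Eventually.of_forall fun x => ?_)
    simp only [fn, div_pow, Real.sq_sqrt (hpos x).le]
    field_simp [(hpos x).ne']

/-- Together with `memHV_fn` and `inner_eq_innerV`, this lets the results in the Hilbert space be
transferred to functions. -/
theorem exists_fn_eq (hVc : Continuous V) (hV : ∀ x, 0 < V x) {u : E n → ℝ} (hu : MemHV α V u) :
    ∃ p : energySpace n α V, fn p =ᵐ[volume] u := by
  have hmeas := hu.1.1.aestronglyMeasurable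
  have h1 : MemLp (quotient α u) 2 (volume.prod volume) := by
    rw [memLp_two_iff_integrable_sq (aestronglyMeasurable_quotient hmeas)]
    simpa only [quotient_sq] using hu.1.2
  have h2 : MemLp (fun x => √(V x) * u x) 2 volume := by
    have hm : AEStronglyMeasurable (fun x => √(V x) * u x) volume :=
      hVc.sqrt.aestronglyMeasurable.mul hmeas
    rw [memLp_two_iff_integrable_sq hm]
    refine hu.2.congr (Eventually.of_forall fun x => ?_)
    simp only [mul_pow, Real.sq_sqrt (hV x).le]
  have h3 : (fun x => h2.toLp _ x / √(V x)) =ᵐ[volume] u := by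
    filter_upwards [h2.coeFn_toLp] with x hx
    rw [hx, mul_div_cancel_left₀ _ (Real.sqrt_pos.2 (hV x)).ne']
  refine ⟨⟨WithLp.toLp 2 (h1.toLp _, h2.toLp _), ?_⟩, h3⟩
  change (h1.toLp _ : E n × E n → ℝ) =ᵐ[_] quotient α fun x => h2.toLp _ x / √(V x)
  exact h1.coeFn_toLp.trans (quotient_congr h3).symm

/-- The norm of `p - q` can be computed from the function it represents, which vanishes almost
everywhere. -/
theorem fn_ext (hV : ∀ x, 0 < V x) {p q : energySpace n α V} (h : fn p =ᵐ[volume] fn q) :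
    p = q := by
  have h0 : fn (p - q) =ᵐ[volume] 0 := by
    filter_upwards [fn_sub p q, h] with x h1 h2
    simp [h1, h2]
  rw [← sub_eq_zero, ← norm_eq_zero, ← normV_fn hV, normV_congr h0]
  simp [normV, innerV]

theorem norm_sq_eq (hV : ∀ x, 0 < V x) (p : energySpace n α V) :
    ‖p‖ ^ 2 = (∫ z, quotient α (fn p) z ^ 2 ∂(volume.prod volume)) + ∫ x, V x * fn p x ^ 2 := by
  rw [← real_inner_self_eq_norm_sq, inner_eq_innerV hV, innerV]
  simp_rw [← quotient_mul, sq, mul_assoc]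

theorem memLp_fn {V₀ : ℝ} (hVc : Continuous V) (hV₀ : 0 < V₀) (hV : ∀ x, V₀ ≤ V x)
    (p : energySpace n α V) : MemLp (fn p) 2 volume := (memHV_fn hVc hV₀ hV p).1.1

/-- The embedding of the energy space into `L²` as a linear map. -/
noncomputable def toL2Lin {V₀ : ℝ} (hVc : Continuous V) (hV₀ : 0 < V₀) (hV : ∀ x, V₀ ≤ V x) :
    energySpace n α V →ₗ[ℝ] Lp ℝ 2 (volume : Measure (E n)) where
  toFun p := (memLp_fn hVc hV₀ hV p).toLp (fn p)
  map_add' p q := (MemLp.toLp_congr (memLp_fn hVc hV₀ hV (p + q))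
    ((memLp_fn hVc hV₀ hV p).add (memLp_fn hVc hV₀ hV q)) (fn_add p q)).trans (MemLp.toLp_add _ _)
  map_smul' c p := (MemLp.toLp_congr (memLp_fn hVc hV₀ hV (c • p))
    ((memLp_fn hVc hV₀ hV p).const_smul c) (fn_smul c p)).trans (MemLp.toLp_const_smul _ _)

theorem coeFn_toL2Lin {V₀ : ℝ} (hVc : Continuous V) (hV₀ : 0 < V₀) (hV : ∀ x, V₀ ≤ V x)
    (p : energySpace n α V) : toL2Lin hVc hV₀ hV p =ᵐ[volume] fn p :=
  (memLp_fn hVc hV₀ hV p).coeFn_toLp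

theorem norm_toL2Lin_le {V₀ : ℝ} (hVc : Continuous V) (hV₀ : 0 < V₀) (hV : ∀ x, V₀ ≤ V x)
    (p : energySpace n α V) : ‖toL2Lin hVc hV₀ hV p‖ ≤ (√V₀)⁻¹ * ‖p‖ := by
  have hs := Real.sqrt_pos.2 hV₀
  have h1 : ‖toL2Lin hVc hV₀ hV p‖ ≤ (√V₀)⁻¹ * ‖p.1.snd‖ := by
    refine Lp.norm_le_mul_norm_of_ae_le_mul ?_
    filter_upwards [coeFn_toL2Lin hVc hV₀ hV p] with x hx
    rw [hx, fn, norm_div, Real.norm_of_nonneg (Real.sqrt_nonneg _), div_eq_inv_mul]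
    gcongr
    exact hV x
  refine h1.trans ?_
  gcongr
  exact WithLp.norm_snd_le _ p.1

/-- The embedding of the energy space into `L²`. -/
noncomputable def toL2 {V₀ : ℝ} (hVc : Continuous V) (hV₀ : 0 < V₀) (hV : ∀ x, V₀ ≤ V x) :
    energySpace n α V →L[ℝ] Lp ℝ 2 (volume : Measure (E n)) :=
  (toL2Lin hVc hV₀ hV).mkContinuous (√V₀)⁻¹ (norm_toL2Lin_le hVc hV₀ hV)

theorem coeFn_toL2 {V₀ : ℝ} (hVc : Continuous V) (hV₀ : 0 < V₀) (hV : ∀ x, V₀ ≤ V x)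
    (p : energySpace n α V) : toL2 hVc hV₀ hV p =ᵐ[volume] fn p :=
  coeFn_toL2Lin hVc hV₀ hV p

end EnergySpace

end FracSchrodinger

/-! ### Compactness of the embedding into `L²` -/

namespace FracSchrodinger

/-- Cauchy–Schwarz for the mean of a square integrable function. -/
theorem sq_integral_le {X : Type*} [MeasurableSpace X] {ν : Measure X} [IsFiniteMeasure ν]
    {v : X → ℝ} (hv : MemLp v 2 ν) : (∫ x, v x ∂ν) ^ 2 ≤ ν.real Set.univ * ∫ x, v x ^ 2 ∂ν := by
  have hi : Integrable v ν := hv.integrable one_le_two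
  have hi2 := hv.integrable_sq
  set m := ν.real Set.univ with hm
  set a := ∫ x, v x ∂ν
  -- This is the variance with denominators cleared, so that the null measure can be treated
  -- separately at the end.
  have h0 : 0 ≤ ∫ x, (m * v x - a) ^ 2 ∂ν := integral_nonneg fun x => sq_nonneg _
  have h1 : ∫ x, (m * v x - a) ^ 2 ∂ν = m ^ 2 * (∫ x, v x ^ 2 ∂ν) - 2 * m * a * a + m * a ^ 2 := by
    have : ∀ x, (m * v x - a) ^ 2 = m ^ 2 * v x ^ 2 - 2 * m * a * v x + a ^ 2 := fun x => by ring
    simp_rw [this]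
    have hs : Integrable (fun x => m ^ 2 * v x ^ 2 - 2 * m * a * v x) ν :=
      (hi2.const_mul _).sub (hi.const_mul _)
    rw [integral_add hs (integrable_const _),
      integral_sub (hi2.const_mul _) (hi.const_mul _), integral_const_mul, integral_const_mul,
      integral_const, smul_eq_mul]
  rw [h1] at h0
  rcases (measureReal_nonneg (μ := ν) (s := Set.univ)).eq_or_lt with hz | hpos
  · have : ν = 0 := by
      rw [← Measure.measure_univ_eq_zero]
      exact (measureReal_eq_zero_iff).1 hz.symm
    simp [a, this]
  · have h2 : 0 ≤ m * (m * (∫ x, v x ^ 2 ∂ν) - a ^ 2) := by nlinarith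
    have := nonneg_of_mul_nonneg_right h2 hpos
    linarith

section Compactness

variable {n : ℕ} {α : ℝ} {V : E n → ℝ}

/-- The Gagliardo density `∫ (u x - u y)² / |x - y|^{n + 2α} dy`. -/
noncomputable def density {n : ℕ} (α : ℝ) (u : E n → ℝ) (x : E n) : ℝ :=
  ∫ y, quotient α u (x, y) ^ 2

theorem density_nonneg (u : E n → ℝ) (x : E n) : 0 ≤ density α u x :=
  integral_nonneg fun _ => sq_nonneg _

/-- The exponent of the kernel is positive, so its denominator is at most `d^{n + 2α}`. On the
diagonal the left side vanishes. -/
theorem sq_diff_le (hα : 0 < α) (u : E n → ℝ) {x y : E n} {d : ℝ} (hd : ‖x - y‖ ≤ d) :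
    (u x - u y) ^ 2 ≤ d ^ ((n : ℝ) + 2 * α) * quotient α u (x, y) ^ 2 := by
  rcases eq_or_ne x y with rfl | hxy
  · simp [quotient]
  · have hpos : 0 < ‖x - y‖ := norm_pos_iff.2 (sub_ne_zero.2 hxy)
    have hk : 0 < ‖x - y‖ ^ ((n : ℝ) + 2 * α) := Real.rpow_pos_of_pos hpos _
    have hle : ‖x - y‖ ^ ((n : ℝ) + 2 * α) ≤ d ^ ((n : ℝ) + 2 * α) :=
      Real.rpow_le_rpow hpos.le hd (by positivity)
    rw [quotient_sq]
    calc (u x - u y) ^ 2 = ‖x - y‖ ^ ((n : ℝ) + 2 * α) *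
          ((u x - u y) ^ 2 / ‖x - y‖ ^ ((n : ℝ) + 2 * α)) := by field_simp
      _ ≤ _ := by gcongr

/-- The deviation from the mean over a ball is controlled by the Gagliardo density. -/
theorem sq_sub_average_le (hα : 0 < α) {u : E n → ℝ} (hu : MemLp u 2 volume) {x c : E n} {s : ℝ}
    (hs : 0 < s) (hx : x ∈ Metric.ball c s)
    (hint : Integrable (fun y => quotient α u (x, y) ^ 2) volume) :
    (u x - (volume.real (Metric.ball c s))⁻¹ * ∫ y in Metric.ball c s, u y) ^ 2 ≤
      (volume.real (Metric.ball c s))⁻¹ * (2 * s) ^ ((n : ℝ) + 2 * α) * density α u x := by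
  set B := Metric.ball c s
  have : IsFiniteMeasure ((volume : Measure (E n)).restrict B) :=
    ⟨by simpa using measure_ball_lt_top⟩
  have hb : 0 < volume.real B :=
    ENNReal.toReal_pos (Metric.measure_ball_pos _ _ hs).ne' measure_ball_lt_top.ne
  set b := volume.real B
  have hub : MemLp u 2 (volume.restrict B) := hu.restrict B
  have hv : MemLp (fun y => u x - u y) 2 (volume.restrict B) := (memLp_const (u x)).sub hub
  -- The deviation from the mean is the mean of the deviations `u x - u y`. Cauchy–Schwarz and `‖x -
  -- y‖ ≤ 2s` within the ball then bring in the Gagliardo density.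
  have h1 : ∫ y in B, (u x - u y) = b * u x - ∫ y in B, u y := by
    rw [integral_sub (integrable_const _) (hub.integrable one_le_two), integral_const, smul_eq_mul]
    simp [b]
  have h2 := sq_integral_le hv
  have h3 : (volume.restrict B).real Set.univ = b := by simp [b]
  have h4 : ∫ y in B, (u x - u y) ^ 2 ≤ (2 * s) ^ ((n : ℝ) + 2 * α) * density α u x := by
    calc ∫ y in B, (u x - u y) ^ 2
        ≤ ∫ y in B, (2 * s) ^ ((n : ℝ) + 2 * α) * quotient α u (x, y) ^ 2 := by
          refine setIntegral_mono_on hv.integrable_sq (hint.const_mul _).integrableOn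
            measurableSet_ball fun y hy => sq_diff_le hα u ?_
          rw [← dist_eq_norm]
          linarith [dist_triangle_right x y c, Metric.mem_ball.1 hx, Metric.mem_ball.1 hy]
      _ ≤ ∫ y, (2 * s) ^ ((n : ℝ) + 2 * α) * quotient α u (x, y) ^ 2 :=
          setIntegral_le_integral (hint.const_mul _) (Eventually.of_forall fun y => by positivity)
      _ = _ := by rw [integral_const_mul, density]
  rw [h1, h3] at h2
  have h5 : u x - b⁻¹ * ∫ y in B, u y = b⁻¹ * (b * u x - ∫ y in B, u y) := by field_simp
  rw [h5, mul_pow, mul_assoc]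
  calc b⁻¹ ^ 2 * (b * u x - ∫ y in B, u y) ^ 2
      ≤ b⁻¹ ^ 2 * (b * ((2 * s) ^ ((n : ℝ) + 2 * α) * density α u x)) := by
        gcongr
        exact h2.trans (by gcongr)
    _ = _ := by field_simp

/-- The averaging operator attached to balls `ball (c i) s` and sets `Q i`. -/
noncomputable def averaging {N : ℕ} (c : Fin N → E n) (s : ℝ) (Q : Fin N → Set (E n))
    (hQ : ∀ i, MeasurableSet (Q i)) (hQf : ∀ i, volume (Q i) ≠ ⊤) :
    Lp ℝ 2 (volume : Measure (E n)) →L[ℝ] Lp ℝ 2 (volume : Measure (E n)) :=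
  ∑ i, ((volume.real (Metric.ball (c i) s))⁻¹ • innerSL ℝ (indicatorConstLp 2
    (measurableSet_ball (x := c i) (ε := s)) measure_ball_lt_top.ne (1 : ℝ))).smulRight
      (indicatorConstLp 2 (hQ i) (hQf i) (1 : ℝ))

/-- Each summand factors through `ℝ`, so the operator has finite rank. -/
theorem isCompactOperator_averaging {N : ℕ} (c : Fin N → E n) (s : ℝ) (Q : Fin N → Set (E n))
    (hQ : ∀ i, MeasurableSet (Q i)) (hQf : ∀ i, volume (Q i) ≠ ⊤) :
    IsCompactOperator (averaging c s Q hQ hQf) := by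
  change averaging c s Q hQ hQf ∈ compactOperator (RingHom.id ℝ) _ _
  refine Submodule.sum_mem _ fun i _ => ?_
  change IsCompactOperator _
  exact IsCompactOperator.comp_clm (isCompactOperator_of_locallyCompactSpace_rng
    (ContinuousLinearMap.toSpanSingleton ℝ (indicatorConstLp 2 (hQ i) (hQf i) (1 : ℝ))))
    ((volume.real (Metric.ball (c i) s))⁻¹ • innerSL ℝ (indicatorConstLp 2
      (measurableSet_ball (x := c i) (ε := s)) measure_ball_lt_top.ne (1 : ℝ)))

theorem averaging_apply {N : ℕ} (c : Fin N → E n) (s : ℝ) (Q : Fin N → Set (E n))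
    (hQ : ∀ i, MeasurableSet (Q i)) (hQf : ∀ i, volume (Q i) ≠ ⊤)
    (u : Lp ℝ 2 (volume : Measure (E n))) :
    averaging c s Q hQ hQf u =ᵐ[volume] fun x => ∑ i,
      (volume.real (Metric.ball (c i) s))⁻¹ * (∫ y in Metric.ball (c i) s, u y) *
        (Q i).indicator (fun _ => (1 : ℝ)) x := by
  have h1 : averaging c s Q hQ hQf u = ∑ i, ((volume.real (Metric.ball (c i) s))⁻¹ *
      ∫ y in Metric.ball (c i) s, u y) • indicatorConstLp 2 (hQ i) (hQf i) (1 : ℝ) := by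
    simp only [averaging, sum_apply, ContinuousLinearMap.smulRight_apply,
      smul_apply, innerSL_apply_apply, L2.inner_indicatorConstLp_one,
      smul_eq_mul]
  rw [h1]
  refine (Lp.coeFn_finsetSum _ _).trans ?_
  have h2 : ∀ᵐ x ∂(volume : Measure (E n)), ∀ i, (((volume.real (Metric.ball (c i) s))⁻¹ *
      ∫ y in Metric.ball (c i) s, u y) • indicatorConstLp 2 (hQ i) (hQf i) (1 : ℝ) :
        Lp ℝ 2 (volume : Measure (E n))) x = (volume.real (Metric.ball (c i) s))⁻¹ *
        (∫ y in Metric.ball (c i) s, u y) * (Q i).indicator (fun _ => (1 : ℝ)) x := by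
    refine ae_all_iff.2 fun i => ?_
    filter_upwards [Lp.coeFn_smul ((volume.real (Metric.ball (c i) s))⁻¹ *
      ∫ y in Metric.ball (c i) s, u y) (indicatorConstLp 2 (hQ i) (hQf i) (1 : ℝ)),
      indicatorConstLp_coeFn (p := 2) (hs := hQ i) (hμs := hQf i) (c := (1 : ℝ))] with x h3 h4
    rw [h3, Pi.smul_apply, h4, smul_eq_mul]
  filter_upwards [h2] with x hx
  rw [Finset.sum_apply]
  exact Finset.sum_congr rfl fun i _ => hx i

/-- A compact set is partitioned up to enlargement into finitely many small measurable pieces. -/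
theorem exists_small_pieces {K : Set (E n)} (hK : IsCompact K) {s : ℝ} (hs : 0 < s) :
    ∃ (N : ℕ) (c : Fin N → E n) (Q : Fin N → Set (E n)), (∀ i, MeasurableSet (Q i)) ∧
      (∀ i, Q i ⊆ Metric.ball (c i) s) ∧ Pairwise (Function.onFun Disjoint Q) ∧ K ⊆ ⋃ i, Q i := by
  obtain ⟨t, -, htf, hcov⟩ := hK.finite_cover_balls hs
  obtain ⟨N, c, rfl⟩ : ∃ (N : ℕ) (c : Fin N → E n), t = Set.range c := by
    lift t to Finset (E n) using htf
    exact ⟨t.card, fun i => t.equivFin.symm i, by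
      ext x; constructor
      · intro hx; exact ⟨t.equivFin ⟨x, hx⟩, by simp⟩
      · rintro ⟨i, rfl⟩; simp⟩
  refine ⟨N, c, disjointed fun i => Metric.ball (c i) s, fun i => ?_, disjointed_subset _,
    disjoint_disjointed _, ?_⟩
  · exact disjointedRec (p := MeasurableSet) (fun _ _ ht => ht.diff measurableSet_ball)
      measurableSet_ball
  · rw [iUnion_disjointed]
    simpa using hcov

theorem integrable_quotient_sq {V₀ : ℝ} (hVc : Continuous V) (hV₀ : 0 < V₀) (hV : ∀ x, V₀ ≤ V x)
    (p : energySpace n α V) :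
    Integrable (fun z => quotient α (fn p) z ^ 2) (volume.prod volume) := by
  simpa only [quotient_sq] using (memHV_fn hVc hV₀ hV p).1.2

theorem norm_L2_sq (u : Lp ℝ 2 (volume : Measure (E n))) : ‖u‖ ^ 2 = ∫ x, u x ^ 2 := by
  rw [← real_inner_self_eq_norm_sq, L2.inner_def]
  refine integral_congr_ae (Eventually.of_forall fun x => ?_)
  simp [sq]

/-- Approximation of functions of finite energy by averages. -/
theorem norm_sub_averaging_sq_le (hα : 0 < α) (hpos : ∀ x, 0 < V x) {N : ℕ} (c : Fin N → E n)
    {s : ℝ} (hs : 0 < s) (Q : Fin N → Set (E n))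
    (hQ : ∀ i, MeasurableSet (Q i)) (hQf : ∀ i, volume (Q i) ≠ ⊤)
    (hQb : ∀ i, Q i ⊆ Metric.ball (c i) s) (hQd : Pairwise (Function.onFun Disjoint Q))
    {M : ℝ} (hM : 0 < M) (htail : ∀ x ∉ ⋃ i, Q i, M ≤ V x)
    (w : Lp ℝ 2 (volume : Measure (E n)))
    (hi : Integrable (fun z => quotient α w z ^ 2) (volume.prod volume))
    (hiV : Integrable (fun x => V x * w x ^ 2) volume) :
    ‖w - averaging c s Q hQ hQf w‖ ^ 2 ≤
      ((volume.real (Metric.ball (0 : E n) s))⁻¹ * (2 * s) ^ ((n : ℝ) + 2 * α) + M⁻¹) *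
        ((∫ z, quotient α w z ^ 2 ∂(volume.prod volume)) + ∫ x, V x * w x ^ 2) := by
  set κ := (volume.real (Metric.ball (0 : E n) s))⁻¹ * (2 * s) ^ ((n : ℝ) + 2 * α) with hκ
  have hκ0 : 0 ≤ κ := by positivity
  have hdens : Integrable (density α w) volume := hi.integral_prod_left
  have hpt : ∀ᵐ x ∂(volume : Measure (E n)),
      (w - averaging c s Q hQ hQf w : Lp ℝ 2 (volume : Measure (E n))) x ^ 2 ≤
      κ * density α w x + M⁻¹ * (V x * w x ^ 2) := by
    filter_upwards [Lp.coeFn_sub w (averaging c s Q hQ hQf w), averaging_apply c s Q hQ hQf w,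
      hi.prod_right_ae] with x h1 h3 h4
    rw [h1, Pi.sub_apply, h3]
    have hd0 := density_nonneg (α := α) w x
    -- On a piece only its own average contributes, by disjointness. Off the pieces the averaging
    -- operator gives zero, and `w² ≤ V w² / M` suffices.
    by_cases hx : x ∈ ⋃ i, Q i
    · obtain ⟨i, hxi⟩ := Set.mem_iUnion.1 hx
      rw [Finset.sum_eq_single i, Set.indicator_of_mem hxi, mul_one]
      · have := sq_sub_average_le hα (Lp.memLp w) hs (hQb i hxi) h4
        rw [Measure.addHaar_real_ball_center, ← hκ] at this
        rw [Measure.addHaar_real_ball_center]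
        have h5 : 0 ≤ M⁻¹ * (V x * w x ^ 2) := by have := hpos x; positivity
        linarith
      · intro j _ hj
        rw [Set.indicator_of_notMem fun hxj => Set.disjoint_left.1 (hQd hj) hxj hxi, mul_zero]
      · simp
    · rw [Finset.sum_eq_zero fun i _ => by
        rw [Set.indicator_of_notMem fun hxi => hx (Set.mem_iUnion.2 ⟨i, hxi⟩), mul_zero], sub_zero]
      have h5 : w x ^ 2 ≤ M⁻¹ * (V x * w x ^ 2) := by
        rw [← mul_assoc]
        refine le_mul_of_one_le_left (sq_nonneg _) ?_
        rw [inv_mul_eq_div, one_le_div hM]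
        exact htail x hx
      have h6 : 0 ≤ κ * density α w x := by positivity
      linarith
  rw [norm_L2_sq]
  have hmono := integral_mono_ae (Lp.memLp (w - averaging c s Q hQ hQf w)).integrable_sq
      ((hdens.const_mul κ).add (hiV.const_mul M⁻¹)) hpt
  refine hmono.trans ?_
  rw [integral_add' (hdens.const_mul κ) (hiV.const_mul M⁻¹), integral_const_mul,
    integral_const_mul]
  have h7 : ∫ x, density α w x = ∫ z, quotient α w z ^ 2 ∂(volume.prod volume) :=
    (integral_prod _ hi).symm
  rw [h7]
  have h8 : 0 ≤ ∫ z, quotient α w z ^ 2 ∂((volume : Measure (E n)).prod volume) :=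
    integral_nonneg fun _ => sq_nonneg _
  have h9 : 0 ≤ ∫ x, V x * w x ^ 2 := integral_nonneg fun x => by
    have := hpos x; positivity
  have h10 : 0 ≤ M⁻¹ := by positivity
  nlinarith [mul_nonneg hκ0 h9, mul_nonneg h10 h8]

/-- Balls have volume of order `s^n`, so the factor is a constant times `s^{2α}`. -/
theorem tendsto_ball_factor (hα : 0 < α) :
    Tendsto (fun s : ℝ => (volume.real (Metric.ball (0 : E n) s))⁻¹ *
      (2 * s) ^ ((n : ℝ) + 2 * α)) (𝓝[>] 0) (𝓝 0) := by
  set b := volume.real (Metric.ball (0 : E n) 1)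
  have hb : 0 < b :=
    ENNReal.toReal_pos (Metric.measure_ball_pos _ _ one_pos).ne' measure_ball_lt_top.ne
  have h1 : Tendsto (fun s : ℝ => b⁻¹ * 2 ^ ((n : ℝ) + 2 * α) * s ^ (2 * α)) (𝓝[>] 0) (𝓝 0) := by
    have : Tendsto (fun s : ℝ => s ^ (2 * α)) (𝓝 0) (𝓝 0) := by
      have := (Real.continuousAt_rpow_const 0 (2 * α) (Or.inr (by positivity))).tendsto
      rwa [Real.zero_rpow (by positivity)] at this
    simpa using (this.mono_left nhdsWithin_le_nhds).const_mul (b⁻¹ * 2 ^ ((n : ℝ) + 2 * α))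
  refine h1.congr' ?_
  filter_upwards [self_mem_nhdsWithin] with s hs
  have hs : 0 < s := hs
  have h2 : volume.real (Metric.ball (0 : E n) s) = s ^ n * b := by
    rw [Measure.real, Measure.addHaar_ball_of_pos _ _ hs, ENNReal.toReal_mul,
      ENNReal.toReal_ofReal (by positivity)]
    simp [b, Measure.real]
  rw [h2, Real.mul_rpow two_pos.le hs.le, Real.rpow_add hs, Real.rpow_natCast]
  have : s ^ n ≠ 0 := by positivity
  field_simp

/-- An operator that is approximated in norm by compact operators is compact. -/
theorem isCompactOperator_of_approx {H F : Type*} [NormedAddCommGroup H] [NormedSpace ℝ H]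
    [NormedAddCommGroup F] [NormedSpace ℝ F] [CompleteSpace F] {J : H →L[ℝ] F}
    (h : ∀ ε > 0, ∃ T : H →L[ℝ] F, IsCompactOperator T ∧ ∀ p, ‖J p - T p‖ ≤ ε * ‖p‖) :
    IsCompactOperator J := by
  refine (isClosed_setOfPred_isCompactOperator (σ₁₂ := RingHom.id ℝ) (M₁ := H)
    (M₂ := F)).closure_subset ((Metric.mem_closure_iff (α := H →L[ℝ] F)).2 fun ε hε => ?_)
  obtain ⟨T, hT, hle⟩ := h (ε / 2) (half_pos hε)
  refine ⟨T, hT, ?_⟩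
  rw [dist_eq_norm]
  exact lt_of_le_of_lt (ContinuousLinearMap.opNorm_le_bound _ (half_pos hε).le hle)
    (half_lt_self hε)

theorem norm_toL2_sub_averaging_sq_le (hα : 0 < α) {V₀ : ℝ} (hVc : Continuous V) (hV₀ : 0 < V₀)
    (hV : ∀ x, V₀ ≤ V x) {N : ℕ} (c : Fin N → E n)
    {s : ℝ} (hs : 0 < s) (Q : Fin N → Set (E n))
    (hQ : ∀ i, MeasurableSet (Q i)) (hQf : ∀ i, volume (Q i) ≠ ⊤)
    (hQb : ∀ i, Q i ⊆ Metric.ball (c i) s) (hQd : Pairwise (Function.onFun Disjoint Q))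
    {M : ℝ} (hM : 0 < M) (htail : ∀ x ∉ ⋃ i, Q i, M ≤ V x) (p : energySpace n α V) :
    ‖toL2 hVc hV₀ hV p - averaging c s Q hQ hQf (toL2 hVc hV₀ hV p)‖ ^ 2 ≤
      ((volume.real (Metric.ball (0 : E n) s))⁻¹ * (2 * s) ^ ((n : ℝ) + 2 * α) + M⁻¹) *
        ‖p‖ ^ 2 := by
  have hpos : ∀ x, 0 < V x := fun x => hV₀.trans_le (hV x)
  have hw := coeFn_toL2 hVc hV₀ hV p
  have hq : (fun z => quotient α (fn p) z ^ 2) =ᵐ[volume.prod volume]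
      fun z => quotient α (toL2 hVc hV₀ hV p) z ^ 2 := by
    filter_upwards [quotient_congr (α := α) hw] with z hz
    rw [hz]
  have hqV : (fun x => V x * fn p x ^ 2) =ᵐ[volume]
      fun x => V x * toL2 hVc hV₀ hV p x ^ 2 := by
    filter_upwards [hw] with z hz
    rw [hz]
  have h1 := norm_sub_averaging_sq_le hα hpos c hs Q hQ hQf hQb hQd hM htail (toL2 hVc hV₀ hV p)
    ((integrable_quotient_sq hVc hV₀ hV p).congr hq) ((memHV_fn hVc hV₀ hV p).2.congr hqV)
  have h2 := norm_sq_eq hpos p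
  rw [integral_congr_ae hq, integral_congr_ae hqV] at h2
  exact h1.trans_eq (congrArg _ h2.symm)

/-- For large balls and fine partitions the averaging error is small. -/
theorem exists_averaging_data (hα : 0 < α) (hVinf : Tendsto V (cocompact (E n)) atTop)
    {ε : ℝ} (hε : 0 < ε) : ∃ (s M : ℝ) (N : ℕ) (c : Fin N → E n) (Q : Fin N → Set (E n)),
      0 < s ∧ 0 < M ∧ (∀ i, MeasurableSet (Q i)) ∧ (∀ i, volume (Q i) ≠ ⊤) ∧
      (∀ i, Q i ⊆ Metric.ball (c i) s) ∧ Pairwise (Function.onFun Disjoint Q) ∧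
      (∀ x ∉ ⋃ i, Q i, M ≤ V x) ∧
      (volume.real (Metric.ball (0 : E n) s))⁻¹ * (2 * s) ^ ((n : ℝ) + 2 * α) + M⁻¹ ≤ ε ^ 2 := by
  -- Half of `ε²` is reserved for the tail, where `M⁻¹ = ε² / 2`, and half for the oscillation on
  -- small balls.
  have hM : 0 < 2 / ε ^ 2 := by positivity
  obtain ⟨K, hK, hKM⟩ := mem_cocompact.1 (hVinf.eventually_ge_atTop (2 / ε ^ 2))
  obtain ⟨s, hs1, hs⟩ := (((tendsto_ball_factor (n := n) hα).eventually_lt_const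
    (show (0 : ℝ) < ε ^ 2 / 2 by positivity)).and self_mem_nhdsWithin).exists
  have hs : 0 < s := hs
  obtain ⟨N, c, Q, hQ, hQb, hQd, hQK⟩ := exists_small_pieces hK hs
  refine ⟨s, 2 / ε ^ 2, N, c, Q, hs, hM, hQ, fun i =>
    ((measure_mono (hQb i)).trans_lt measure_ball_lt_top).ne, hQb, hQd,
    fun x hx => hKM fun hxK => hx (hQK hxK), ?_⟩
  have : (2 / ε ^ 2)⁻¹ = ε ^ 2 / 2 := by field_simp
  rw [this]
  linarith [hs1]

/-- The embedding of `H^α_V` into `L²` is compact. -/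
theorem isCompactOperator_toL2 (hα : 0 < α) {V₀ : ℝ} (hVc : Continuous V) (hV₀ : 0 < V₀)
    (hV : ∀ x, V₀ ≤ V x) (hVinf : Tendsto V (cocompact (E n)) atTop) :
    IsCompactOperator (toL2 (α := α) hVc hV₀ hV) := by
  refine isCompactOperator_of_approx fun ε hε => ?_
  have hdata := exists_averaging_data hα hVinf hε
  choose s M N c Q hs hM hQ hQf hQb hQd htail hle using hdata
  refine ⟨(averaging c s Q hQ hQf).comp (toL2 hVc hV₀ hV),
    IsCompactOperator.comp_clm (isCompactOperator_averaging c s Q hQ hQf)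
      (toL2 hVc hV₀ hV), fun p => ?_⟩
  have h3 := (norm_toL2_sub_averaging_sq_le hα hVc hV₀ hV c hs Q hQ hQf hQb hQd hM htail p).trans
    ((mul_le_mul_of_nonneg_right hle (sq_nonneg ‖p‖)).trans_eq (mul_pow ε ‖p‖ 2).symm)
  exact le_of_sq_le_sq h3 (mul_nonneg hε.le (norm_nonneg p))

end Compactness

end FracSchrodinger

/-! ### The fractional Sobolev inequality -/

namespace FracSchrodinger

section Sobolev

variable {n : ℕ} {α : ℝ} {V : E n → ℝ}

theorem two_lt_critExp (hα : 0 < α) (hn : 2 * α < n) : 2 < critExp n α := by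
  have : (0 : ℝ) < n - 2 * α := by linarith
  rw [critExp, lt_div_iff₀ this]
  linarith

theorem growthExp_add_one (hn : 2 * α < n) : growthExp n α + 1 = critExp n α := by
  have : (0 : ℝ) < n - 2 * α := by linarith
  rw [critExp, growthExp]
  field_simp
  ring

/-- Optimisation of the radius in the pointwise Sobolev estimate. -/
theorem rpow_critExp_le (hα : 0 < α) (hn : 2 * α < n) {a D c₁ c₂ T : ℝ} (ha : 0 ≤ a) (hD : 0 ≤ D)
    (hc₁ : 0 < c₁) (hc₂ : 0 < c₂) (hT : 0 < T)
    (h : ∀ s : ℝ, 0 < s → a ^ 2 ≤ c₁ * s ^ (2 * α) * D +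
      c₂ * T ^ (2 / critExp n α) * s ^ (-((n : ℝ) - 2 * α))) :
    a ^ critExp n α ≤ 2 * c₁ * (2 * c₂) ^ (2 * α / (n - 2 * α)) *
      T ^ (1 - 2 / critExp n α) * D := by
  have hm : (0 : ℝ) < n - 2 * α := by linarith
  have hn0 : (0 : ℝ) < n := by linarith
  have hp := two_lt_critExp hα hn
  rcases ha.eq_or_lt with rfl | ha
  · rw [Real.zero_rpow (by linarith)]
    positivity
  set m := (n : ℝ) - 2 * α
  set κ := 2 * α / m with hκ
  set t := 2 * c₂ * T ^ (2 / critExp n α) with ht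
  have ht0 : 0 < t := by positivity
  have hta : 0 < t / a ^ 2 := by positivity
  -- At this radius the second term equals `a² / 2` and is absorbed on the left. The powers then
  -- match because `2*_α = 2 + 2κ` and `2κ / 2*_α = 1 - 2 / 2*_α`.
  have h1 := h ((t / a ^ 2) ^ (1 / m)) (by positivity)
  rw [← Real.rpow_mul hta.le, ← Real.rpow_mul hta.le] at h1
  have e1 : 1 / m * (2 * α) = κ := by rw [hκ]; ring
  have e2 : 1 / m * -m = -1 := by field_simp
  rw [e1, e2, Real.rpow_neg_one, Real.div_rpow ht0.le (by positivity)] at h1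
  have e3 : c₂ * T ^ (2 / critExp n α) * (t / a ^ 2)⁻¹ = a ^ 2 / 2 := by
    rw [ht]; field_simp
  rw [e3] at h1
  have hak : 0 < (a ^ 2) ^ κ := by positivity
  have h2 : a ^ 2 * (a ^ 2) ^ κ ≤ 2 * c₁ * t ^ κ * D := by
    have h3 : a ^ 2 ≤ 2 * c₁ * t ^ κ * D / (a ^ 2) ^ κ := by
      have : 2 * c₁ * t ^ κ * D / (a ^ 2) ^ κ = 2 * (c₁ * (t ^ κ / (a ^ 2) ^ κ) * D) := by ring
      linarith
    rwa [le_div_iff₀ hak] at h3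
  have e4 : a ^ critExp n α = a ^ 2 * (a ^ 2) ^ κ := by
    rw [← Real.rpow_natCast a 2, ← Real.rpow_mul ha.le, ← Real.rpow_add ha]
    congr 1
    rw [critExp, hκ, show (n : ℝ) - 2 * α = m from rfl]
    push_cast
    field_simp
    simp only [m]
    ring
  have e5 : t ^ κ = (2 * c₂) ^ κ * T ^ (1 - 2 / critExp n α) := by
    rw [ht, Real.mul_rpow (by positivity) (by positivity), ← Real.rpow_mul hT.le]
    congr 2
    rw [critExp, hκ]
    field_simp
    ring
  rw [e4]
  refine h2.trans_eq ?_
  rw [e5]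
  ring

theorem volume_real_ball (x : E n) {s : ℝ} (hs : 0 < s) :
    volume.real (Metric.ball x s) = s ^ n * volume.real (Metric.ball (0 : E n) 1) := by
  rw [Measure.real, Measure.addHaar_ball_of_pos _ _ hs, ENNReal.toReal_mul,
    ENNReal.toReal_ofReal (by positivity)]
  simp [Measure.real]

theorem volume_real_ball_pos (x : E n) {s : ℝ} (hs : 0 < s) :
    0 < volume.real (Metric.ball x s) :=
  ENNReal.toReal_pos (Metric.measure_ball_pos _ _ hs).ne' measure_ball_lt_top.ne

/-- Hölder's inequality for the mean over a set of finite measure. -/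
theorem abs_setIntegral_le {p : ℝ} (hp : 1 < p) {u : E n → ℝ}
    (hu : MemLp u (ENNReal.ofReal p) volume) {B : Set (E n)} (hB : volume B ≠ ⊤) :
    |∫ y in B, u y| ≤ (∫ y, |u y| ^ p) ^ (1 / p) * volume.real B ^ (1 - 1 / p) := by
  have hp0 : 0 < p := by linarith
  have hpt : (ENNReal.ofReal p).toReal = p := ENNReal.toReal_ofReal hp0.le
  have : IsFiniteMeasure ((volume : Measure (E n)).restrict B) := ⟨by simpa using hB.lt_top⟩
  have hq := Real.HolderConjugate.conjExponent hp
  have hpq : 1 / Real.conjExponent p = 1 - 1 / p := by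
    have := hq.inv_add_inv_eq_one
    rw [one_div, one_div]
    linarith
  have h1 := integral_mul_le_Lp_mul_Lq_of_nonneg hq (μ := volume.restrict B) (f := fun y => |u y|)
    (g := fun _ => (1 : ℝ)) (Eventually.of_forall fun _ => abs_nonneg _)
    (Eventually.of_forall fun _ => zero_le_one) ((hu.restrict B).abs) (memLp_const _)
  simp only [mul_one, Real.one_rpow, hpq, integral_const, smul_eq_mul] at h1
  have h3 : (volume.restrict B).real Set.univ = volume.real B := by simp [Measure.real]
  rw [h3] at h1
  have hint : Integrable (fun y => |u y| ^ p) volume := by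
    have := hu.integrable_norm_rpow (by simpa using hp0) ENNReal.ofReal_ne_top
    simpa only [hpt, Real.norm_eq_abs] using this
  refine abs_integral_le_integral_abs.trans (h1.trans ?_)
  refine mul_le_mul_of_nonneg_right (Real.rpow_le_rpow (integral_nonneg fun y => by positivity)
    (setIntegral_le_integral hint (Eventually.of_forall fun y => ?_)) (by positivity))
    (by positivity)
  exact Real.rpow_nonneg (abs_nonneg _) _

/-- The pointwise form of the fractional Sobolev inequality. -/
theorem exists_pointwise_sobolev (hα : 0 < α) (hn : 2 * α < n) :
    ∃ S > 0, ∀ u : E n → ℝ, MemLp u 2 volume → MemLp u (ENNReal.ofReal (critExp n α)) volume →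
      0 < ∫ y, |u y| ^ critExp n α → ∀ x, Integrable (fun y => quotient α u (x, y) ^ 2) volume →
      |u x| ^ critExp n α ≤ S * (∫ y, |u y| ^ critExp n α) ^ (1 - 2 / critExp n α) *
        density α u x := by
  have hp := two_lt_critExp hα hn
  have hm : (0 : ℝ) < n - 2 * α := by linarith
  have hn0 : (0 : ℝ) < n := by linarith
  set b := volume.real (Metric.ball (0 : E n) 1) with hb
  have hb0 : 0 < b := volume_real_ball_pos 0 one_pos
  set p := critExp n α with hpdef
  have hp0 : 0 < p := by linarith
  set c₁ := 2 * (b⁻¹ * 2 ^ ((n : ℝ) + 2 * α))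
  set c₂ := 2 * b ^ (-(2 / p))
  refine ⟨2 * c₁ * (2 * c₂) ^ (2 * α / (n - 2 * α)), by positivity, fun u hu hup hT x hx => ?_⟩
  set T := ∫ y, |u y| ^ p
  refine rpow_critExp_le hα hn (abs_nonneg _) (density_nonneg _ _) (by positivity)
    (by positivity) hT fun s hs => ?_
  -- The oscillation estimate from the compactness proof is now used with the ball centred at `x`
  -- and a free radius. The mean itself is bounded through Hölder's inequality.
  have h1 := sq_sub_average_le hα hu hs (Metric.mem_ball_self hs) hx
  have h2 := abs_setIntegral_le (by linarith : 1 < p) hup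
    (measure_ball_lt_top (x := x) (r := s) (μ := (volume : Measure (E n)))).ne
  set bs := volume.real (Metric.ball x s) with hbs
  have hbs0 : 0 < bs := volume_real_ball_pos x hs
  set A := ∫ y in Metric.ball x s, u y
  have h3 : (bs⁻¹ * A) ^ 2 ≤ T ^ (2 / p) * bs ^ (-(2 / p)) := by
    have h4 : |bs⁻¹ * A| ≤ T ^ (1 / p) * bs ^ (-(1 / p)) := by
      rw [abs_mul, abs_of_pos (inv_pos.2 hbs0)]
      calc bs⁻¹ * |A| ≤ bs⁻¹ * (T ^ (1 / p) * bs ^ (1 - 1 / p)) := by gcongr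
        _ = T ^ (1 / p) * bs ^ (-(1 / p)) := by
          rw [sub_eq_add_neg, Real.rpow_add hbs0, Real.rpow_one]
          field_simp
    calc (bs⁻¹ * A) ^ 2 = |bs⁻¹ * A| ^ 2 := (sq_abs _).symm
      _ ≤ (T ^ (1 / p) * bs ^ (-(1 / p))) ^ 2 := by gcongr
      _ = _ := by
        rw [mul_pow, ← Real.rpow_natCast, ← Real.rpow_mul hT.le, ← Real.rpow_natCast (bs ^ _),
          ← Real.rpow_mul hbs0.le]
        congr 2 <;> push_cast <;> ring
  have e1 : bs = s ^ (n : ℝ) * b := by rw [Real.rpow_natCast]; exact volume_real_ball x hs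
  have e2 : bs ^ (-(2 / p)) = b ^ (-(2 / p)) * s ^ (-((n : ℝ) - 2 * α)) := by
    rw [e1, Real.mul_rpow (by positivity) hb0.le, ← Real.rpow_mul hs.le, mul_comm]
    congr 2
    rw [hpdef, critExp]
    field_simp
  have e3 : bs⁻¹ * (2 * s) ^ ((n : ℝ) + 2 * α) = b⁻¹ * 2 ^ ((n : ℝ) + 2 * α) * s ^ (2 * α) := by
    rw [e1, Real.mul_rpow two_pos.le hs.le, Real.rpow_add hs]
    field_simp
  rw [e3] at h1
  rw [e2] at h3
  rw [sq_abs]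
  have h5 : u x ^ 2 ≤ 2 * (u x - bs⁻¹ * A) ^ 2 + 2 * (bs⁻¹ * A) ^ 2 := by
    nlinarith [sq_nonneg (u x - bs⁻¹ * A - bs⁻¹ * A)]
  refine h5.trans ?_
  have e4 : c₁ * s ^ (2 * α) * density α u x + c₂ * T ^ (2 / p) * s ^ (-((n : ℝ) - 2 * α)) =
      2 * (b⁻¹ * 2 ^ ((n : ℝ) + 2 * α) * s ^ (2 * α) * density α u x) +
      2 * (T ^ (2 / p) * (b ^ (-(2 / p)) * s ^ (-((n : ℝ) - 2 * α)))) := by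
    simp only [c₁, c₂]; ring
  rw [e4]
  linarith

/-- The fractional Sobolev inequality for functions already known to lie in `L^{2*}`. -/
theorem exists_sobolev_of_memLp (hα : 0 < α) (hn : 2 * α < n) :
    ∃ S > 0, ∀ u : E n → ℝ, MemLp u 2 volume → MemLp u (ENNReal.ofReal (critExp n α)) volume →
      Integrable (fun z => quotient α u z ^ 2) (volume.prod volume) →
      eLpNorm u (ENNReal.ofReal (critExp n α)) volume ≤
        ENNReal.ofReal (S * √(∫ z, quotient α u z ^ 2 ∂(volume.prod volume))) := by
  obtain ⟨S, hS, h⟩ := exists_pointwise_sobolev hα hn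
  have hp := two_lt_critExp hα hn
  set p := critExp n α
  have hp0 : 0 < p := by linarith
  have hpt : (ENNReal.ofReal p).toReal = p := ENNReal.toReal_ofReal hp0.le
  refine ⟨√S, Real.sqrt_pos.2 hS, fun u hu hup hi => ?_⟩
  rw [hup.eLpNorm_eq_integral_rpow_norm (by simpa using hp0) ENNReal.ofReal_ne_top, hpt]
  simp_rw [Real.norm_eq_abs]
  refine ENNReal.ofReal_le_ofReal ?_
  set G := ∫ z, quotient α u z ^ 2 ∂((volume : Measure (E n)).prod volume) with hG
  have hG0 : 0 ≤ G := integral_nonneg fun _ => sq_nonneg _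
  set T := ∫ y, |u y| ^ p with hT
  have hT0 : 0 ≤ T := integral_nonneg fun _ => by positivity
  rcases hT0.eq_or_lt with hz | hpos
  · rw [← hz, Real.zero_rpow (by positivity)]
    positivity
  have hint : Integrable (fun y => |u y| ^ p) volume := by
    have := hup.integrable_norm_rpow (by simpa using hp0) ENNReal.ofReal_ne_top
    simpa only [hpt, Real.norm_eq_abs] using this
  have hdens : Integrable (density α u) volume := hi.integral_prod_left
  have h1 : T ≤ S * T ^ (1 - 2 / p) * G := by
    have h2 : ∫ x, density α u x = G := (integral_prod _ hi).symm
    rw [← h2, ← integral_const_mul]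
    refine integral_mono_ae hint (hdens.const_mul _) ?_
    filter_upwards [hi.prod_right_ae] with x hx
    exact h u hu hup hpos x hx
  -- Cancelling a power of `T` needs `T` positive and finite. Finiteness is why `L^{2*}` membership
  -- is assumed here and removed later by truncation.
  have h3 : T ^ (2 / p) ≤ S * G := by
    have h4 : T = T ^ (1 - 2 / p) * T ^ (2 / p) := by
      rw [← Real.rpow_add hpos, sub_add_cancel, Real.rpow_one]
    have h5 : 0 < T ^ (1 - 2 / p) := by positivity
    refine le_of_mul_le_mul_left ?_ h5
    rw [← h4]
    linarith
  rw [← Real.sqrt_mul hS.le]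
  refine Real.le_sqrt_of_sq_le ?_
  rw [← Real.rpow_natCast, ← Real.rpow_mul hT0]
  convert h3 using 2
  push_cast
  ring

/-- Truncation at height `M`. -/
noncomputable def truncate {n : ℕ} (M : ℝ) (u : E n → ℝ) (x : E n) : ℝ := max (-M) (min (u x) M)

theorem abs_truncate_le {M : ℝ} (hM : 0 ≤ M) (u : E n → ℝ) (x : E n) : |truncate M u x| ≤ M := by
  unfold truncate
  rw [abs_le]
  exact ⟨le_max_left _ _, max_le (by linarith) (min_le_right _ _)⟩

theorem abs_truncate_le_abs {M : ℝ} (hM : 0 ≤ M) (u : E n → ℝ) (x : E n) :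
    |truncate M u x| ≤ |u x| := by
  unfold truncate
  rcases max_cases (-M) (min (u x) M) with h | h <;> rcases min_cases (u x) M with h' | h' <;>
    rcases abs_cases (u x) with h'' | h'' <;> rw [abs_le] <;> constructor <;> linarith

theorem abs_truncate_sub_le (M : ℝ) (u : E n → ℝ) (x y : E n) :
    |truncate M u x - truncate M u y| ≤ |u x - u y| := by
  unfold truncate
  refine (abs_max_sub_max_le_max _ _ _ _).trans ?_
  rw [sub_self, abs_zero, max_eq_right (abs_nonneg _)]
  refine (abs_min_sub_min_le_max _ _ _ _).trans ?_
  rw [sub_self, abs_zero, max_eq_left (abs_nonneg _)]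

theorem truncate_eq {M : ℝ} {u : E n → ℝ} {x : E n} (h : |u x| ≤ M) : truncate M u x = u x := by
  rw [abs_le] at h
  rw [truncate, min_eq_left h.2, max_eq_right h.1]

theorem aestronglyMeasurable_truncate (M : ℝ) {u : E n → ℝ} (hu : AEStronglyMeasurable u volume) :
    AEStronglyMeasurable (truncate M u) volume :=
  (aemeasurable_const.max (hu.aemeasurable.min aemeasurable_const)).aestronglyMeasurable

/-- The fractional Sobolev inequality. -/
theorem exists_sobolev (hα : 0 < α) (hn : 2 * α < n) :
    ∃ S > 0, ∀ u : E n → ℝ, MemLp u 2 volume →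
      Integrable (fun z => quotient α u z ^ 2) (volume.prod volume) →
      eLpNorm u (ENNReal.ofReal (critExp n α)) volume ≤
        ENNReal.ofReal (S * √(∫ z, quotient α u z ^ 2 ∂(volume.prod volume))) := by
  obtain ⟨S, hS, h⟩ := exists_sobolev_of_memLp hα hn
  have hp := two_lt_critExp hα hn
  set p := critExp n α
  have hp0 : 0 < p := by linarith
  have hpt : (ENNReal.ofReal p).toReal = p := ENNReal.toReal_ofReal hp0.le
  refine ⟨S, hS, fun u hu hi => ?_⟩
  have hbound : ∀ M : ℕ, eLpNorm (truncate M u) (ENNReal.ofReal p) volume ≤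
      ENNReal.ofReal (S * √(∫ z, quotient α u z ^ 2 ∂(volume.prod volume))) := by
    intro M
    have hM : (0 : ℝ) ≤ M := Nat.cast_nonneg M
    have hmeas := aestronglyMeasurable_truncate (M : ℝ) hu.aestronglyMeasurable
    have h2 : MemLp (truncate M u) 2 volume :=
      hu.mono hmeas (Eventually.of_forall fun x => abs_truncate_le_abs hM u x)
    -- A bounded `L²` function lies in `L^p` for `p > 2`, with `M^{p - 2} u²` as majorant.
    have hpp : MemLp (truncate M u) (ENNReal.ofReal p) volume := by
      rw [← integrable_norm_rpow_iff hmeas (by simpa using hp0) ENNReal.ofReal_ne_top, hpt]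
      refine (hu.integrable_sq.const_mul ((M : ℝ) ^ (p - 2))).mono'
        (hmeas.norm.aemeasurable.pow_const p).aestronglyMeasurable
        (Eventually.of_forall fun x => ?_)
      rw [Real.norm_of_nonneg (by positivity), Real.norm_eq_abs]
      have e1 : |truncate M u x| ^ p = |truncate M u x| ^ (p - 2) * |truncate M u x| ^ 2 := by
        rcases (abs_nonneg (truncate M u x)).eq_or_lt with h0 | h0
        · rw [← h0, Real.zero_rpow hp0.ne']
          simp
        · rw [← Real.rpow_natCast, ← Real.rpow_add h0]
          congr 1
          push_cast
          ring
      rw [e1, ← sq_abs (u x)]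
      exact mul_le_mul (Real.rpow_le_rpow (abs_nonneg _) (abs_truncate_le hM u x) (by linarith))
        (pow_le_pow_left₀ (abs_nonneg _) (abs_truncate_le_abs hM u x) 2) (by positivity)
        (by positivity)
    have hle : ∀ z, quotient α (truncate M u) z ^ 2 ≤ quotient α u z ^ 2 := fun z => by
      rw [quotient, quotient, div_pow, div_pow]
      gcongr ?_ / _
      exact sq_le_sq.2 (abs_truncate_sub_le _ _ _ _)
    have hii : Integrable (fun z => quotient α (truncate M u) z ^ 2) (volume.prod volume) :=
      hi.mono' ((aestronglyMeasurable_quotient hmeas).pow 2) (Eventually.of_forall fun z => by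
        rw [Real.norm_of_nonneg (sq_nonneg _)]
        exact hle z)
    refine (h _ h2 hpp hii).trans (ENNReal.ofReal_le_ofReal ?_)
    exact mul_le_mul_of_nonneg_left (Real.sqrt_le_sqrt (integral_mono hii hi hle)) hS.le
  -- Truncation is 1-Lipschitz and does not raise the Gagliardo energy, so the bound is uniform in
  -- `M`. Fatou's lemma lets `M → ∞`.
  refine (Lp.eLpNorm_lim_le_liminf_eLpNorm (f := fun M : ℕ => truncate M u)
    (fun M => aestronglyMeasurable_truncate _ hu.aestronglyMeasurable) u
    (Eventually.of_forall fun x => ?_)).trans ?_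
  · refine tendsto_const_nhds.congr' ?_
    filter_upwards [eventually_ge_atTop ⌈|u x|⌉₊] with M hM
    exact (truncate_eq (Nat.ceil_le.1 hM)).symm
  · refine (liminf_le_liminf (Eventually.of_forall hbound)).trans ?_
    simp

end Sobolev

end FracSchrodinger

/-! ### The Sobolev constant: attained and positive -/

namespace FracSchrodinger

section SobolevConst

variable {n : ℕ} {α : ℝ} {V : E n → ℝ}

theorem normV_sq {V₀ : ℝ} (hV₀ : 0 < V₀) (hV : ∀ x, V₀ ≤ V x) (u : E n → ℝ) : normV α V u ^ 2 =
      (∫ z, quotient α u z ^ 2 ∂(volume.prod volume)) + ∫ x, V x * u x ^ 2 := by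
  have hinner : innerV α V u u =
      (∫ z, quotient α u z ^ 2 ∂(volume.prod volume)) + ∫ x, V x * u x ^ 2 := by
    rw [innerV]
    simp_rw [← quotient_mul, sq, mul_assoc]
  rw [normV, hinner, Real.sq_sqrt]
  refine add_nonneg (integral_nonneg fun _ => sq_nonneg _) (integral_nonneg fun x => ?_)
  have := hV₀.trans_le (hV x)
  positivity

theorem eLpNorm_two_eq {u : E n → ℝ} (hu : MemLp u 2 volume) :
    eLpNorm u 2 volume = ENNReal.ofReal √(∫ x, u x ^ 2) := by
  rw [hu.eLpNorm_eq_integral_rpow_norm two_ne_zero ENNReal.ofNat_ne_top, Real.sqrt_eq_rpow]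
  simp

/-- The set of admissible constants in the Sobolev embedding is non-empty. -/
theorem exists_sobolevConst_bound (hα : 0 < α) (hn : 2 * α < n) {V₀ : ℝ}
    (hV₀ : 0 < V₀) (hV : ∀ x, V₀ ≤ V x) : ∃ C : ℝ, 0 ≤ C ∧ ∀ u : E n → ℝ, MemHV α V u →
      eLpNorm u 2 volume ≤ ENNReal.ofReal (C * normV α V u) ∧
      eLpNorm u (ENNReal.ofReal (critExp n α)) volume ≤ ENNReal.ofReal (C * normV α V u) := by
  obtain ⟨S, hS, hsob⟩ := exists_sobolev hα hn
  refine ⟨max S (√V₀)⁻¹, by positivity, fun u hu => ?_⟩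
  have hN := normV_sq (α := α) hV₀ hV u
  have hN0 : 0 ≤ normV α V u := Real.sqrt_nonneg _
  have hG : 0 ≤ ∫ z, quotient α u z ^ 2 ∂((volume : Measure (E n)).prod volume) :=
    integral_nonneg fun _ => sq_nonneg _
  have hW : 0 ≤ ∫ x, V x * u x ^ 2 := integral_nonneg fun x => by
    have := hV₀.trans_le (hV x)
    positivity
  have hu2 := hu.1.1
  constructor
  · rw [eLpNorm_two_eq hu2]
    refine ENNReal.ofReal_le_ofReal ?_
    have h1 : V₀ * ∫ x, u x ^ 2 ≤ ∫ x, V x * u x ^ 2 := by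
      rw [← integral_const_mul]
      exact integral_mono (hu2.integrable_sq.const_mul _) hu.2 fun x =>
        mul_le_mul_of_nonneg_right (hV x) (sq_nonneg _)
    have h2 : √(∫ x, u x ^ 2) ≤ (√V₀)⁻¹ * normV α V u := by
      rw [Real.sqrt_le_left (by positivity), mul_pow, inv_pow, Real.sq_sqrt hV₀.le, inv_mul_eq_div,
        le_div_iff₀ hV₀]
      linarith
    refine h2.trans ?_
    gcongr
    exact le_max_right _ _
  · refine (hsob u hu2 (by simpa only [quotient_sq] using hu.1.2)).trans
      (ENNReal.ofReal_le_ofReal ?_)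
    refine mul_le_mul (le_max_left _ _) ?_ (Real.sqrt_nonneg _) (by positivity)
    rw [Real.sqrt_le_left hN0]
    linarith

theorem sobolevConst_nonneg : 0 ≤ sobolevConst α V := Real.sInf_nonneg fun _ hC => hC.1

/-- The Sobolev constant is admissible in the Sobolev embedding. -/
theorem eLpNorm_le_sobolevConst (hα : 0 < α) (hn : 2 * α < n) {V₀ : ℝ}
    (hV₀ : 0 < V₀) (hV : ∀ x, V₀ ≤ V x) {u : E n → ℝ} (hu : MemHV α V u) :
    eLpNorm u 2 volume ≤ ENNReal.ofReal (sobolevConst α V * normV α V u) ∧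
    eLpNorm u (ENNReal.ofReal (critExp n α)) volume ≤
      ENNReal.ofReal (sobolevConst α V * normV α V u) := by
  set S := {C : ℝ | 0 ≤ C ∧ ∀ u : E n → ℝ, MemHV α V u →
    eLpNorm u 2 volume ≤ ENNReal.ofReal (C * normV α V u) ∧
    eLpNorm u (ENNReal.ofReal (critExp n α)) volume ≤ ENNReal.ofReal (C * normV α V u)} with hS
  have hne : S.Nonempty := exists_sobolevConst_bound hα hn hV₀ hV
  have hN0 : 0 ≤ normV α V u := Real.sqrt_nonneg _
  -- For `u` of positive norm the bound says that a fixed quotient is at most `C`, so it passes to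
  -- the infimum. Norm zero is separate, since one cannot divide.
  have key : ∀ a : ENNReal, (∀ C ∈ S, a ≤ ENNReal.ofReal (C * normV α V u)) →
      a ≤ ENNReal.ofReal (sInf S * normV α V u) := by
    intro a ha
    obtain ⟨C₀, hC₀⟩ := hne
    have hat : a ≠ ⊤ := ((ha C₀ hC₀).trans_lt ENNReal.ofReal_lt_top).ne
    rcases hN0.eq_or_lt with h0 | h0
    · have := ha C₀ hC₀
      rw [← h0, mul_zero] at this ⊢
      exact this
    · rw [ENNReal.le_ofReal_iff_toReal_le hat
        (mul_nonneg (Real.sInf_nonneg fun _ hC => hC.1) hN0), ← div_le_iff₀ h0]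
      refine le_csInf ⟨C₀, hC₀⟩ fun C hC => ?_
      rw [div_le_iff₀ h0, ← ENNReal.le_ofReal_iff_toReal_le hat (mul_nonneg hC.1 hN0)]
      exact ha C hC
  exact ⟨key _ fun C hC => (hC.2 u hu).1, key _ fun C hC => (hC.2 u hu).2⟩

/-- The radial majorant of Gagliardo integrands of Lipschitz functions is integrable. -/
theorem integrable_min_kernel (hn : n ≠ 0) (hα0 : 0 < α) (hα1 : α < 1) :
    Integrable (fun z : E n => min 1 (‖z‖ ^ 2) / ‖z‖ ^ ((n : ℝ) + 2 * α)) volume := by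
  have : Nonempty (Fin n) := ⟨⟨0, Nat.pos_of_ne_zero hn⟩⟩
  have : Nontrivial (E n) := inferInstance
  refine (integrable_fun_norm_addHaar (volume : Measure (E n))
    (f := fun y : ℝ => min 1 (y ^ 2) / y ^ ((n : ℝ) + 2 * α))).2 ?_
  rw [finrank_euclideanSpace, Fintype.card_fin]
  have hpow : ∀ y : ℝ, 0 < y → y ^ (n - 1) = y ^ ((n : ℝ) - 1) := fun y hy => by
    rw [← Real.rpow_natCast, Nat.cast_sub (Nat.pos_of_ne_zero hn), Nat.cast_one]
  -- With the radial weight `y^{n-1}` the integrand is `y^{1 - 2α}` on `(0, 1)`, integrable since `α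
  -- < 1`, and `y^{-1 - 2α}` beyond, integrable since `α > 0`.
  rw [← Set.Ioo_union_Ici_eq_Ioi one_pos, integrableOn_union]
  constructor
  · refine ((intervalIntegral.integrableOn_Ioo_rpow_iff one_pos).2
      (by linarith : -1 < 1 - 2 * α)).congr_fun (fun y hy => ?_) measurableSet_Ioo
    simp only [smul_eq_mul]
    rw [min_eq_right (by nlinarith [hy.1, hy.2]), hpow y hy.1, ← Real.rpow_natCast y 2,
      ← Real.rpow_sub hy.1, ← Real.rpow_add hy.1]
    congr 1
    push_cast
    ring
  · rw [integrableOn_Ici_iff_integrableOn_Ioi]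
    refine (integrableOn_Ioi_rpow_of_lt (by linarith : -1 - 2 * α < -1) one_pos).congr_fun
      (fun y hy => ?_) measurableSet_Ioi
    have hy1 : 1 < y := hy
    have hy : 0 < y := one_pos.trans hy1
    simp only [smul_eq_mul]
    rw [min_eq_left (by nlinarith), hpow y hy, one_div, ← Real.rpow_neg hy.le, ← Real.rpow_add hy]
    congr 1
    ring

/-- The energy space is not trivial: it contains the hat function `max 0 (1 - |x|)`. -/
theorem memHV_hat (hn : n ≠ 0) (hα0 : 0 < α) (hα1 : α < 1) (hVc : Continuous V) :
    MemHV α V fun x => max 0 (1 - ‖x‖) := by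
  set u : E n → ℝ := fun x => max 0 (1 - ‖x‖) with hu
  have huc : Continuous u := by fun_prop
  set B := Metric.closedBall (0 : E n) 1
  have hu0 : ∀ x ∉ B, u x = 0 := fun x hx => by
    rw [mem_closedBall_zero_iff, not_le] at hx
    exact max_eq_left (by linarith)
  have hsupp : HasCompactSupport u := HasCompactSupport.intro (isCompact_closedBall 0 1) hu0
  have hle1 : ∀ x, u x ∈ Set.Icc (0 : ℝ) 1 := fun x =>
    ⟨le_max_left _ _, max_le zero_le_one (by linarith [norm_nonneg x])⟩
  have hlip : ∀ x y, |u x - u y| ≤ ‖x - y‖ := fun x y => by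
    refine (abs_max_sub_max_le_max _ _ _ _).trans ?_
    rw [sub_self, abs_zero, max_eq_right (abs_nonneg _), sub_sub_sub_cancel_left, ← norm_sub_rev y]
    exact abs_norm_sub_norm_le y x
  refine ⟨⟨huc.memLp_of_hasCompactSupport hsupp, ?_⟩, ?_⟩
  · set k : E n → ℝ := fun z => min 1 (‖z‖ ^ 2) / ‖z‖ ^ ((n : ℝ) + 2 * α) with hk
    have hki : Integrable k volume := integrable_min_kernel hn hα0 hα1
    have hBi : Integrable (B.indicator fun _ => (1 : ℝ)) volume :=
      (integrable_indicator_iff measurableSet_closedBall).2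
        (integrableOn_const (isCompact_closedBall (0 : E n) 1).measure_lt_top.ne)
    -- The Gagliardo integrand vanishes unless one variable is in `B`, so it is dominated by this
    -- convolution integrand plus its mirror image.
    have h1 : Integrable (fun z : E n × E n => B.indicator (fun _ => (1 : ℝ)) z.2 * k (z.1 - z.2))
        (volume.prod volume) := by
      simpa using Integrable.convolution_integrand (ContinuousLinearMap.mul ℝ ℝ) hBi hki
    have h2 : Integrable (fun z : E n × E n => B.indicator (fun _ => (1 : ℝ)) z.1 * k (z.2 - z.1))
        (volume.prod volume) := h1.swap
    refine (h1.add h2).mono' ?_ (Eventually.of_forall fun z => ?_)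
    · have := (aestronglyMeasurable_quotient (α := α) huc.aestronglyMeasurable).pow 2
      refine this.congr (Eventually.of_forall fun z => quotient_sq u z)
    · have hk0 : 0 ≤ k (z.1 - z.2) := by simp only [hk]; positivity
      have hks : k (z.2 - z.1) = k (z.1 - z.2) := by simp only [hk, norm_sub_rev]
      rw [Real.norm_of_nonneg (by positivity)]
      simp only [Pi.add_apply, hks]
      by_cases hz : z.1 ∈ B ∨ z.2 ∈ B
      · have h3 : (u z.1 - u z.2) ^ 2 / ‖z.1 - z.2‖ ^ ((n : ℝ) + 2 * α) ≤ k (z.1 - z.2) := by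
          simp only [hk]
          gcongr
          refine le_min ?_ ?_
          · rw [sq_le_one_iff_abs_le_one, abs_le]
            constructor <;> linarith [(hle1 z.1).1, (hle1 z.1).2, (hle1 z.2).1, (hle1 z.2).2]
          · rw [← sq_abs]
            gcongr
            exact hlip _ _
        refine h3.trans ?_
        have i0 : ∀ x, 0 ≤ B.indicator (fun _ => (1 : ℝ)) x := fun x =>
          Set.indicator_nonneg (fun _ _ => zero_le_one) x
        rcases hz with hz | hz
        · rw [Set.indicator_of_mem hz, one_mul]
          have := mul_nonneg (i0 z.2) hk0
          linarith
        · rw [Set.indicator_of_mem hz, one_mul]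
          have := mul_nonneg (i0 z.1) hk0
          linarith
      · push Not at hz
        rw [hu0 _ hz.1, hu0 _ hz.2, Set.indicator_of_notMem hz.1, Set.indicator_of_notMem hz.2]
        simp
  · refine Continuous.integrable_of_hasCompactSupport (by fun_prop) ?_
    refine HasCompactSupport.intro (isCompact_closedBall (0 : E n) 1) fun x hx => ?_
    rw [hu0 x hx]
    simp

theorem hat_not_ae_zero : ¬ (fun x : E n => max 0 (1 - ‖x‖)) =ᵐ[volume] 0 := by
  intro h
  have hc : Continuous fun x : E n => max 0 (1 - ‖x‖) := by fun_prop
  have := congrFun ((hc.ae_eq_iff_eq volume continuous_const).1 h) 0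
  change max 0 (1 - ‖(0 : E n)‖) = (0 : ℝ) at this
  simp at this

/-- A zero constant would make every element of the space vanish almost everywhere, which the hat
function contradicts. Positivity is needed because the threshold on `h` divides by this constant. -/
theorem sobolevConst_pos (hα0 : 0 < α) (hα1 : α < 1) (hn : 2 * α < n) {V₀ : ℝ}
    (hVc : Continuous V) (hV₀ : 0 < V₀) (hV : ∀ x, V₀ ≤ V x) : 0 < sobolevConst α V := by
  refine sobolevConst_nonneg.lt_of_ne' fun h0 => ?_
  have hn0 : n ≠ 0 := by rintro rfl; norm_num at hn; linarith
  have hm := memHV_hat hn0 hα0 hα1 hVc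
  have h1 := (eLpNorm_le_sobolevConst hα0 hn hV₀ hV hm).1
  rw [h0, zero_mul, ENNReal.ofReal_zero, nonpos_iff_eq_zero,
    eLpNorm_eq_zero_iff hm.1.1.aestronglyMeasurable two_ne_zero] at h1
  exact hat_not_ae_zero h1

end SobolevConst

end FracSchrodinger

/-! ### Pointwise estimates for `f` and its primitive -/

namespace FracSchrodinger

section Scalar

variable {f : ℝ → ℝ} {q : ℝ}

/-- A quantitative form of the continuity of `f` that is adapted to its growth at `0` and `∞`. -/
theorem exists_abs_sub_le (hq : 0 < q) (hf : Continuous f) (hzero : f =o[𝓝 0] fun t => |t|)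
    (hinf : f =o[cocompact ℝ] fun t => |t| ^ q) {η : ℝ} (hη : 0 < η) :
    ∃ C : ℝ, 0 ≤ C ∧ ∀ s t : ℝ,
      |f s - f t| ≤ η * (|s| + |t| + |s| ^ q + |t| ^ q) + C * |s - t| := by
  obtain ⟨δ, hδ, hfδ⟩ : ∃ δ > 0, ∀ t, |t| < δ → |f t| ≤ η * |t| := by
    obtain ⟨δ, hδ, h⟩ := Metric.eventually_nhds_iff.1 (hzero.bound hη)
    exact ⟨δ, hδ, fun t ht => by simpa using h (by simpa using ht)⟩
  obtain ⟨R, hfR⟩ : ∃ R, ∀ t, R < |t| → |f t| ≤ η / 2 * |t| ^ q := by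
    have h := hinf.bound (half_pos hη)
    rw [← Metric.cobounded_eq_cocompact, ← comap_norm_atTop, eventually_comap] at h
    obtain ⟨R, hR⟩ := eventually_atTop.1 h
    refine ⟨R, fun t ht => ?_⟩
    have := hR |t| ht.le t rfl
    rwa [Real.norm_eq_abs, Real.norm_of_nonneg (by positivity)] at this
  obtain ⟨M, hM⟩ := (isCompact_Icc (a := -R) (b := R)).exists_bound_of_continuousOn hf.continuousOn
  have hall : ∀ t, |f t| ≤ max M 0 + η / 2 * |t| ^ q := by
    intro t
    rcases le_or_gt |t| R with h | h
    · have h1 := hM t (abs_le.1 h)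
      rw [Real.norm_eq_abs] at h1
      have h2 : 0 ≤ η / 2 * |t| ^ q := by positivity
      linarith [le_max_left M 0]
    · linarith [hfR t h, le_max_right M 0]
  -- Beyond `R'` the additive constants in `hall`, one each for `s` and `t`, are absorbed by the
  -- power. One large argument is enough.
  obtain ⟨R', hR'⟩ : ∃ R', ∀ t, R' < |t| → 2 * max M 0 ≤ η / 2 * |t| ^ q := by
    have h1 : Tendsto (fun x : ℝ => η / 2 * x ^ q) atTop atTop :=
      (tendsto_rpow_atTop hq).const_mul_atTop (half_pos hη)
    obtain ⟨R', h⟩ := eventually_atTop.1 (h1.eventually_ge_atTop (2 * max M 0))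
    exact ⟨R', fun t ht => h _ ht.le⟩
  obtain ⟨M', hM'⟩ :=
    (isCompact_Icc (a := -R') (b := R')).exists_bound_of_continuousOn hf.continuousOn
  obtain ⟨τ, hτ, huc⟩ := Metric.uniformContinuousOn_iff.1
    ((isCompact_Icc (a := -R') (b := R')).uniformContinuousOn_of_continuous hf.continuousOn)
    (η * δ) (by positivity)
  refine ⟨2 * |M'| / τ, by positivity, fun s t => ?_⟩
  have hs0 : 0 ≤ |s| ^ q := by positivity
  have ht0 : 0 ≤ |t| ^ q := by positivity
  have hs1 := abs_nonneg s
  have ht1 := abs_nonneg t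
  have hst : 0 ≤ 2 * |M'| / τ * |s - t| := by positivity
  have htri := abs_sub (f s) (f t)
  by_cases hlarge : R' < |s| ∨ R' < |t|
  · have h1 := hall s
    have h2 := hall t
    have h3 : 2 * max M 0 ≤ η / 2 * (|s| ^ q + |t| ^ q) := by
      rcases hlarge with h | h
      · nlinarith [hR' s h]
      · nlinarith [hR' t h]
    nlinarith
  · push Not at hlarge
    by_cases hsmall : |s| < δ ∧ |t| < δ
    · nlinarith [hfδ s hsmall.1, hfδ t hsmall.2]
    · have hδst : δ ≤ |s| + |t| := by
        by_contra! hcon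
        exact hsmall ⟨by linarith, by linarith⟩
      -- Both points lie in a compact set and `δ ≤ |s| + |t|`. Close points differ in `f` by at most
      -- `ηδ`, covered by the linear weight; for distant points the bound on `|f|` is converted into
      -- a multiple of `|s - t|`.
      rcases lt_or_ge |s - t| τ with h | h
      · have h1 := huc s (abs_le.1 hlarge.1) t (abs_le.1 hlarge.2) h
        rw [Real.dist_eq] at h1
        nlinarith
      · have h1 := hM' s (abs_le.1 hlarge.1)
        have h2 := hM' t (abs_le.1 hlarge.2)
        rw [Real.norm_eq_abs] at h1 h2
        have h3 : 2 * |M'| ≤ 2 * |M'| / τ * |s - t| := by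
          rw [div_mul_eq_mul_div, le_div_iff₀ hτ]
          gcongr
        have h4 := le_abs_self M'
        have h5 : 0 ≤ η * (|s| + |t| + |s| ^ q + |t| ^ q) := by positivity
        linarith

theorem hasDerivAt_primitive (hf : Continuous f) (t : ℝ) :
    HasDerivAt (primitive f) (f t) t :=
  (hf.integral_hasStrictDerivAt 0 t).hasDerivAt

theorem continuous_primitive (hf : Continuous f) : Continuous (primitive f) :=
  continuous_iff_continuousAt.2 fun t => (hasDerivAt_primitive hf t).continuousAt

theorem primitive_zero : primitive f 0 = 0 := by simp [primitive]

theorem add_rpow_le {a b : ℝ} (ha : 0 ≤ a) (hb : 0 ≤ b) (hq : 0 < q) :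
    (a + b) ^ q ≤ 2 ^ q * (a ^ q + b ^ q) := by
  have h1 : a + b ≤ 2 * max a b := by linarith [le_max_left a b, le_max_right a b]
  have h2 : max a b ^ q ≤ a ^ q + b ^ q := by
    have := Real.rpow_nonneg ha q
    have := Real.rpow_nonneg hb q
    rcases max_cases a b with h | h <;> rw [h.1] <;> linarith
  calc (a + b) ^ q ≤ (2 * max a b) ^ q := Real.rpow_le_rpow (by positivity) h1 hq.le
    _ = 2 ^ q * max a b ^ q := Real.mul_rpow two_pos.le (le_max_of_le_left ha)
    _ ≤ _ := by gcongr

/-- First order Taylor estimate for the primitive. -/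
theorem exists_primitive_remainder_le (hq : 0 < q) (hf : Continuous f)
    (hzero : f =o[𝓝 0] fun t => |t|) (hinf : f =o[cocompact ℝ] fun t => |t| ^ q) {η : ℝ}
    (hη : 0 < η) : ∃ C : ℝ, 0 ≤ C ∧ ∀ a b : ℝ, |primitive f b - primitive f a - f a * (b - a)| ≤
      (η * (|a| + |b| + |a| ^ q + |b| ^ q) + C * |b - a|) * |b - a| := by
  have h2q : (1 : ℝ) ≤ 2 ^ q := Real.one_le_rpow one_le_two hq.le
  -- The divisor `2 · 2^q` pays for replacing `|ξ|` by `|a| + |b|` for intermediate points `ξ` and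
  -- splitting the power of the sum.
  obtain ⟨C, hC, h⟩ := exists_abs_sub_le hq hf hzero hinf
    (η := η / (2 * 2 ^ q)) (by positivity)
  refine ⟨C, hC, fun a b => ?_⟩
  have hbound : ∀ ξ ∈ Set.uIcc a b, ‖f ξ - f a‖ ≤
      η * (|a| + |b| + |a| ^ q + |b| ^ q) + C * |b - a| := by
    intro ξ hξ
    have h1 : |ξ - a| ≤ |b - a| := Set.abs_sub_left_of_mem_uIcc hξ
    have h2 : |ξ| ≤ |a| + |b| := by
      rcases Set.mem_uIcc.1 hξ with h | h <;> rw [abs_le] <;> constructor <;>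
        linarith [neg_abs_le a, neg_abs_le b, le_abs_self a, le_abs_self b, abs_nonneg a,
          abs_nonneg b]
    have h3 : |a| ≤ |a| + |b| := by linarith [abs_nonneg b]
    have h4 : |ξ| ^ q ≤ (|a| + |b|) ^ q := Real.rpow_le_rpow (abs_nonneg _) h2 hq.le
    have h5 : |a| ^ q ≤ (|a| + |b|) ^ q := Real.rpow_le_rpow (abs_nonneg _) h3 hq.le
    have h6 := add_rpow_le (abs_nonneg a) (abs_nonneg b) hq
    rw [Real.norm_eq_abs]
    refine (h ξ a).trans ?_
    have h7 : |ξ| + |a| + |ξ| ^ q + |a| ^ q ≤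
        2 * 2 ^ q * (|a| + |b| + |a| ^ q + |b| ^ q) := by
      have h8 : |a| + |b| ≤ 2 ^ q * (|a| + |b|) := le_mul_of_one_le_left (by positivity) h2q
      nlinarith
    have h9 : η / (2 * 2 ^ q) * (|ξ| + |a| + |ξ| ^ q + |a| ^ q) ≤
        η * (|a| + |b| + |a| ^ q + |b| ^ q) := by
      calc _ ≤ η / (2 * 2 ^ q) * (2 * 2 ^ q * (|a| + |b| + |a| ^ q + |b| ^ q)) := by gcongr
        _ = _ := by field_simp
    gcongr
  have := (convex_uIcc a b).norm_image_sub_le_of_norm_hasDerivWithin_le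
    (f := fun y => primitive f y - f a * y) (f' := fun y => f y - f a)
    (fun ξ _ => (((hasDerivAt_primitive hf ξ).sub
      ((hasDerivAt_id ξ).const_mul (f a))).congr_deriv (by simp)).hasDerivWithinAt)
    hbound Set.left_mem_uIcc Set.right_mem_uIcc
  rw [Real.norm_eq_abs, Real.norm_eq_abs] at this
  convert this using 2
  ring

/-- The Ambrosetti–Rabinowitz condition makes the primitive grow superquadratically. -/
theorem rpow_mul_primitive_le (hf : Continuous f) {μ : ℝ}
    (hAR : ∀ t : ℝ, t ≠ 0 → 0 < μ * primitive f t ∧ μ * primitive f t ≤ t * f t) (x : ℝ) {s : ℝ}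
    (hs : 1 ≤ s) : s ^ μ * primitive f x ≤ primitive f (s * x) := by
  rcases eq_or_ne x 0 with rfl | hx
  · simp [primitive_zero]
  have hd : ∀ t : ℝ, 0 < t → HasDerivAt (fun t : ℝ => t ^ (-μ) * primitive f (t * x))
      (-μ * t ^ (-μ - 1) * primitive f (t * x) + t ^ (-μ) * (f (t * x) * x)) t := fun t ht => by
    have h1 : HasDerivAt (fun t : ℝ => t * x) x t := by
      simpa using (hasDerivAt_id t).mul_const x
    have h2 : HasDerivAt (fun t => primitive f (t * x)) (f (t * x) * x) t :=
      HasDerivAt.comp (h₂ := primitive f) t (hasDerivAt_primitive hf (t * x)) h1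
    exact (Real.hasDerivAt_rpow_const (p := -μ) (Or.inl ht.ne')).mul h2
  -- The derivative is `t^{-μ-1}` times `t x f(t x) - μ F(t x)`, which is nonnegative by the
  -- Ambrosetti–Rabinowitz condition.
  have hmono : MonotoneOn (fun t : ℝ => t ^ (-μ) * primitive f (t * x)) (Set.Ici 1) := by
    refine monotoneOn_of_hasDerivWithinAt_nonneg (convex_Ici 1)
      (fun t ht => (hd t (one_pos.trans_le ht)).continuousAt.continuousWithinAt)
      (fun t ht => ?_) (fun t ht => ?_)
      (f' := fun t => -μ * t ^ (-μ - 1) * primitive f (t * x) + t ^ (-μ) * (f (t * x) * x))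
    · rw [interior_Ici] at ht
      exact (hd t (one_pos.trans ht)).hasDerivWithinAt
    · rw [interior_Ici] at ht
      have ht0 : 0 < t := one_pos.trans ht
      have h1 := (hAR (t * x) (mul_ne_zero ht0.ne' hx)).2
      have h2 : t ^ (-μ) = t ^ (-μ - 1) * t := by
        rw [Real.rpow_sub_one ht0.ne']
        field_simp
      rw [h2]
      have h3 : 0 < t ^ (-μ - 1) := by positivity
      have h4 : -μ * t ^ (-μ - 1) * primitive f (t * x) + t ^ (-μ - 1) * t * (f (t * x) * x) =
          t ^ (-μ - 1) * (t * x * f (t * x) - μ * primitive f (t * x)) := by ring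
      rw [h4]
      exact mul_nonneg h3.le (by linarith)
  have h1 := hmono Set.self_mem_Ici hs hs
  simp only [Real.one_rpow, one_mul] at h1
  have hs0 : 0 < s := one_pos.trans_le hs
  rw [Real.rpow_neg hs0.le, inv_mul_eq_div, le_div_iff₀ (by positivity)] at h1
  linarith

/-- The global growth bound with the explicit constant `K_ε`. -/
theorem abs_le_of_growth (hf : Continuous f) (hq : 0 < q) {ε δ ρ : ℝ} (hε : 0 < ε) (hδ : 0 < δ)
    (hfδ : ∀ t : ℝ, |t| ≤ δ → |f t| ≤ ε * |t|)
    (hfρ : ∀ t : ℝ, ρ ≤ |t| → |f t| ≤ ε * |t| ^ q) (t : ℝ) :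
    |f t| ≤ ε * |t| + (ε + growthConst f q δ ρ) * |t| ^ q := by
  have hcomp : IsCompact {t : ℝ | δ ≤ |t| ∧ |t| ≤ ρ} := by
    refine (isCompact_Icc (a := -ρ) (b := ρ)).of_isClosed_subset
      ((isClosed_le continuous_const continuous_abs).inter
        (isClosed_le continuous_abs continuous_const)) fun t ht => abs_le.1 ht.2
  have hS0 : 0 ≤ sSup ((fun t => |f t|) '' {t : ℝ | δ ≤ |t| ∧ |t| ≤ ρ}) :=
    Real.sSup_nonneg (by rintro _ ⟨t, -, rfl⟩; exact abs_nonneg _)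
  have hK0 : 0 ≤ growthConst f q δ ρ := mul_nonneg (by positivity) hS0
  have h0 : 0 ≤ |t| ^ q := by positivity
  have h1 : 0 ≤ ε * |t| := by positivity
  rcases le_or_gt |t| δ with h | h
  · nlinarith [hfδ t h, mul_nonneg (add_nonneg hε.le hK0) h0]
  rcases le_or_gt ρ |t| with h' | h'
  · nlinarith [hfρ t h', mul_nonneg hK0 h0]
  · have h2 : |f t| ≤ sSup ((fun t => |f t|) '' {t : ℝ | δ ≤ |t| ∧ |t| ≤ ρ}) :=
      le_csSup (hcomp.image hf.abs).bddAbove ⟨t, ⟨h.le, h'.le⟩, rfl⟩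
    -- In the middle range `|t| > δ`, so the maximum of `|f|` can be multiplied by this factor; this
    -- is the origin of `δ^{-q}` in `K_ε`.
    have h3 : (1 : ℝ) ≤ δ ^ (-q) * |t| ^ q := by
      rw [Real.rpow_neg hδ.le, inv_mul_eq_div, one_le_div (by positivity)]
      exact Real.rpow_le_rpow hδ.le h.le hq.le
    have h4 : |f t| ≤ growthConst f q δ ρ * |t| ^ q := by
      rw [growthConst, mul_right_comm]
      exact h2.trans (le_mul_of_one_le_left hS0 h3)
    nlinarith [mul_nonneg hε.le h0]

theorem growthConst_nonneg {δ ρ : ℝ} (hδ : 0 < δ) : 0 ≤ growthConst f q δ ρ :=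
  mul_nonneg (by positivity) (Real.sSup_nonneg (by rintro _ ⟨t, -, rfl⟩; exact abs_nonneg _))

/-- Integrated growth bound. -/
theorem abs_primitive_le (hf : Continuous f) (hq : 0 < q) {A B : ℝ} (hA : 0 ≤ A) (hB : 0 ≤ B)
    (h : ∀ t, |f t| ≤ A * |t| + B * |t| ^ q) (t : ℝ) :
    |primitive f t| ≤ A * t ^ 2 + B * (|t| ^ q * |t|) := by
  -- The mean value inequality forgoes the factors `1/2` and `1/(q + 1)` of exact integration. The
  -- threshold on `h` is calibrated to this cruder bound.
  have := (convex_uIcc 0 t).norm_image_sub_le_of_norm_hasDerivWithin_le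
    (f := primitive f) (f' := f) (C := A * |t| + B * |t| ^ q)
    (fun ξ _ => (hasDerivAt_primitive hf ξ).hasDerivWithinAt)
    (fun ξ hξ => by
      have h1 : |ξ| ≤ |t| := by simpa using Set.abs_sub_left_of_mem_uIcc hξ
      rw [Real.norm_eq_abs]
      refine (h ξ).trans ?_
      gcongr) Set.left_mem_uIcc Set.right_mem_uIcc
  rw [primitive_zero, sub_zero, sub_zero, Real.norm_eq_abs, Real.norm_eq_abs] at this
  refine this.trans_eq ?_
  rw [← sq_abs t]
  ring

end Scalar

/-! ### Hölder estimates for the weighted integrals -/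

section Nemytskii

variable {X : Type*} [MeasurableSpace X] {ν : Measure X} {f : ℝ → ℝ} {q : ℝ}

/-- Cauchy–Schwarz in terms of `eLpNorm`. -/
theorem integral_abs_mul_abs_le {u w : X → ℝ} (hu : MemLp u 2 ν) (hw : MemLp w 2 ν) :
    Integrable (fun x => |u x| * |w x|) ν ∧
      ∫ x, |u x| * |w x| ∂ν ≤ (eLpNorm u 2 ν).toReal * (eLpNorm w 2 ν).toReal := by
  refine ⟨hu.abs.integrable_mul hw.abs, ?_⟩
  have h1 := integral_mul_le_Lp_mul_Lq_of_nonneg (μ := ν) Real.HolderConjugate.two_two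
    (f := fun x => |u x|) (g := fun x => |w x|) (Eventually.of_forall fun _ => abs_nonneg _)
    (Eventually.of_forall fun _ => abs_nonneg _) (by rw [ENNReal.ofReal_ofNat]; exact hu.abs)
    (by rw [ENNReal.ofReal_ofNat]; exact hw.abs)
  have e : ∀ {v : X → ℝ}, MemLp v 2 ν →
      (eLpNorm v 2 ν).toReal = (∫ x, |v x| ^ (2 : ℝ) ∂ν) ^ (1 / (2 : ℝ)) := by
    intro v hv
    rw [hv.eLpNorm_eq_integral_rpow_norm two_ne_zero ENNReal.ofNat_ne_top, ENNReal.toReal_ofReal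
      (by positivity)]
    simp
  rw [e hu, e hw]
  exact h1

/-- Hölder's inequality with exponents `(q + 1) / q` and `q + 1`. -/
theorem integral_rpow_mul_le (hq : 0 < q) {u w : X → ℝ} (hu : MemLp u (ENNReal.ofReal (q + 1)) ν)
    (hw : MemLp w (ENNReal.ofReal (q + 1)) ν) :
    Integrable (fun x => |u x| ^ q * |w x|) ν ∧ ∫ x, |u x| ^ q * |w x| ∂ν ≤
      (eLpNorm u (ENNReal.ofReal (q + 1)) ν).toReal ^ q *
        (eLpNorm w (ENNReal.ofReal (q + 1)) ν).toReal := by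
  have hq1 : 0 < q + 1 := by linarith
  have hc : ((q + 1) / q).HolderConjugate (q + 1) := by
    rw [Real.holderConjugate_iff]
    refine ⟨by rw [lt_div_iff₀ hq]; linarith, ?_⟩
    field_simp
  have hne0 : ENNReal.ofReal (q + 1) ≠ 0 := by simpa using hq1
  have hnet : ENNReal.ofReal (q + 1) ≠ ⊤ := ENNReal.ofReal_ne_top
  have htr : (ENNReal.ofReal (q + 1)).toReal = q + 1 := ENNReal.toReal_ofReal hq1.le
  have huq : MemLp (fun x => |u x| ^ q) (ENNReal.ofReal ((q + 1) / q)) ν := by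
    have h1 := hu.norm_rpow_div (ENNReal.ofReal q)
    rw [ENNReal.toReal_ofReal hq.le, ← ENNReal.ofReal_div_of_pos hq] at h1
    exact h1
  have h1 := integral_mul_le_Lp_mul_Lq_of_nonneg (μ := ν) hc
    (f := fun x => |u x| ^ q) (g := fun x => |w x|)
    (Eventually.of_forall fun _ => Real.rpow_nonneg (abs_nonneg _) _)
    (Eventually.of_forall fun _ => abs_nonneg _) huq hw.abs
  have e : ∀ {v : X → ℝ}, MemLp v (ENNReal.ofReal (q + 1)) ν →
      (eLpNorm v (ENNReal.ofReal (q + 1)) ν).toReal =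
        (∫ x, |v x| ^ (q + 1) ∂ν) ^ (1 / (q + 1)) := by
    intro v hv
    rw [hv.eLpNorm_eq_integral_rpow_norm hne0 hnet, ENNReal.toReal_ofReal (by positivity), htr]
    simp
  refine ⟨?_, ?_⟩
  · have hh : (ENNReal.ofReal ((q + 1) / q)).HolderConjugate (ENNReal.ofReal (q + 1)) :=
      hc.ennrealOfReal
    exact huq.integrable_mul hw.abs
  · rw [e hu, e hw]
    refine h1.trans_eq ?_
    congr 1
    have h2 : ∀ x, (|u x| ^ q) ^ ((q + 1) / q) = |u x| ^ (q + 1) := fun x => by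
      rw [← Real.rpow_mul (abs_nonneg _)]
      congr 1
      field_simp
    simp_rw [h2]
    rw [← Real.rpow_mul (integral_nonneg fun x => by positivity)]
    congr 1
    field_simp

/-- Integration of a pointwise bound by linear and power weights. -/
theorem integral_weight_le (hq : 0 < q) {u v w d k : X → ℝ} {η C : ℝ}
    (hu : MemLp u 2 ν) (hv : MemLp v 2 ν) (hw : MemLp w 2 ν) (hd : MemLp d 2 ν)
    (hu' : MemLp u (ENNReal.ofReal (q + 1)) ν) (hv' : MemLp v (ENNReal.ofReal (q + 1)) ν)
    (hw' : MemLp w (ENNReal.ofReal (q + 1)) ν) (hη : 0 ≤ η) (hC : 0 ≤ C)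
    (hk : AEStronglyMeasurable k ν)
    (hkb : ∀ x, |k x| ≤ (η * (|u x| + |v x| + |u x| ^ q + |v x| ^ q) + C * |d x|) * |w x|) :
    Integrable k ν ∧ |∫ x, k x ∂ν| ≤
      η * (((eLpNorm u 2 ν).toReal + (eLpNorm v 2 ν).toReal) * (eLpNorm w 2 ν).toReal +
        ((eLpNorm u (ENNReal.ofReal (q + 1)) ν).toReal ^ q +
          (eLpNorm v (ENNReal.ofReal (q + 1)) ν).toReal ^ q) *
          (eLpNorm w (ENNReal.ofReal (q + 1)) ν).toReal) +
      C * ((eLpNorm d 2 ν).toReal * (eLpNorm w 2 ν).toReal) := by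
  obtain ⟨i1, b1⟩ := integral_abs_mul_abs_le hu hw
  obtain ⟨i2, b2⟩ := integral_abs_mul_abs_le hv hw
  obtain ⟨i3, b3⟩ := integral_rpow_mul_le hq hu' hw'
  obtain ⟨i4, b4⟩ := integral_rpow_mul_le hq hv' hw'
  obtain ⟨i5, b5⟩ := integral_abs_mul_abs_le hd hw
  have hi : Integrable (fun x => η * ((|u x| * |w x| + |v x| * |w x|) +
      (|u x| ^ q * |w x| + |v x| ^ q * |w x|)) + C * (|d x| * |w x|)) ν :=
    (((i1.add i2).add (i3.add i4)).const_mul η).add (i5.const_mul C)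
  have hle : ∀ x, |k x| ≤ η * ((|u x| * |w x| + |v x| * |w x|) +
      (|u x| ^ q * |w x| + |v x| ^ q * |w x|)) + C * (|d x| * |w x|) := fun x =>
    (hkb x).trans_eq (by ring)
  have hki : Integrable k ν := hi.mono' hk (Eventually.of_forall hle)
  refine ⟨hki, abs_integral_le_integral_abs.trans ((integral_mono hki.abs hi hle).trans ?_)⟩
  have e1 : ∫ x, η * ((|u x| * |w x| + |v x| * |w x|) +
      (|u x| ^ q * |w x| + |v x| ^ q * |w x|)) + C * (|d x| * |w x|) ∂ν =
      η * (((∫ x, |u x| * |w x| ∂ν) + ∫ x, |v x| * |w x| ∂ν) +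
        ((∫ x, |u x| ^ q * |w x| ∂ν) + ∫ x, |v x| ^ q * |w x| ∂ν)) +
        C * ∫ x, |d x| * |w x| ∂ν := by
    have i6 : Integrable (fun x => |u x| * |w x| + |v x| * |w x|) ν := i1.add i2
    have i7 : Integrable (fun x => |u x| ^ q * |w x| + |v x| ^ q * |w x|) ν := i3.add i4
    have i8 : Integrable (fun x => (|u x| * |w x| + |v x| * |w x|) +
      (|u x| ^ q * |w x| + |v x| ^ q * |w x|)) ν := i6.add i7
    rw [integral_add (i8.const_mul η) (i5.const_mul C), integral_const_mul, integral_const_mul,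
      integral_add i6 i7, integral_add i1 i2, integral_add i3 i4]
  rw [e1, add_mul, add_mul]
  gcongr

end Nemytskii

end FracSchrodinger

/-! ### Abstract embeddings and the nonlinear term -/

namespace FracSchrodinger

/-- A linear embedding of a normed space `H` into the functions in `L² ∩ L^{q+1}`, modulo null sets,
bounded by `C` in both norms; the `L²` norm is realised by the operator `J`. -/
structure LebesgueEmbedding (H : Type*) [NormedAddCommGroup H] [InnerProductSpace ℝ H]
    (F : Type*) [NormedAddCommGroup F] [NormedSpace ℝ F]
    {X : Type*} [MeasurableSpace X] (ν : Measure X) (q C : ℝ) where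
  /-- The function represented by an element of `H`. -/
  fn : H → X → ℝ
  /-- The embedding into `L²`. -/
  J : H →L[ℝ] F
  fn_add : ∀ p p', fn (p + p') =ᵐ[ν] fn p + fn p'
  fn_smul : ∀ (c : ℝ) p, fn (c • p) =ᵐ[ν] c • fn p
  memLp_two : ∀ p, MemLp (fn p) 2 ν
  memLp_crit : ∀ p, MemLp (fn p) (ENNReal.ofReal (q + 1)) ν
  norm_J : ∀ p, ‖J p‖ = (eLpNorm (fn p) 2 ν).toReal
  norm_J_le : ∀ p, ‖J p‖ ≤ C * ‖p‖
  crit_le : ∀ p, (eLpNorm (fn p) (ENNReal.ofReal (q + 1)) ν).toReal ≤ C * ‖p‖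

namespace LebesgueEmbedding

variable {H : Type*} [NormedAddCommGroup H] [InnerProductSpace ℝ H]
  {F : Type*} [NormedAddCommGroup F] [NormedSpace ℝ F]
  {X : Type*} [MeasurableSpace X] {ν : Measure X} {q C : ℝ} (e : LebesgueEmbedding H F ν q C)
  {f : ℝ → ℝ} {h : X → ℝ}

theorem fn_zero : e.fn 0 =ᵐ[ν] 0 := by
  have := e.fn_smul 0 0
  rw [zero_smul, zero_smul] at this
  exact this

theorem fn_sub (p p' : H) : e.fn (p - p') =ᵐ[ν] e.fn p - e.fn p' := by
  have h1 := e.fn_add p ((-1 : ℝ) • p')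
  rw [neg_one_smul, ← sub_eq_add_neg] at h1
  have h2 := e.fn_smul (-1) p'
  rw [neg_one_smul] at h2
  filter_upwards [h1, h2] with x hx1 hx2
  rw [hx1, Pi.add_apply, hx2]
  simp [sub_eq_add_neg]

theorem eLpNorm_fn_sub (p p' : H) :
    (eLpNorm (e.fn p - e.fn p') 2 ν).toReal = ‖e.J p - e.J p'‖ := by
  rw [← map_sub, e.norm_J, eLpNorm_congr_ae (e.fn_sub p p')]

/-- The constant bounding the weights on the ball of radius `R`. -/
noncomputable def weight (_ : LebesgueEmbedding H F ν q C) (R : ℝ) : ℝ :=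
  2 * (C * R) * C + 2 * (C * R) ^ q * C

theorem weight_nonneg (hC : 0 ≤ C) {R : ℝ} (hR : 0 ≤ R) : 0 ≤ e.weight R := by
  unfold weight
  positivity

theorem weight_le (hq : 0 < q) (hC : 0 ≤ C) {R : ℝ} {p p' : H} (hp : ‖p‖ ≤ R) (hp' : ‖p'‖ ≤ R)
    (w : H) :
    ((eLpNorm (e.fn p) 2 ν).toReal + (eLpNorm (e.fn p') 2 ν).toReal) *
        (eLpNorm (e.fn w) 2 ν).toReal +
      ((eLpNorm (e.fn p) (ENNReal.ofReal (q + 1)) ν).toReal ^ q +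
        (eLpNorm (e.fn p') (ENNReal.ofReal (q + 1)) ν).toReal ^ q) *
        (eLpNorm (e.fn w) (ENNReal.ofReal (q + 1)) ν).toReal ≤ e.weight R * ‖w‖ := by
  have h2 : ∀ p, (eLpNorm (e.fn p) 2 ν).toReal ≤ C * ‖p‖ := fun p => e.norm_J p ▸ e.norm_J_le p
  have h3 : ∀ {p : H}, ‖p‖ ≤ R → C * ‖p‖ ≤ C * R := fun h => by gcongr
  have hR : 0 ≤ R := (norm_nonneg p).trans hp
  calc _ ≤ (C * R + C * R) * (C * ‖w‖) + ((C * R) ^ q + (C * R) ^ q) * (C * ‖w‖) := by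
        gcongr
        · exact (h2 p).trans (h3 hp)
        · exact (h2 p').trans (h3 hp')
        · exact h2 w
        · exact (e.crit_le p).trans (h3 hp)
        · exact (e.crit_le p').trans (h3 hp')
        · exact e.crit_le w
    _ = _ := by rw [weight]; ring

theorem scaled_weight_le (hq : 0 < q) (hC : 0 ≤ C) {R η : ℝ} (hη : 0 ≤ η) {p p' : H}
    (hp : ‖p‖ ≤ R) (hp' : ‖p'‖ ≤ R) (w : H) :
    η / (e.weight R + 1) *
      (((eLpNorm (e.fn p) 2 ν).toReal + (eLpNorm (e.fn p') 2 ν).toReal) *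
        (eLpNorm (e.fn w) 2 ν).toReal +
      ((eLpNorm (e.fn p) (ENNReal.ofReal (q + 1)) ν).toReal ^ q +
        (eLpNorm (e.fn p') (ENNReal.ofReal (q + 1)) ν).toReal ^ q) *
        (eLpNorm (e.fn w) (ENNReal.ofReal (q + 1)) ν).toReal) ≤ η * ‖w‖ := by
  have hW := e.weight_nonneg hC ((norm_nonneg p).trans hp)
  refine (mul_le_mul_of_nonneg_left (e.weight_le hq hC hp hp' w) (by positivity)).trans ?_
  calc η / (e.weight R + 1) * (e.weight R * ‖w‖)
      = e.weight R / (e.weight R + 1) * (η * ‖w‖) := by ring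
    _ ≤ 1 * (η * ‖w‖) := by
        gcongr
        rw [div_le_one (by positivity)]
        linarith
    _ = η * ‖w‖ := one_mul _

theorem aestronglyMeasurable_fn (p : H) : AEStronglyMeasurable (e.fn p) ν :=
  (e.memLp_two p).aestronglyMeasurable

theorem integrable_mul (hh : MemLp h 2 ν) (w : H) : Integrable (fun x => h x * e.fn w x) ν :=
  hh.integrable_mul (e.memLp_two w)

theorem abs_integral_mul_le (hh : MemLp h 2 ν) (w : H) :
    |∫ x, h x * e.fn w x ∂ν| ≤ (eLpNorm h 2 ν).toReal * ‖e.J w‖ := by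
  rw [e.norm_J]
  refine abs_integral_le_integral_abs.trans ?_
  simp_rw [abs_mul]
  exact (integral_abs_mul_abs_le hh (e.memLp_two w)).2

section Growth

variable (hq : 0 < q) (hf : Continuous f) (hf0 : f 0 = 0) (hzero : f =o[𝓝 0] fun t => |t|)
  (hinf : f =o[cocompact ℝ] fun t => |t| ^ q)
include hq hf hzero hinf

/-- The difference of the nonlinear terms on a ball. -/
theorem exists_nemytskii_sub_le (hC : 0 ≤ C) {R η : ℝ} (hR : 0 ≤ R) (hη : 0 < η) :
    ∃ K : ℝ, 0 ≤ K ∧ ∀ p p' w : H, ‖p‖ ≤ R → ‖p'‖ ≤ R →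
      Integrable (fun x => (f (e.fn p x) - f (e.fn p' x)) * e.fn w x) ν ∧
      |∫ x, (f (e.fn p x) - f (e.fn p' x)) * e.fn w x ∂ν| ≤
        η * ‖w‖ + K * (‖e.J p - e.J p'‖ * ‖e.J w‖) := by
  have hW := e.weight_nonneg hC hR
  -- Dividing by the size of the weights on the ball makes the critical part contribute at most
  -- `η‖w‖`. The `+ 1` avoids division by zero.
  obtain ⟨K, hK, hb⟩ := exists_abs_sub_le hq hf hzero hinf
    (η := η / (e.weight R + 1)) (by positivity)
  refine ⟨K, hK, fun p p' w hp hp' => ?_⟩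
  have hm : AEStronglyMeasurable (fun x => (f (e.fn p x) - f (e.fn p' x)) * e.fn w x) ν :=
    ((hf.comp_aestronglyMeasurable (e.aestronglyMeasurable_fn p)).sub
      (hf.comp_aestronglyMeasurable (e.aestronglyMeasurable_fn p'))).mul
      (e.aestronglyMeasurable_fn w)
  obtain ⟨h1, h2⟩ := integral_weight_le hq (e.memLp_two p) (e.memLp_two p') (e.memLp_two w)
    ((e.memLp_two p).sub (e.memLp_two p')) (e.memLp_crit p) (e.memLp_crit p') (e.memLp_crit w)
    (by positivity : 0 ≤ η / (e.weight R + 1)) hK hm fun x => by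
      rw [abs_mul, Pi.sub_apply]
      gcongr
      exact hb _ _
  refine ⟨h1, h2.trans ?_⟩
  refine add_le_add (e.scaled_weight_le hq hC hη.le hp hp' w) (le_of_eq ?_)
  rw [e.eLpNorm_fn_sub, ← e.norm_J w]

include hf0

/-- The nonlinear term on a ball. -/
theorem exists_nemytskii_le (hC : 0 ≤ C) {R η : ℝ} (hR : 0 ≤ R) (hη : 0 < η) :
    ∃ K : ℝ, 0 ≤ K ∧ ∀ p w : H, ‖p‖ ≤ R →
      Integrable (fun x => f (e.fn p x) * e.fn w x) ν ∧
      |∫ x, f (e.fn p x) * e.fn w x ∂ν| ≤ η * ‖w‖ + K * ‖e.J w‖ := by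
  obtain ⟨K, hK, hb⟩ := e.exists_nemytskii_sub_le hq hf hzero hinf hC hR hη
  refine ⟨K * (C * R), by positivity, fun p w hp => ?_⟩
  obtain ⟨h1, h2⟩ := hb p 0 w hp (by simpa using hR)
  have hae : (fun x => (f (e.fn p x) - f (e.fn 0 x)) * e.fn w x) =ᵐ[ν]
      fun x => f (e.fn p x) * e.fn w x := by
    filter_upwards [e.fn_zero] with x hx
    rw [hx, Pi.zero_apply, hf0, sub_zero]
  rw [integral_congr_ae hae, map_zero, sub_zero, ← mul_assoc] at h2
  refine ⟨h1.congr hae, h2.trans ?_⟩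
  gcongr
  exact (e.norm_J_le p).trans (by gcongr)

theorem integrable_nemytskii_mul (hC : 0 ≤ C) (p w : H) :
    Integrable (fun x => f (e.fn p x) * e.fn w x) ν := by
  obtain ⟨K, -, h⟩ :=
    e.exists_nemytskii_le hq hf hf0 hzero hinf hC (norm_nonneg p) one_pos
  exact (h p w le_rfl).1

theorem integrable_primitive (p : H) : Integrable (fun x => primitive f (e.fn p x)) ν := by
  -- At base point `0`, where `F` and `f` vanish, the Taylor remainder is `F` itself.
  obtain ⟨K, hK, hb⟩ := exists_primitive_remainder_le hq hf hzero hinf one_pos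
  refine (integral_weight_le hq (MemLp.zero (ε := ℝ)) (e.memLp_two p) (e.memLp_two p) (e.memLp_two p)
    (MemLp.zero (ε := ℝ)) (e.memLp_crit p) (e.memLp_crit p) zero_le_one hK
    ((continuous_primitive hf).comp_aestronglyMeasurable (e.aestronglyMeasurable_fn p))
    fun x => ?_).1
  have := hb 0 (e.fn p x)
  rw [primitive_zero, hf0, sub_zero, zero_mul, sub_zero, sub_zero] at this
  simpa using this

/-- First order expansion of the nonlinear part of the energy on a ball. -/
theorem exists_primitive_remainder_le (hC : 0 ≤ C) {R η : ℝ} (hR : 0 ≤ R) (hη : 0 < η) :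
    ∃ K : ℝ, 0 ≤ K ∧ ∀ p p' : H, ‖p‖ ≤ R → ‖p'‖ ≤ R →
      |(∫ x, primitive f (e.fn p' x) ∂ν) - (∫ x, primitive f (e.fn p x) ∂ν) -
        ∫ x, f (e.fn p x) * e.fn (p' - p) x ∂ν| ≤
        η * ‖p' - p‖ + K * ‖e.J (p' - p)‖ ^ 2 := by
  have hW := e.weight_nonneg hC hR
  obtain ⟨K, hK, hb⟩ := FracSchrodinger.exists_primitive_remainder_le hq hf hzero hinf
    (η := η / (e.weight R + 1)) (by positivity)
  refine ⟨K, hK, fun p p' hp hp' => ?_⟩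
  set w := p' - p with hw
  have hwae := e.fn_sub p' p
  have hi : Integrable (fun x => f (e.fn p x) * (e.fn p' x - e.fn p x)) ν := by
    refine (e.integrable_nemytskii_mul hq hf hf0 hzero hinf hC p w).congr ?_
    filter_upwards [hwae] with x hx
    rw [hx, Pi.sub_apply]
  have hi1 := e.integrable_primitive hq hf hf0 hzero hinf p
  have hi2 := e.integrable_primitive hq hf hf0 hzero hinf p'
  have hi3 : Integrable (fun x => primitive f (e.fn p' x) - primitive f (e.fn p x)) ν :=
    hi2.sub hi1
  have heq : (∫ x, primitive f (e.fn p' x) ∂ν) - (∫ x, primitive f (e.fn p x) ∂ν) -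
      ∫ x, f (e.fn p x) * e.fn w x ∂ν = ∫ x, (primitive f (e.fn p' x) - primitive f (e.fn p x) -
        f (e.fn p x) * (e.fn p' x - e.fn p x)) ∂ν := by
    rw [integral_sub hi3 hi, integral_sub hi2 hi1]
    congr 1
    refine integral_congr_ae ?_
    filter_upwards [hwae] with x hx
    rw [hx, Pi.sub_apply]
  have hd2 : MemLp (e.fn p' - e.fn p) 2 ν := (e.memLp_two p').sub (e.memLp_two p)
  have hdq : MemLp (e.fn p' - e.fn p) (ENNReal.ofReal (q + 1)) ν :=
    (e.memLp_crit p').sub (e.memLp_crit p)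
  obtain ⟨-, h2⟩ := integral_weight_le hq (e.memLp_two p) (e.memLp_two p') hd2 hd2
    (e.memLp_crit p) (e.memLp_crit p') hdq (by positivity : 0 ≤ η / (e.weight R + 1)) hK
    (hi3.sub hi).aestronglyMeasurable fun x => hb _ _
  rw [eLpNorm_congr_ae hwae.symm, eLpNorm_congr_ae hwae.symm] at h2
  rw [heq]
  refine h2.trans ?_
  have h3 : K * ((eLpNorm (e.fn w) 2 ν).toReal * (eLpNorm (e.fn w) 2 ν).toReal) =
      K * ‖e.J w‖ ^ 2 := by
    rw [← e.norm_J, sq]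
  exact add_le_add (e.scaled_weight_le hq hC hη.le hp hp' w) h3.le

theorem integrable_source_mul (hh : MemLp h 2 ν) (hC : 0 ≤ C) (p w : H) :
    Integrable (fun x => (f (e.fn p x) + h x) * e.fn w x) ν := by
  refine ((e.integrable_nemytskii_mul hq hf hf0 hzero hinf hC p w).add
    (e.integrable_mul hh w)).congr (Eventually.of_forall fun x => ?_)
  simp only [Pi.add_apply]
  ring

theorem integral_source_mul (hh : MemLp h 2 ν) (hC : 0 ≤ C) (p w : H) :
    ∫ x, (f (e.fn p x) + h x) * e.fn w x ∂ν =
      (∫ x, f (e.fn p x) * e.fn w x ∂ν) + ∫ x, h x * e.fn w x ∂ν := by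
  rw [← integral_add (e.integrable_nemytskii_mul hq hf hf0 hzero hinf hC p w)
    (e.integrable_mul hh w)]
  simp_rw [add_mul]

/-- The Riesz representative of `w ↦ ∫ (f(u) + h) w`. -/
theorem exists_riesz [CompleteSpace H] (hh : MemLp h 2 ν) (hC : 0 ≤ C) (p : H) :
    ∃ a : H, ∀ w, inner ℝ a w = ∫ x, (f (e.fn p x) + h x) * e.fn w x ∂ν := by
  have hi := e.integrable_source_mul hq hf hf0 hzero hinf hh hC p
  obtain ⟨K, hK, hb⟩ :=
    e.exists_nemytskii_le hq hf hf0 hzero hinf hC (norm_nonneg p) one_pos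
  let ℓ : H →ₗ[ℝ] ℝ :=
    { toFun := fun w => ∫ x, (f (e.fn p x) + h x) * e.fn w x ∂ν
      map_add' := fun w w' => by
        rw [← integral_add (hi w) (hi w')]
        refine integral_congr_ae ?_
        filter_upwards [e.fn_add w w'] with x hx
        rw [hx, Pi.add_apply, mul_add]
      map_smul' := fun c w => by
        rw [RingHom.id_apply, smul_eq_mul, ← integral_const_mul]
        refine integral_congr_ae ?_
        filter_upwards [e.fn_smul c w] with x hx
        rw [hx, Pi.smul_apply, smul_eq_mul]
        ring }
  let L : H →L[ℝ] ℝ := ℓ.mkContinuous (1 + K * C + (eLpNorm h 2 ν).toReal * C) fun w => by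
    change |∫ x, (f (e.fn p x) + h x) * e.fn w x ∂ν| ≤ _
    rw [e.integral_source_mul hq hf hf0 hzero hinf hh hC p w]
    refine (abs_add_le _ _).trans ?_
    have h1 := (hb p w le_rfl).2
    have h2 := e.abs_integral_mul_le hh w
    have h3 := e.norm_J_le w
    have h4 : 0 ≤ (eLpNorm h 2 ν).toReal := ENNReal.toReal_nonneg
    nlinarith [mul_le_mul_of_nonneg_left h3 hK, mul_le_mul_of_nonneg_left h3 h4]
  refine ⟨(InnerProductSpace.toDual ℝ H).symm L, fun w => ?_⟩
  rw [InnerProductSpace.toDual_symm_apply]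
  rfl

end Growth

end LebesgueEmbedding

end FracSchrodinger

/-! ### The energy functional: gradient, Palais–Smale, critical points -/

namespace FracSchrodinger

namespace LebesgueEmbedding

variable {H : Type*} [NormedAddCommGroup H] [InnerProductSpace ℝ H]
  {F : Type*} [NormedAddCommGroup F] [NormedSpace ℝ F]
  {X : Type*} [MeasurableSpace X] {ν : Measure X} {q C : ℝ} (e : LebesgueEmbedding H F ν q C)
  {f : ℝ → ℝ} {h : X → ℝ}

/-- The compact part `∫ F(u) + ∫ h u` of the energy. -/
noncomputable def potential (f : ℝ → ℝ) (h : X → ℝ) (p : H) : ℝ :=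
  (∫ x, primitive f (e.fn p x) ∂ν) + ∫ x, h x * e.fn p x ∂ν

theorem potential_zero : e.potential f h 0 = 0 := by
  have h1 : ∫ x, primitive f (e.fn 0 x) ∂ν = 0 := by
    rw [integral_congr_ae (g := fun _ => (0 : ℝ)), integral_zero]
    filter_upwards [e.fn_zero] with x hx
    rw [hx, Pi.zero_apply, primitive_zero]
  have h2 : ∫ x, h x * e.fn 0 x ∂ν = 0 := by
    rw [integral_congr_ae (g := fun _ => (0 : ℝ)), integral_zero]
    filter_upwards [e.fn_zero] with x hx
    rw [hx, Pi.zero_apply, mul_zero]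
  rw [potential, h1, h2, add_zero]

section Growth

variable (hC : 0 ≤ C) (hq : 0 < q) (hf : Continuous f) (hf0 : f 0 = 0)
  (hzero : f =o[𝓝 0] fun t => |t|) (hinf : f =o[cocompact ℝ] fun t => |t| ^ q) (hh : MemLp h 2 ν)
  {a : H → H} (ha : ∀ p w, inner ℝ (a p) w = ∫ x, (f (e.fn p x) + h x) * e.fn w x ∂ν)
include hC hq hf hf0 hzero hinf hh ha

/-- Testing the difference of the representatives with itself reduces this to the Nemytskii
estimate. Consequently `a` maps bounded sequences that are Cauchy in `L²` to Cauchy sequences. -/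
theorem exists_norm_gradient_sub_le {R η : ℝ} (hR : 0 ≤ R) (hη : 0 < η) :
    ∃ K : ℝ, 0 ≤ K ∧ ∀ p p' : H, ‖p‖ ≤ R → ‖p'‖ ≤ R →
      ‖a p - a p'‖ ≤ η + K * ‖e.J p - e.J p'‖ := by
  obtain ⟨K, hK, hb⟩ := e.exists_nemytskii_sub_le hq hf hzero hinf hC hR hη
  refine ⟨K * C, by positivity, fun p p' hp hp' => ?_⟩
  set w := a p - a p'
  have h1 : inner ℝ w w = ∫ x, (f (e.fn p x) - f (e.fn p' x)) * e.fn w x ∂ν := by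
    change inner ℝ (a p - a p') w = _
    rw [inner_sub_left, ha, ha, ← integral_sub
      (e.integrable_source_mul hq hf hf0 hzero hinf hh hC p w)
      (e.integrable_source_mul hq hf hf0 hzero hinf hh hC p' w)]
    refine integral_congr_ae (Eventually.of_forall fun x => ?_)
    simp only
    ring
  have h2 := (le_abs_self _).trans (hb p p' w hp hp').2
  rw [← h1, real_inner_self_eq_norm_sq] at h2
  have h3 : K * (‖e.J p - e.J p'‖ * ‖e.J w‖) ≤ K * (‖e.J p - e.J p'‖ * (C * ‖w‖)) := by
    gcongr
    exact e.norm_J_le w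
  rcases (norm_nonneg w).eq_or_lt with h0 | h0
  · rw [← h0]
    positivity
  · refine le_of_mul_le_mul_right ?_ h0
    nlinarith

theorem continuous_gradient : Continuous a := by
  rw [Metric.continuous_iff]
  intro p ε hε
  obtain ⟨K, hK, hb⟩ := e.exists_norm_gradient_sub_le hC hq hf hf0 hzero hinf hh ha
    (R := ‖p‖ + 1) (by positivity) (half_pos hε)
  refine ⟨min 1 (ε / (2 * (K * C + 1))), by positivity, fun p' hp' => ?_⟩
  rw [dist_eq_norm] at hp' ⊢
  have h1 : ‖p'‖ ≤ ‖p‖ + 1 := by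
    have := norm_le_norm_add_norm_sub' p' p
    linarith [hp'.trans_le (min_le_left _ _)]
  refine (hb p' p h1 (by linarith)).trans_lt ?_
  rw [← map_sub]
  have h2 := e.norm_J_le (p' - p)
  have h3 := hp'.trans_le (min_le_right _ _)
  rw [lt_div_iff₀ (by positivity)] at h3
  have h4 : K * ‖e.J (p' - p)‖ ≤ K * (C * ‖p' - p‖) := by gcongr
  nlinarith [norm_nonneg (p' - p), mul_nonneg hK hC]

theorem exists_potential_remainder_le {R η : ℝ} (hR : 0 ≤ R) (hη : 0 < η) :
    ∃ K : ℝ, 0 ≤ K ∧ ∀ p p' : H, ‖p‖ ≤ R → ‖p'‖ ≤ R →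
      |e.potential f h p' - e.potential f h p - inner ℝ (a p) (p' - p)| ≤
        η * ‖p' - p‖ + K * ‖e.J (p' - p)‖ ^ 2 := by
  obtain ⟨K, hK, hb⟩ := e.exists_primitive_remainder_le hq hf hf0 hzero hinf hC hR hη
  refine ⟨K, hK, fun p p' hp hp' => ?_⟩
  have h1 : ∫ x, h x * e.fn (p' - p) x ∂ν =
      (∫ x, h x * e.fn p' x ∂ν) - ∫ x, h x * e.fn p x ∂ν := by
    rw [← integral_sub (e.integrable_mul hh p') (e.integrable_mul hh p)]
    refine integral_congr_ae ?_
    filter_upwards [e.fn_sub p' p] with x hx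
    rw [hx, Pi.sub_apply, mul_sub]
  rw [ha, e.integral_source_mul hq hf hf0 hzero hinf hh hC, h1, potential, potential]
  convert hb p p' hp hp' using 2
  ring

/-- The potential's remainder is `η‖d‖` with `η` arbitrary plus a multiple of `‖J d‖²`, which is
quadratic in `‖d‖`, as is the remainder of `½‖·‖²`. -/
theorem hasGradientAt_energy [CompleteSpace H] (p : H) :
    HasGradientAt (fun p => ‖p‖ ^ 2 / 2 - e.potential f h p) (p - a p) p := by
  rw [hasGradientAt_iff_isLittleO, isLittleO_iff]
  intro c hc
  obtain ⟨K, hK, hb⟩ := e.exists_potential_remainder_le hC hq hf hf0 hzero hinf hh ha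
    (R := ‖p‖ + 1) (by positivity) (half_pos hc)
  set M := K * C ^ 2 + 1 with hM
  have hM0 : 0 < M := by positivity
  filter_upwards [Metric.ball_mem_nhds p (show 0 < min 1 (c / (2 * M)) by positivity)] with p' hp'
  rw [Metric.mem_ball, dist_eq_norm] at hp'
  set d := p' - p with hd
  have h1 : ‖p'‖ ≤ ‖p‖ + 1 := by
    have := norm_le_norm_add_norm_sub' p' p
    linarith [hp'.trans_le (min_le_left _ _)]
  have h2 := hb p p' (by linarith) h1
  have h3 := hp'.trans_le (min_le_right _ _)
  rw [lt_div_iff₀ (by positivity)] at h3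
  have h4 : ‖e.J d‖ ^ 2 ≤ C ^ 2 * ‖d‖ ^ 2 := by
    rw [← mul_pow]
    gcongr
    exact e.norm_J_le d
  have h5 : ‖p'‖ ^ 2 = ‖p‖ ^ 2 + 2 * inner ℝ p d + ‖d‖ ^ 2 := by
    rw [← norm_add_sq_real, hd, add_sub_cancel]
  have h6 : ‖p'‖ ^ 2 / 2 - e.potential f h p' - (‖p‖ ^ 2 / 2 - e.potential f h p) -
      inner ℝ (p - a p) d = ‖d‖ ^ 2 / 2 -
        (e.potential f h p' - e.potential f h p - inner ℝ (a p) d) := by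
    rw [h5, inner_sub_left]
    ring
  rw [h6, Real.norm_eq_abs]
  have h7 : |‖d‖ ^ 2 / 2| = ‖d‖ ^ 2 / 2 := abs_of_nonneg (by positivity)
  refine (abs_sub _ _).trans ?_
  rw [h7]
  have h8 : K * ‖e.J d‖ ^ 2 ≤ K * (C ^ 2 * ‖d‖ ^ 2) := by gcongr
  have h9 : M * ‖d‖ ^ 2 ≤ c / 2 * ‖d‖ := by
    nlinarith [norm_nonneg d]
  rw [hM] at h9
  nlinarith [sq_nonneg ‖d‖]

/-- The potential is uniformly continuous on balls with respect to the `L²` norm. -/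
theorem exists_abs_potential_sub_le {R η : ℝ} (hR : 0 < R) (hη : 0 < η) :
    ∃ τ > 0, ∀ p p' : H, ‖p‖ ≤ R → ‖p'‖ ≤ R → ‖e.J p - e.J p'‖ < τ →
      |e.potential f h p - e.potential f h p'| ≤ η := by
  -- Two points of the ball are at distance at most `2R`, so each of the two terms with coefficient
  -- `η / (8R)` costs `η / 4`. The other half of `η` is left for the `L²` terms.
  obtain ⟨K, hK, hb⟩ := e.exists_potential_remainder_le hC hq hf hf0 hzero hinf hh ha hR.le
    (η := η / (8 * R)) (by positivity)
  obtain ⟨K', hK', hb'⟩ := e.exists_nemytskii_le hq hf hf0 hzero hinf hC hR.le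
    (η := η / (8 * R)) (by positivity)
  set N := (eLpNorm h 2 ν).toReal
  have hN : 0 ≤ N := ENNReal.toReal_nonneg
  refine ⟨min 1 (η / (2 * (K + K' + N + 1))), by positivity, fun p p' hp hp' hJ => ?_⟩
  set d := p - p' with hd
  rw [← map_sub] at hJ
  have h1 := hb p' p hp' hp
  have h2 : |inner ℝ (a p') d| ≤ η / (8 * R) * ‖d‖ + (K' + N) * ‖e.J d‖ := by
    rw [ha, e.integral_source_mul hq hf hf0 hzero hinf hh hC]
    refine (abs_add_le _ _).trans ?_
    linarith [(hb' p' d hp').2, e.abs_integral_mul_le hh d]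
  have h3 : ‖d‖ ≤ 2 * R := (norm_sub_le p p').trans (by linarith)
  have h4 : η / (8 * R) * ‖d‖ ≤ η / 4 := by
    calc η / (8 * R) * ‖d‖ ≤ η / (8 * R) * (2 * R) := by gcongr
      _ = η / 4 := by field_simp; ring
  have h5 := hJ.trans_le (min_le_left _ _)
  have h6 := hJ.trans_le (min_le_right _ _)
  rw [lt_div_iff₀ (by positivity)] at h6
  have h7 : ‖e.J d‖ ^ 2 ≤ ‖e.J d‖ := by nlinarith [norm_nonneg (e.J d)]
  have h8 : K * ‖e.J d‖ ^ 2 ≤ K * ‖e.J d‖ := by gcongr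
  have h9 : e.potential f h p - e.potential f h p' =
    (e.potential f h p - e.potential f h p' - inner ℝ (a p') d) + inner ℝ (a p') d := by ring
  rw [h9]
  refine (abs_add_le _ _).trans ?_
  nlinarith [norm_nonneg (e.J d)]

theorem exists_potential_le {R : ℝ} (hR : 0 ≤ R) :
    ∃ B : ℝ, ∀ p : H, ‖p‖ ≤ R → e.potential f h p ≤ B := by
  obtain ⟨K, hK, hb⟩ := e.exists_potential_remainder_le hC hq hf hf0 hzero hinf hh ha hR one_pos
  refine ⟨‖a 0‖ * R + R + K * (C * R) ^ 2, fun p hp => ?_⟩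
  have h1 := (le_abs_self _).trans (hb 0 p (by simpa using hR) hp)
  rw [e.potential_zero, sub_zero, sub_zero, one_mul] at h1
  have h2 := real_inner_le_norm (a 0) p
  have h3 : ‖a 0‖ * ‖p‖ ≤ ‖a 0‖ * R := by gcongr
  have h4 : K * ‖e.J p‖ ^ 2 ≤ K * (C * R) ^ 2 := by
    gcongr
    exact (e.norm_J_le p).trans (by gcongr)
  linarith

/-- The Ambrosetti–Rabinowitz condition at the level of the functional. -/
theorem le_inner_gradient {μ : ℝ} (hμ : 2 < μ)
    (hAR : ∀ t : ℝ, t ≠ 0 → 0 < μ * primitive f t ∧ μ * primitive f t ≤ t * f t) (p : H) :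
    μ * e.potential f h p - (μ - 1) * ((eLpNorm h 2 ν).toReal * (C * ‖p‖)) ≤
      inner ℝ (a p) p := by
  rw [ha, e.integral_source_mul hq hf hf0 hzero hinf hh hC, potential]
  have h1 : μ * ∫ x, primitive f (e.fn p x) ∂ν ≤ ∫ x, f (e.fn p x) * e.fn p x ∂ν := by
    rw [← integral_const_mul]
    refine integral_mono ((e.integrable_primitive hq hf hf0 hzero hinf p).const_mul μ)
      (e.integrable_nemytskii_mul hq hf hf0 hzero hinf hC p p) fun x => ?_
    rcases eq_or_ne (e.fn p x) 0 with h0 | h0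
    · simp [h0, primitive_zero]
    · simp only
      rw [mul_comm (f _)]
      exact (hAR _ h0).2
  -- The source enters `μ` times the potential with weight `μ` but the gradient pairing with weight
  -- `1`, which explains the coefficient `μ - 1`.
  have h2 := (le_abs_self _).trans (e.abs_integral_mul_le hh p)
  have h3 : (eLpNorm h 2 ν).toReal * ‖e.J p‖ ≤ (eLpNorm h 2 ν).toReal * (C * ‖p‖) := by
    gcongr
    exact e.norm_J_le p
  nlinarith

/-- The Palais–Smale condition. -/
theorem palais_smale [CompleteSpace H] (hJ : IsCompactOperator e.J) {μ : ℝ} (hμ : 2 < μ)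
    (hAR : ∀ t : ℝ, t ≠ 0 → 0 < μ * primitive f t ∧ μ * primitive f t ≤ t * f t)
    (u : ℕ → H) (B : ℝ) (hB : ∀ k, ‖u k‖ ^ 2 / 2 - e.potential f h (u k) ≤ B)
    (hg : Tendsto (fun k => u k - a (u k)) atTop (𝓝 0)) :
    ∃ (b : H) (φ : ℕ → ℕ), StrictMono φ ∧ Tendsto (u ∘ φ) atTop (𝓝 b) := by
  obtain ⟨G, hG⟩ : ∃ G, ∀ k, ‖u k - a (u k)‖ ≤ G := by
    obtain ⟨G, hG⟩ := (hg.norm.bddAbove_range)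
    exact ⟨G, fun k => hG ⟨k, rfl⟩⟩
  set N := (eLpNorm h 2 ν).toReal * C with hN
  have hN0 : 0 ≤ N := mul_nonneg ENNReal.toReal_nonneg hC
  have hG0 : 0 ≤ G := (norm_nonneg _).trans (hG 0)
  set θ := μ / 2 - 1 with hθ
  have hθ0 : 0 < θ := by rw [hθ]; linarith
  set D := G + (μ - 1) * N with hD
  have hD0 : 0 ≤ D := add_nonneg hG0 (mul_nonneg (by linarith) hN0)
  have hbound : ∀ k, ‖u k‖ ≤ (D + μ * |B|) / θ + 1 := by
    intro k
    have h1 := e.le_inner_gradient hC hq hf hf0 hzero hinf hh ha hμ hAR (u k)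
    have h2 : -(G * ‖u k‖) ≤ inner ℝ (u k - a (u k)) (u k) :=
      (neg_le_neg (mul_le_mul_of_nonneg_right (hG k) (norm_nonneg _))).trans
        (neg_le_of_abs_le (abs_real_inner_le_norm _ _))
    rw [inner_sub_left, real_inner_self_eq_norm_sq] at h2
    have h3 : μ * (‖u k‖ ^ 2 / 2 - e.potential f h (u k)) ≤ μ * |B| :=
      mul_le_mul_of_nonneg_left ((hB k).trans (le_abs_self B)) (by linarith)
    -- In `μ I(u) - ⟨I'(u), u⟩` the nonlinear terms have a favourable sign and the quadratic term
    -- keeps the coefficient `μ / 2 - 1 > 0`. An upper bound on the energy thus suffices.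
    have h4 : θ * ‖u k‖ ^ 2 ≤ D * ‖u k‖ + μ * |B| := by
      rw [hθ, hD, hN]
      nlinarith
    by_contra! hcon
    have h5 : (D + μ * |B|) / θ < ‖u k‖ - 1 := by linarith
    rw [div_lt_iff₀ hθ0] at h5
    have h6 : 0 ≤ μ * |B| := mul_nonneg (by linarith) (abs_nonneg _)
    have h7 : 0 ≤ (D + μ * |B|) / θ := by positivity
    have h8 : 1 < ‖u k‖ := by linarith
    nlinarith [mul_lt_mul_of_pos_right h5 (zero_lt_one.trans h8)]
  set R := (D + μ * |B|) / θ + 1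
  have hR : 0 ≤ R := (norm_nonneg _).trans (hbound 0)
  obtain ⟨φ, hφ, hcau⟩ := exists_subseq_cauchySeq hJ hbound
  have hacau : CauchySeq fun k => a (u (φ k)) := by
    rw [Metric.cauchySeq_iff]
    intro ε hε
    obtain ⟨K, hK, hb⟩ := e.exists_norm_gradient_sub_le hC hq hf hf0 hzero hinf hh ha hR
      (half_pos hε)
    obtain ⟨M, hM⟩ := Metric.cauchySeq_iff.1 hcau (ε / (2 * (K + 1))) (by positivity)
    refine ⟨M, fun i hi j hj => ?_⟩
    have h1 := hM i hi j hj
    rw [dist_eq_norm] at h1 ⊢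
    rw [lt_div_iff₀ (by positivity)] at h1
    refine (hb _ _ (hbound _) (hbound _)).trans_lt ?_
    nlinarith [norm_nonneg (e.J (u (φ i)) - e.J (u (φ j)))]
  obtain ⟨b, hb⟩ := cauchySeq_tendsto_of_complete hacau
  refine ⟨b, φ, hφ, ?_⟩
  -- Since `u = (u - a u) + a u`, convergence of `a u` along the subsequence gives convergence of
  -- `u`.
  have := (hg.comp hφ.tendsto_atTop).add hb
  rw [zero_add] at this
  refine this.congr fun k => ?_
  simp

end Growth

/-- The energy is non-positive far away on the ray through a non-zero element. -/
theorem exists_energy_nonpos (hq : 0 < q) (hf : Continuous f) (hf0 : f 0 = 0)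
    (hzero : f =o[𝓝 0] fun t => |t|) (hinf : f =o[cocompact ℝ] fun t => |t| ^ q) {μ : ℝ} (hμ : 2 < μ)
    (hAR : ∀ t : ℝ, t ≠ 0 → 0 < μ * primitive f t ∧ μ * primitive f t ≤ t * f t) {p : H}
    (hp : ¬ e.fn p =ᵐ[ν] 0) (r : ℝ) :
    ∃ b : H, r < ‖b‖ ∧ ‖b‖ ^ 2 / 2 - e.potential f h b ≤ 0 := by
  have hμ0 : 0 < μ := by linarith
  have hF0 : ∀ t, 0 ≤ primitive f t := fun t => by
    rcases eq_or_ne t 0 with rfl | ht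
    · rw [primitive_zero]
    · exact (pos_of_mul_pos_right (hAR t ht).1 hμ0.le).le
  have hi := e.integrable_primitive hq hf hf0 hzero hinf p
  have hP : 0 < ∫ x, primitive f (e.fn p x) ∂ν := by
    refine (integral_nonneg fun x => hF0 _).lt_of_ne' fun h0 => hp ?_
    rw [integral_eq_zero_iff_of_nonneg (fun x => hF0 _) hi] at h0
    filter_upwards [h0] with x hx
    by_contra hne
    exact (pos_of_mul_pos_right (hAR _ hne).1 hμ0.le).ne' hx
  set P := ∫ x, primitive f (e.fn p x) ∂ν
  set L := ∫ x, h x * e.fn p x ∂ν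
  have hpn : 0 < ‖p‖ := norm_pos_iff.2 fun h0 => hp (h0 ▸ e.fn_zero)
  -- Along the ray the nonlinear part is at least `s^μ P`. After division by `s²` it outgrows the
  -- quadratic term and the source, because `μ > 2`.
  have hlim : Tendsto (fun s : ℝ => s ^ (μ - 2) * P) atTop atTop :=
    (tendsto_rpow_atTop (by linarith)).atTop_mul_const hP
  obtain ⟨s, hs1, hs2, hs3⟩ := ((eventually_ge_atTop (1 : ℝ)).and
    ((hlim.eventually_ge_atTop (‖p‖ ^ 2 / 2 + |L|)).and (eventually_gt_atTop (r / ‖p‖)))).exists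
  have hs0 : 0 < s := one_pos.trans_le hs1
  refine ⟨s • p, ?_, ?_⟩
  · rw [norm_smul, Real.norm_of_nonneg hs0.le]
    rwa [div_lt_iff₀ hpn] at hs3
  have h1 : s ^ μ * P ≤ ∫ x, primitive f (e.fn (s • p) x) ∂ν := by
    rw [← integral_const_mul]
    refine integral_mono_ae (hi.const_mul _)
      (e.integrable_primitive hq hf hf0 hzero hinf (s • p)) ?_
    filter_upwards [e.fn_smul s p] with x hx
    rw [hx, Pi.smul_apply, smul_eq_mul]
    exact rpow_mul_primitive_le hf hAR _ hs1
  have h2 : ∫ x, h x * e.fn (s • p) x ∂ν = s * L := by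
    rw [← integral_const_mul]
    refine integral_congr_ae ?_
    filter_upwards [e.fn_smul s p] with x hx
    rw [hx, Pi.smul_apply, smul_eq_mul]
    ring
  have h3 : s ^ μ = s ^ 2 * s ^ (μ - 2) := by
    rw [← Real.rpow_natCast, ← Real.rpow_add hs0]
    congr 1
    push_cast
    ring
  rw [potential, h2, norm_smul, Real.norm_of_nonneg hs0.le]
  have h4 : -(s * L) ≤ s ^ 2 * |L| := by
    have : s * |L| ≤ s ^ 2 * |L| := by
      gcongr
      nlinarith
    nlinarith [neg_abs_le L]
  have h5 : s ^ 2 * (‖p‖ ^ 2 / 2 + |L|) ≤ s ^ 2 * (s ^ (μ - 2) * P) := by gcongr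
  rw [h3] at h1
  nlinarith

/-- Two critical points: one at the mountain pass level, one minimising on a ball. -/
theorem exists_two_critical [CompleteSpace H] (hC : 0 ≤ C) (hq : 0 < q) (hf : Continuous f)
    (hf0 : f 0 = 0) (hzero : f =o[𝓝 0] fun t => |t|) (hinf : f =o[cocompact ℝ] fun t => |t| ^ q)
    (hh : MemLp h 2 ν) (hJ : IsCompactOperator e.J) {μ : ℝ} (hμ : 2 < μ)
    (hAR : ∀ t : ℝ, t ≠ 0 → 0 < μ * primitive f t ∧ μ * primitive f t ≤ t * f t) {r β : ℝ}
    (hr : 0 < r) (hβ : 0 < β)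
    (hsphere : ∀ p : H, ‖p‖ = r → β ≤ ‖p‖ ^ 2 / 2 - e.potential f h p) {p₀ : H}
    (hp₀ : ¬ e.fn p₀ =ᵐ[ν] 0) :
    ∃ p₁ p₂ : H,
      (∀ w, inner ℝ p₁ w = ∫ x, (f (e.fn p₁ x) + h x) * e.fn w x ∂ν) ∧
      HasGradientAt (fun p => ‖p‖ ^ 2 / 2 - e.potential f h p) 0 p₁ ∧
      0 < ‖p₁‖ ^ 2 / 2 - e.potential f h p₁ ∧
      IsGLB {m : ℝ | ∃ γ : C(unitInterval, H), γ 0 = 0 ∧ r < ‖γ 1‖ ∧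
        ‖γ 1‖ ^ 2 / 2 - e.potential f h (γ 1) ≤ 0 ∧
        IsGreatest (Set.range fun t => ‖γ t‖ ^ 2 / 2 - e.potential f h (γ t)) m}
        (‖p₁‖ ^ 2 / 2 - e.potential f h p₁) ∧
      (∀ w, inner ℝ p₂ w = ∫ x, (f (e.fn p₂ x) + h x) * e.fn w x ∂ν) ∧
      HasGradientAt (fun p => ‖p‖ ^ 2 / 2 - e.potential f h p) 0 p₂ ∧ ‖p₂‖ < r ∧
      (∀ w, ‖w‖ ≤ r → ‖p₂‖ ^ 2 / 2 - e.potential f h p₂ ≤ ‖w‖ ^ 2 / 2 - e.potential f h w) ∧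
      ‖p₂‖ ^ 2 / 2 - e.potential f h p₂ ≤ 0 := by
  choose a ha using e.exists_riesz hq hf hf0 hzero hinf hh hC
  have hgrad := e.hasGradientAt_energy hC hq hf hf0 hzero hinf hh ha
  have hac := e.continuous_gradient hC hq hf hf0 hzero hinf hh ha
  obtain ⟨b, hb, hIb⟩ := e.exists_energy_nonpos hq hf hf0 hzero hinf hμ hAR hp₀ r (h := h)
  obtain ⟨p₁, hp₁, hβ₁, hglb⟩ := mountain_pass hgrad (continuous_id.sub hac)
    (by simp [e.potential_zero]) hr hβ hsphere hb hIb
    (e.palais_smale hC hq hf hf0 hzero hinf hh ha hJ hμ hAR)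
  have hIc : Continuous fun p => ‖p‖ ^ 2 / 2 - e.potential f h p :=
    continuous_iff_continuousAt.2 fun u => (hgrad u).continuousAt
  have hpc : Continuous (e.potential f h) := by
    have h1 : Continuous fun p : H => ‖p‖ ^ 2 / 2 - (‖p‖ ^ 2 / 2 - e.potential f h p) :=
      (by fun_prop : Continuous fun p : H => ‖p‖ ^ 2 / 2).sub hIc
    simpa using h1
  obtain ⟨B, hB⟩ := e.exists_potential_le hC hq hf hf0 hzero hinf hh ha hr.le
  obtain ⟨p₂, hp₂, hmin⟩ := exists_min_closedBall hJ hpc hr hB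
    fun η hη => e.exists_abs_potential_sub_le hC hq hf hf0 hzero hinf hh ha hr hη
  have hneg : ‖p₂‖ ^ 2 / 2 - e.potential f h p₂ ≤ 0 := by
    simpa [e.potential_zero] using hmin 0 (by simpa using hr.le)
  -- On the sphere the energy is at least `β > 0`, but the minimum is at most the value `0` at the
  -- origin. The minimiser is thus interior and its gradient vanishes.
  have hlt : ‖p₂‖ < r := hp₂.lt_of_ne fun h0 => by linarith [hsphere p₂ h0]
  have hg₂ : p₂ - a p₂ = 0 := by
    have hloc : IsLocalMin (fun p => ‖p‖ ^ 2 / 2 - e.potential f h p) p₂ := by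
      filter_upwards [(isOpen_lt continuous_norm continuous_const).mem_nhds hlt] with w hw
      exact hmin w (le_of_lt hw)
    have h1 := hloc.hasFDerivAt_eq_zero (hgrad p₂).hasFDerivAt
    exact (InnerProductSpace.toDual ℝ H).map_eq_zero_iff.1 h1
  have hg₁ : p₁ - a p₁ = 0 := hp₁
  refine ⟨p₁, p₂, fun w => ?_, ?_, hβ.trans_le hβ₁, hglb, fun w => ?_, ?_, hlt, hmin, hneg⟩
  · rw [← ha, ← sub_eq_zero.1 hg₁]
  · exact hg₁ ▸ hgrad p₁
  · rw [← ha, ← sub_eq_zero.1 hg₂]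
  · exact hg₂ ▸ hgrad p₂

end LebesgueEmbedding

end FracSchrodinger

/-! ### Transfer between the Hilbert space and functions -/

namespace FracSchrodinger

/-- Upper bound for the potential under an explicit growth condition. -/
theorem LebesgueEmbedding.potential_le {H : Type*} [NormedAddCommGroup H] [InnerProductSpace ℝ H]
    {F : Type*} [NormedAddCommGroup F] [NormedSpace ℝ F]
    {X : Type*} [MeasurableSpace X] {ν : Measure X} {q C : ℝ} (e : LebesgueEmbedding H F ν q C)
    {f : ℝ → ℝ} {h : X → ℝ} (hC : 0 ≤ C) (hq : 0 < q) (hf : Continuous f) (hh : MemLp h 2 ν)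
    {A B : ℝ} (hA : 0 ≤ A) (hB : 0 ≤ B) (hg : ∀ t, |f t| ≤ A * |t| + B * |t| ^ q) (p : H) :
    e.potential f h p ≤ A * (C * ‖p‖) ^ 2 + B * (C * ‖p‖) ^ (q + 1) +
      (eLpNorm h 2 ν).toReal * (C * ‖p‖) := by
  have h1 := integral_abs_mul_abs_le (e.memLp_two p) (e.memLp_two p)
  have h2 := integral_rpow_mul_le hq (e.memLp_crit p) (e.memLp_crit p)
  have h3 := (le_abs_self _).trans (e.abs_integral_mul_le hh p)
  have hbound : ∀ x, |primitive f (e.fn p x)| ≤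
      A * (|e.fn p x| * |e.fn p x|) + B * (|e.fn p x| ^ q * |e.fn p x|) := fun x => by
    refine (abs_primitive_le hf hq hA hB hg _).trans_eq ?_
    rw [← sq_abs (e.fn p x), sq]
  have hi : Integrable (fun x => A * (|e.fn p x| * |e.fn p x|) +
      B * (|e.fn p x| ^ q * |e.fn p x|)) ν := (h1.1.const_mul A).add (h2.1.const_mul B)
  have hF : Integrable (fun x => primitive f (e.fn p x)) ν :=
    hi.mono' ((continuous_primitive hf).comp_aestronglyMeasurable (e.aestronglyMeasurable_fn p))
      (Eventually.of_forall hbound)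
  have h4 : ∫ x, primitive f (e.fn p x) ∂ν ≤ A * (∫ x, |e.fn p x| * |e.fn p x| ∂ν) +
      B * ∫ x, |e.fn p x| ^ q * |e.fn p x| ∂ν := by
    rw [← integral_const_mul, ← integral_const_mul,
      ← integral_add (h1.1.const_mul A) (h2.1.const_mul B)]
    exact integral_mono hF hi fun x => (le_abs_self _).trans (hbound x)
  have hJ := e.norm_J_le p
  have hc := e.crit_le p
  have h0 : 0 ≤ C * ‖p‖ := by positivity
  have h5 : ∫ x, |e.fn p x| * |e.fn p x| ∂ν ≤ (C * ‖p‖) ^ 2 := by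
    refine h1.2.trans ?_
    rw [← e.norm_J, sq]
    gcongr
  have h6 : ∫ x, |e.fn p x| ^ q * |e.fn p x| ∂ν ≤ (C * ‖p‖) ^ (q + 1) := by
    refine h2.2.trans ?_
    rw [Real.rpow_add_one' h0 (by linarith)]
    gcongr
  have h7 : (eLpNorm h 2 ν).toReal * ‖e.J p‖ ≤ (eLpNorm h 2 ν).toReal * (C * ‖p‖) := by gcongr
  have h8 := mul_le_mul_of_nonneg_left h5 hA
  have h9 := mul_le_mul_of_nonneg_left h6 hB
  rw [potential]
  linarith

section Transfer

variable {n : ℕ} {α : ℝ} {V : E n → ℝ} {V₀ : ℝ}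

/-- The embedding of `H^α_V` into `L² ∩ L^{2*}`. -/
noncomputable def embedding (hα : 0 < α) (hn : 2 * α < n) (hVc : Continuous V) (hV₀ : 0 < V₀)
    (hV : ∀ x, V₀ ≤ V x) :
    LebesgueEmbedding (energySpace n α V) (Lp ℝ 2 (volume : Measure (E n)))
      (volume : Measure (E n)) (growthExp n α) (sobolevConst α V) where
  fn := fn
  J := toL2 hVc hV₀ hV
  fn_add := fn_add
  fn_smul := fn_smul
  memLp_two := memLp_fn hVc hV₀ hV
  memLp_crit p := by
    rw [growthExp_add_one hn]
    exact ⟨aestronglyMeasurable_fn hVc p, (eLpNorm_le_sobolevConst hα hn hV₀ hV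
      (memHV_fn hVc hV₀ hV p)).2.trans_lt ENNReal.ofReal_lt_top⟩
  norm_J p := by
    rw [Lp.norm_def, eLpNorm_congr_ae (coeFn_toL2 hVc hV₀ hV p)]
  norm_J_le p := by
    rw [Lp.norm_def, eLpNorm_congr_ae (coeFn_toL2 hVc hV₀ hV p),
      ← normV_fn fun x => hV₀.trans_le (hV x)]
    exact ENNReal.toReal_le_of_le_ofReal (mul_nonneg sobolevConst_nonneg (Real.sqrt_nonneg _))
      (eLpNorm_le_sobolevConst hα hn hV₀ hV (memHV_fn hVc hV₀ hV p)).1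
  crit_le p := by
    rw [growthExp_add_one hn, ← normV_fn fun x => hV₀.trans_le (hV x)]
    exact ENNReal.toReal_le_of_le_ofReal (mul_nonneg sobolevConst_nonneg (Real.sqrt_nonneg _))
      (eLpNorm_le_sobolevConst hα hn hV₀ hV (memHV_fn hVc hV₀ hV p)).2

theorem energy_congr {f : ℝ → ℝ} {h u w : E n → ℝ} (huw : u =ᵐ[volume] w) :
    energy α V f h u = energy α V f h w := by
  have h1 : ∫ x, primitive f (u x) = ∫ x, primitive f (w x) := by
    refine integral_congr_ae ?_
    filter_upwards [huw] with x hx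
    rw [hx]
  have h2 : ∫ x, h x * u x = ∫ x, h x * w x := by
    refine integral_congr_ae ?_
    filter_upwards [huw] with x hx
    rw [hx]
  rw [energy, energy, normV_congr huw, h1, h2]

theorem energy_fn (hα : 0 < α) (hn : 2 * α < n) (hVc : Continuous V) (hV₀ : 0 < V₀)
    (hV : ∀ x, V₀ ≤ V x) (f : ℝ → ℝ) (h : E n → ℝ) (p : energySpace n α V) :
    energy α V f h (fn p) = ‖p‖ ^ 2 / 2 - (embedding hα hn hVc hV₀ hV).potential f h p := by
  rw [energy, normV_fn fun x => hV₀.trans_le (hV x), LebesgueEmbedding.potential, sub_sub]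
  rfl

theorem isWeakSolution_fn (hVc : Continuous V) (hV₀ : 0 < V₀) (hV : ∀ x, V₀ ≤ V x) {f : ℝ → ℝ}
    {h : E n → ℝ} {p : energySpace n α V}
    (hi : ∀ w : energySpace n α V, Integrable (fun x => (f (fn p x) + h x) * fn w x) volume)
    (hp : ∀ w : energySpace n α V, inner ℝ p w = ∫ x, (f (fn p x) + h x) * fn w x) :
    IsWeakSolution α V f h (fn p) := by
  have hpos : ∀ x, 0 < V x := fun x => hV₀.trans_le (hV x)
  refine ⟨memHV_fn hVc hV₀ hV p, fun w hw => ?_⟩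
  obtain ⟨w', hw'⟩ := exists_fn_eq hVc hpos hw
  have hae : (fun x => (f (fn p x) + h x) * fn w' x) =ᵐ[volume]
      fun x => (f (fn p x) + h x) * w x := by
    filter_upwards [hw'] with x hx
    rw [hx]
  refine ⟨(hi w').congr hae, ?_⟩
  rw [← integral_congr_ae hae, ← hp, inner_eq_innerV hpos]
  exact innerV_congr EventuallyEq.rfl hw'.symm

/-- Every admissible increment is represented by an element of the same norm, and the energy ignores
null sets, so the little-o estimate transfers directly. -/
theorem isCriticalPt_fn (hVc : Continuous V) (hV₀ : 0 < V₀)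
    (hV : ∀ x, V₀ ≤ V x) {f : ℝ → ℝ} {h : E n → ℝ} {p : energySpace n α V}
    (hp : HasGradientAt (fun p : energySpace n α V => energy α V f h (fn p)) 0 p) :
    IsCriticalPt α V f h (fn p) := by
  have hpos : ∀ x, 0 < V x := fun x => hV₀.trans_le (hV x)
  refine ⟨memHV_fn hVc hV₀ hV p, fun c hc => ?_⟩
  rw [hasGradientAt_iff_isLittleO, isLittleO_iff] at hp
  obtain ⟨r, hr, hball⟩ := Metric.eventually_nhds_iff.1 (hp hc)
  refine ⟨r, hr, fun w hw hwr => ?_⟩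
  obtain ⟨w', hw'⟩ := exists_fn_eq hVc hpos hw
  have hn : normV α V w = ‖w'‖ := by rw [← normV_fn hpos, normV_congr hw']
  have h1 := @hball (p + w') (by rw [dist_eq_norm, add_sub_cancel_left, ← hn]; exact hwr)
  have h2 : energy α V f h (fn (p + w')) = energy α V f h (fn p + w) := by
    refine energy_congr ?_
    filter_upwards [fn_add p w', hw'] with x h3 h4
    rw [h3, Pi.add_apply, h4, Pi.add_apply]
  rw [add_sub_cancel_left, inner_zero_left, sub_zero, h2, Real.norm_eq_abs, ← hn] at h1
  exact h1

/-- The path of functions represented by a path in the energy space. -/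
noncomputable def fnPath (γ : C(unitInterval, energySpace n α V)) (t : ℝ) : E n → ℝ :=
  fn (γ (Set.projIcc 0 1 zero_le_one t))

theorem fnPath_coe (γ : C(unitInterval, energySpace n α V)) (t : unitInterval) :
    fnPath γ t = fn (γ t) := by
  rw [fnPath, Set.projIcc_val]

theorem normV_fnPath_sub (hpos : ∀ x, 0 < V x) (γ : C(unitInterval, energySpace n α V)) (s t : ℝ) :
    normV α V (fnPath γ s - fnPath γ t) =
      ‖γ (Set.projIcc 0 1 zero_le_one s) - γ (Set.projIcc 0 1 zero_le_one t)‖ :=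
  (normV_congr (fn_sub _ _).symm).trans (normV_fn hpos _)

theorem isMountainPath_fnPath (hVc : Continuous V) (hV₀ : 0 < V₀) (hV : ∀ x, V₀ ≤ V x)
    {f : ℝ → ℝ} {h : E n → ℝ} {r : ℝ} {γ : C(unitInterval, energySpace n α V)} (h0 : γ 0 = 0)
    (h1 : r < ‖γ 1‖) (hE : energy α V f h (fn (γ 1)) ≤ 0) :
    IsMountainPath α V f h r (fnPath γ) := by
  have hpos : ∀ x, 0 < V x := fun x => hV₀.trans_le (hV x)
  have hv0 : fnPath γ 0 = fn (γ 0) := fnPath_coe γ 0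
  have hv1 : fnPath γ 1 = fn (γ 1) := fnPath_coe γ 1
  refine ⟨fun t _ => memHV_fn hVc hV₀ hV _, fun t _ => ?_, ?_, ?_, ?_⟩
  · simp_rw [normV_fnPath_sub hpos]
    have hc' : Continuous fun s : ℝ => γ (Set.projIcc 0 1 zero_le_one s) :=
      γ.continuous.comp continuous_projIcc
    exact (tendsto_iff_norm_sub_tendsto_zero.1 (hc'.tendsto t)).mono_left nhdsWithin_le_nhds
  · rw [hv0, h0]
    exact fn_zero
  · rw [hv1, normV_fn hpos]
    exact h1
  · rw [hv1]
    exact hE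

/-- Representatives can be chosen independently for each `t`: the correspondence preserves norms of
differences, so continuity carries over. -/
theorem exists_path_lift (hVc : Continuous V) (hpos : ∀ x, 0 < V x)
    {f : ℝ → ℝ} {h : E n → ℝ} {r : ℝ} {γ : ℝ → E n → ℝ} (hγ : IsMountainPath α V f h r γ) :
    ∃ P : C(unitInterval, energySpace n α V), ∀ t : unitInterval, fn (P t) =ᵐ[volume] γ t := by
  choose P hP using fun t : unitInterval => exists_fn_eq hVc hpos (hγ.1 t t.2)
  have hnorm : ∀ s t : unitInterval, ‖P s - P t‖ = normV α V (γ s - γ t) := fun s t => by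
    rw [← normV_fn hpos]
    refine normV_congr ?_
    filter_upwards [fn_sub (P s) (P t), hP s, hP t] with x h2 h3 h4
    rw [h2, Pi.sub_apply, h3, h4, Pi.sub_apply]
  have hPc : Continuous P := by
    refine continuous_iff_continuousAt.2 fun t => ?_
    rw [ContinuousAt, tendsto_iff_norm_sub_tendsto_zero]
    simp_rw [hnorm]
    exact (hγ.2.1 t t.2).comp (tendsto_nhdsWithin_iff.2
      ⟨continuous_subtype_val.tendsto t, Eventually.of_forall fun s => s.2⟩)
  exact ⟨⟨P, hPc⟩, hP⟩

/-- The mountain pass level in terms of paths in the energy space. -/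
theorem isMountainPassLevel_of_isGLB (hVc : Continuous V) (hV₀ : 0 < V₀)
    (hV : ∀ x, V₀ ≤ V x) {f : ℝ → ℝ} {h : E n → ℝ} {r c : ℝ}
    (hc : IsGLB {m : ℝ | ∃ γ : C(unitInterval, energySpace n α V), γ 0 = 0 ∧ r < ‖γ 1‖ ∧
        energy α V f h (fn (γ 1)) ≤ 0 ∧
        IsGreatest (Set.range fun t => energy α V f h (fn (γ t))) m} c) :
    IsMountainPassLevel α V f h r c := by
  have hpos : ∀ x, 0 < V x := fun x => hV₀.trans_le (hV x)
  constructor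
  · rintro m ⟨γ, hγ, hm⟩
    obtain ⟨P, hP⟩ := exists_path_lift hVc hpos hγ
    have hEP : ∀ t : unitInterval, energy α V f h (fn (P t)) = energy α V f h (γ t) :=
      fun t => energy_congr (hP t)
    have hP1 : ‖P 1‖ = normV α V (γ 1) := (normV_fn hpos _).symm.trans (normV_congr (hP 1))
    refine hc.1 ⟨P, fn_ext hpos ((hP 0).trans (hγ.2.2.1.trans fn_zero.symm)),
      hP1 ▸ hγ.2.2.2.1, (hEP 1).trans_le hγ.2.2.2.2, ?_⟩
    simp_rw [hEP]
    rwa [Set.image_eq_range] at hm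
  · intro b hb
    refine hc.2 ?_
    rintro m ⟨γ, h0, h1, hE, hm⟩
    refine hb ⟨fnPath γ, isMountainPath_fnPath hVc hV₀ hV h0 h1 hE, ?_⟩
    rw [Set.image_eq_range]
    have : (fun t : Set.Icc (0 : ℝ) 1 => energy α V f h (fnPath γ t)) =
        fun t : unitInterval => energy α V f h (fn (γ t)) := by
      funext t
      rw [fnPath_coe]
    rwa [this]

end Transfer

end FracSchrodinger

/-! ### The existence theorem -/

theorem theorem1p1 (n : ℕ) (hn : 2 ≤ n) (α : ℝ) (hα0 : 0 < α) (hα1 : α < 1)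
    (V : FracSchrodinger.E n → ℝ) (hVcont : Continuous V)
    (V₀ : ℝ) (hV₀ : 0 < V₀) (hV : ∀ x, V₀ ≤ V x)
    (hVinf : Tendsto V (cocompact (FracSchrodinger.E n)) atTop)
    (f : ℝ → ℝ) (hfcont : Continuous f) (hf0 : f 0 = 0)
    (hfzero : f =o[𝓝 0] fun t => |t|)
    (hfinf : f =o[cocompact ℝ] fun t => |t| ^ FracSchrodinger.growthExp n α)
    (μ : ℝ) (hμ : 2 < μ)
    (hAR : ∀ t : ℝ, t ≠ 0 → 0 < μ * FracSchrodinger.primitive f t ∧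
      μ * FracSchrodinger.primitive f t ≤ t * f t)
    (ε : ℝ) (hε : 0 < ε) (hεC : ε < 1 / (2 * FracSchrodinger.sobolevConst α V ^ 2))
    (δ ρ : ℝ) (hδ : 0 < δ) (hδρ : δ ≤ ρ)
    (hfδ : ∀ t : ℝ, |t| ≤ δ → |f t| ≤ ε * |t|)
    (hfρ : ∀ t : ℝ, ρ ≤ |t| → |f t| ≤ ε * |t| ^ FracSchrodinger.growthExp n α)
    (r : ℝ) (hr : 0 < r)
    (h : FracSchrodinger.E n → ℝ) (hL2 : MemLp h 2 volume) (hne : ¬ h =ᵐ[volume] 0)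
    (hsmall : (eLpNorm h 2 volume).toReal <
      r / FracSchrodinger.sobolevConst α V *
        (1 / 2 - ε * FracSchrodinger.sobolevConst α V ^ 2
          - (ε + FracSchrodinger.growthConst f (FracSchrodinger.growthExp n α) δ ρ)
            * FracSchrodinger.sobolevConst α V ^ FracSchrodinger.critExp n α
            * r ^ (FracSchrodinger.critExp n α - 2))) :
    ∃ u₁ u₂ : FracSchrodinger.E n → ℝ,
      FracSchrodinger.IsWeakSolution α V f h u₁ ∧
      FracSchrodinger.IsWeakSolution α V f h u₂ ∧
      ¬ u₁ =ᵐ[volume] u₂ ∧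
      FracSchrodinger.IsCriticalPt α V f h u₁ ∧
      FracSchrodinger.IsMountainPassLevel α V f h r (FracSchrodinger.energy α V f h u₁) ∧
      0 < FracSchrodinger.energy α V f h u₁ ∧
      FracSchrodinger.IsCriticalPt α V f h u₂ ∧
      FracSchrodinger.normV α V u₂ < r ∧
      (∀ w : FracSchrodinger.E n → ℝ, FracSchrodinger.MemHV α V w →
        FracSchrodinger.normV α V w ≤ r →
        FracSchrodinger.energy α V f h u₂ ≤ FracSchrodinger.energy α V f h w) ∧
      FracSchrodinger.energy α V f h u₂ ≤ 0 := by
  have hn2 : 2 * α < n := by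
    have : (2 : ℝ) ≤ n := by exact_mod_cast hn
    linarith
  have hpos : ∀ x, 0 < V x := fun x => hV₀.trans_le (hV x)
  set C := FracSchrodinger.sobolevConst α V with hCdef
  have hC : 0 < C := FracSchrodinger.sobolevConst_pos hα0 hα1 hn2 hVcont hV₀ hV
  set q := FracSchrodinger.growthExp n α with hqdef
  have hqp : q + 1 = FracSchrodinger.critExp n α := FracSchrodinger.growthExp_add_one hn2
  have hp2 := FracSchrodinger.two_lt_critExp hα0 hn2
  have hq : 0 < q := by linarith
  set K := FracSchrodinger.growthConst f q δ ρ with hKdef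
  have hK : 0 ≤ K := FracSchrodinger.growthConst_nonneg hδ
  set e := FracSchrodinger.embedding hα0 hn2 hVcont hV₀ hV with he
  have henergy : ∀ p, FracSchrodinger.energy α V f h (FracSchrodinger.fn p) =
      ‖p‖ ^ 2 / 2 - e.potential f h p := FracSchrodinger.energy_fn hα0 hn2 hVcont hV₀ hV f h
  -- Expanded, `β` is precisely the lower bound for the energy on the sphere given by the growth
  -- estimate; it is positive by the smallness of `h`.
  set β := r * C * (r / C * (1 / 2 - ε * C ^ 2 - (ε + K) * C ^ FracSchrodinger.critExp n α *
    r ^ (FracSchrodinger.critExp n α - 2)) - (eLpNorm h 2 volume).toReal) with hβdef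
  have hβ : 0 < β := mul_pos (mul_pos hr hC) (sub_pos.2 hsmall)
  have hsphere : ∀ p : FracSchrodinger.energySpace n α V, ‖p‖ = r →
      β ≤ ‖p‖ ^ 2 / 2 - e.potential f h p := by
    intro p hp
    have h1 := e.potential_le hC.le hq hfcont hL2 hε.le (add_nonneg hε.le hK)
      (FracSchrodinger.abs_le_of_growth hfcont hq hε hδ hfδ hfρ) p
    rw [hqp, hp, Real.mul_rpow hC.le hr.le] at h1
    have h2 : r ^ FracSchrodinger.critExp n α =
        r ^ 2 * r ^ (FracSchrodinger.critExp n α - 2) := by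
      rw [← Real.rpow_natCast, ← Real.rpow_add hr]
      congr 1
      push_cast
      ring
    rw [h2] at h1
    have h3 : β = r ^ 2 / 2 - (ε * (C * r) ^ 2 + (ε + K) * (C ^ FracSchrodinger.critExp n α *
        (r ^ 2 * r ^ (FracSchrodinger.critExp n α - 2))) +
        (eLpNorm h 2 volume).toReal * (C * r)) := by
      rw [hβdef]
      field_simp
      ring
    rw [hp, h3]
    linarith
  have hnz : n ≠ 0 := by omega
  -- Any nonzero element would do as the direction in which the energy becomes nonpositive; the hat
  -- function provides one.
  obtain ⟨p₀, hp₀⟩ := FracSchrodinger.exists_fn_eq hVcont hpos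
    (FracSchrodinger.memHV_hat (V := V) hnz hα0 hα1 hVcont)
  obtain ⟨p₁, p₂, hw₁, hg₁, hpos₁, hglb, hw₂, hg₂, hlt, hmin, hneg⟩ :=
    e.exists_two_critical hC.le hq hfcont hf0 hfzero hfinf hL2
      (FracSchrodinger.isCompactOperator_toL2 hα0 hVcont hV₀ hV hVinf) hμ hAR hr hβ hsphere
      (p₀ := p₀) (fun h0 => FracSchrodinger.hat_not_ae_zero (hp₀.symm.trans h0))
  have hi := e.integrable_source_mul hq hfcont hf0 hfzero hfinf hL2 hC.le
  simp_rw [← henergy] at hg₁ hpos₁ hglb hg₂ hmin hneg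
  refine ⟨FracSchrodinger.fn p₁, FracSchrodinger.fn p₂,
    FracSchrodinger.isWeakSolution_fn hVcont hV₀ hV (hi p₁) hw₁,
    FracSchrodinger.isWeakSolution_fn hVcont hV₀ hV (hi p₂) hw₂, fun h12 => ?_,
    FracSchrodinger.isCriticalPt_fn hVcont hV₀ hV hg₁,
    FracSchrodinger.isMountainPassLevel_of_isGLB hVcont hV₀ hV hglb, hpos₁,
    FracSchrodinger.isCriticalPt_fn hVcont hV₀ hV hg₂,
    (FracSchrodinger.normV_fn hpos p₂).trans_lt hlt, fun w hw hwr => ?_, hneg⟩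
  -- The solutions differ because one energy is positive and the other is not.
  · rw [FracSchrodinger.energy_congr h12] at hpos₁
    exact absurd hneg (not_le.2 hpos₁)
  · obtain ⟨w', hw'⟩ := FracSchrodinger.exists_fn_eq hVcont hpos hw
    rw [← FracSchrodinger.energy_congr hw']
    refine hmin w' ?_
    rw [← FracSchrodinger.normV_fn hpos, FracSchrodinger.normV_congr hw']
    exact hwr
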